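/- **Setting.** Let $s\in(1,2)$, $\mathfrak b=3-2s\in(-1,1)$, $d_s=2^{\mathfrak b}\,\Gamma(2-s)/\Gamma(s)$. Let $\Omega\subset\mathbb R^d$ be a bounded open convex polytope, and let $\{(\lambda_k,\varphi_k)\}_k$ be the eigenpairs of the Dirichlet Laplacian on $\Omega$, with $\{\varphi_k\}$ an orthonormal basis of $L^2(\Omega)$. Put $\|w\|_{\mathbb H^s(\Omega)}^2=\sum_k\lambda_k^s|(w,\varphi_k)_{L^2(\Omega)}|^2$. Let $f=\sum_kF_k\varphi_k\in\mathbb H^{-s}(\Omega)$, that is, $\sum_k\lambda_k^{-s}F_k^2<\infty$, and $\langle f,w\rangle=\sum_kF_k(w,\varphi_k)_{L^2(\Omega)}$. Let $\mathcal Y>0$, $\mathcal C_{\mathcal Y}=\Omega\times(0,\mathcal Y)$, and let $L^2(y^{\mathfrak b},\mathcal C_{\mathcal Y})$ be the $L^2$ space of the measure $y^{\mathfrak b}\,dx\,dy$, identified with $L^2(y^{\mathfrak b},(0,\mathcal Y);L^2(\Omega))$. Write $\mathcal D_{\mathfrak b}w=-y^{-\mathfrak b}\partial_y(y^{\mathfrak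 b}\partial_yw)$ and $\mathbb L_{\mathfrak b}w=\mathcal D_{\mathfrak b}w-\Delta_xw$. For $X=\mathbb R$ or $X=L^2(\Omega)$ let $H^2(y^{\mathfrak b},(0,\mathcal Y);X)$ be the space of all $w$ with $w,\partial_yw\in L^2(y^{\mathfrak b},(0,\mathcal Y);X)$, $\partial_y(y^{\mathfrak b}\partial_yw)\in L^2(y^{-\mathfrak b},(0,\mathcal Y);X)$ and $\lim_{y\downarrow0}y^{\mathfrak b}\partial_yw=0$. Let $\mathcal H_{\mathcal Y}$ be the space of all $w\in H^2(y^{\mathfrak b},(0,\mathcal Y);L^2(\Omega))$ with $\nabla_xw,\ \partial_y\nabla_xw,\ D_x^2w\in L^2(y^{\mathfrak b},\mathcal C_{\mathcal Y})$, with $w=\partial_{\mathbf n}w=0$ on $\partial\Omega\times(0,\mathcal Y)$ (that is, $w(\cdot,y)\in H^2_0(\Omega)$ for a.e. $y$) and with $w=\partial_yw=0$ at $y=\mathcal Y$. Put $\|w\|_{\mathcal H}=\|\mathbb L_{\mathfrak b}w\|_{L^2(y^{\mathfrak b},\mathcal C_{\mathcal Y})}$ and $\mathrm{Tr}_\Omega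 w=w(\cdot,0)$. Let $\mathcal T_h$ be a conforming simplicial triangulation of $\Omega$ and $\{\mathcal P_T\}_{T\in\mathcal T_h}$ finite-dimensional local function spaces that are $H^2$-conforming: each $v\in C^1(\bar\Omega)$ with $v|_T\in\mathcal P_T$ for all $T$ is in $H^2(\Omega)$. Put $W(\mathcal T_h)=\{v\in C^1(\bar\Omega):v|_T\in\mathcal P_T\ \forall T\in\mathcal T_h,\ v=\partial_{\mathbf n}v=0\text{ on }\partial\Omega\}$. Let $\mathcal M_M$ be a partition of $[0,\mathcal Y]$ into $M$ intervals $I_m$, let $\mathcal S(\mathcal M_M)$ be the set of $p\in C^1([0,\mathcal Y])$ which are polynomials of degree at most $3$ on each $I_m$ and satisfy $p(\mathcal Y)=p'(0)=p'(\mathcal Y)=0$, and let $V=W(\mathcal T_h)\otimes\mathcal S(\mathcal M_M)$. Let $\mathfrak u\in\mathcal H_{\mathcal Y}$ satisfy $\int_{\mathcal C_{\mathcal Y}}y^{\mathfrak b}\,\mathbb L_{\mathfrak b}\mathfrak u\,\mathbb L_{\mathfrak b}v\,dx\,dy=d_s\langle f,\mathrm{Tr}_\Omega v\rangle$ for all $v\in\mathcal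 H_{\mathcal Y}$, and let $\mathfrak u_{h,M}\in V$ satisfy the same identity (with $\mathfrak u_{h,M}$ in place of $\mathfrak u$) for all $v\in V$. **Theorem (best approximation).** (1) There is a constant $C_1$, depending only on $s$, with $$\|\mathrm{Tr}_\Omega(\mathfrak u-\mathfrak u_{h,M})\|_{\mathbb H^s(\Omega)}\le C_1\|\mathfrak u-\mathfrak u_{h,M}\|_{\mathcal H},\qquad \|\mathfrak u-\mathfrak u_{h,M}\|_{\mathcal H}=\min_{v\in V}\|\mathfrak u-v\|_{\mathcal H}<\infty .$$ (2) Let $\Pi_x:H^2_0(\Omega)\to W(\mathcal T_h)$ be a linear projection with $\|\Pi_xw\|_{L^2(\Omega)}\le c_0\|w\|_{L^2(\Omega)}$ and $\|\Delta\Pi_xw\|_{L^2(\Omega)}\le c_1\|\Delta w\|_{L^2(\Omega)}$ for all $w\in H^2_0(\Omega)$; denote its continuous extension to $L^2(\Omega)$ by $\Pi_x$ as well. Let $\Pi_y:H^2(y^{\mathfrak b},(0,\mathcal Y);\mathbb R)\to\mathcal S(\mathcal M_M)$ be any linear projection. For $w\in H^2(y^{\mathfrak b},(0,\mathcal Y);L^2(\Omega))$,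 $\Pi_yw$ denotes the function $[0,\mathcal Y]\to L^2(\Omega)$ determined by $(\phi,(\Pi_yw)(\cdot))_{L^2(\Omega)}=\Pi_y\big[(\phi,w(\cdot))_{L^2(\Omega)}\big]$ for all $\phi\in L^2(\Omega)$; if $\Pi_y$ is bounded, then $\Pi_yw$ exists for every such $w$. Suppose that the terms below are defined, that is, that $\Delta_x\mathfrak u\in H^2(y^{\mathfrak b},(0,\mathcal Y);L^2(\Omega))$ and that $\Pi_y\mathfrak u$ and $\Pi_y\Delta_x\mathfrak u$ exist. Then, with a constant $C_2$ depending only on $s$, $c_0$ and $c_1$, and with all norms on the right in $L^2(y^{\mathfrak b},\mathcal C_{\mathcal Y})$, $$\|\mathfrak u-\mathfrak u_{h,M}\|_{\mathcal H}\le C_2\Big(\|(\mathrm{id}-\Pi_x)\mathcal D_{\mathfrak b}\mathfrak u\|+\|\Delta_x(\mathrm{id}-\Pi_x)\mathfrak u\|+\|\mathcal D_{\mathfrak b}(\mathrm{id}-\Pi_y)\mathfrak u\|+\|(\mathrm{id}-\Pi_y)\Delta_x\mathfrak u\|\Big).$$ -/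

import Mathlib

open MeasureTheory Set Filter Topology
open scoped ENNReal NNReal ContDiff

noncomputable section

namespace PolyExt

/-! ### Sobolev spaces on a domain of `ℝ^d` -/

/-- `ℝ^d` with the Euclidean norm. -/
abbrev Space (d : ℕ) : Type := EuclideanSpace ℝ (Fin d)

/-- `L²(Ω)`. -/
abbrev L2 {d : ℕ} (Ω : Set (Space d)) : Type := Lp ℝ 2 (volume.restrict Ω)

/-- A bounded open convex polytope with non-empty interior. -/
def IsConvexPolytope {d : ℕ} (Ω : Set (Space d)) : Prop :=
  Ω.Nonempty ∧ ∃ A : Finset (Space d), Ω = interior (convexHull ℝ (A : Set (Space d)))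

/-- The classical partial derivative `∂_i φ`. -/
def partialD {d : ℕ} (i : Fin d) (φ : Space d → ℝ) (x : Space d) : ℝ :=
  fderiv ℝ φ x (EuclideanSpace.single i 1)

/-- `φ ∈ C_c^∞(Ω)`. -/
def IsTest {d : ℕ} (Ω : Set (Space d)) (φ : Space d → ℝ) : Prop :=
  ContDiff ℝ ∞ φ ∧ HasCompactSupport φ ∧ tsupport φ ⊆ Ω

/-- `g ∈ L²(Ω)` is the weak partial derivative `∂_i u` of `u ∈ L²(Ω)`. -/
def IsWeakPartial {d : ℕ} (Ω : Set (Space d)) (i : Fin d) (u g : L2 Ω) : Prop :=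
  ∀ φ : Space d → ℝ, IsTest Ω φ →
    ∫ x in Ω, u x * partialD i φ x = - ∫ x in Ω, g x * φ x

open Classical in
/-- The weak partial derivative `∂_i u` in `L²(Ω)` (and `0` if there is none). -/
def weakD {d : ℕ} (Ω : Set (Space d)) (i : Fin d) (u : L2 Ω) : L2 Ω :=
  if h : ∃ g, IsWeakPartial Ω i u g then h.choose else 0

/-- The Laplacian `Δ_x` (weak derivatives). -/
def lap {d : ℕ} (Ω : Set (Space d)) (u : L2 Ω) : L2 Ω :=
  ∑ i, weakD Ω i (weakD Ω i u)

/-- `u ∈ H²(Ω)`. -/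
def MemH2 {d : ℕ} (Ω : Set (Space d)) (u : L2 Ω) : Prop :=
  ∀ i, ∃ g, IsWeakPartial Ω i u g ∧ ∀ j, ∃ h, IsWeakPartial Ω j g h

/-- `u ∈ H¹₀(Ω)`, the closure of `C_c^∞(Ω)` in `H¹(Ω)`. -/
def MemH10 {d : ℕ} (Ω : Set (Space d)) (u : L2 Ω) : Prop :=
  ∃ (φ : ℕ → Space d → ℝ) (g : Fin d → L2 Ω), (∀ n, IsTest Ω (φ n)) ∧
    Tendsto (fun n => eLpNorm (φ n - ⇑u) 2 (volume.restrict Ω)) atTop (𝓝 0) ∧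
    ∀ i, Tendsto (fun n => eLpNorm (partialD i (φ n) - ⇑(g i)) 2 (volume.restrict Ω))
      atTop (𝓝 0)

/-- `u ∈ H²₀(Ω)`, the closure of `C_c^∞(Ω)` in `H²(Ω)`. -/
def MemH20 {d : ℕ} (Ω : Set (Space d)) (u : L2 Ω) : Prop :=
  ∃ (φ : ℕ → Space d → ℝ) (g : Fin d → L2 Ω) (h : Fin d → Fin d → L2 Ω),
    (∀ n, IsTest Ω (φ n)) ∧
    Tendsto (fun n => eLpNorm (φ n - ⇑u) 2 (volume.restrict Ω)) atTop (𝓝 0) ∧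
    (∀ i, Tendsto (fun n => eLpNorm (partialD i (φ n) - ⇑(g i)) 2 (volume.restrict Ω))
      atTop (𝓝 0)) ∧
    ∀ i j, Tendsto
      (fun n => eLpNorm (partialD i (partialD j (φ n)) - ⇑(h i j)) 2 (volume.restrict Ω))
      atTop (𝓝 0)

theorem partialD_add {d : ℕ} (i : Fin d) {φ ψ : Space d → ℝ}
    (hφ : ContDiff ℝ ∞ φ) (hψ : ContDiff ℝ ∞ ψ) :
    partialD i (φ + ψ) = partialD i φ + partialD i ψ := by
  funext x
  have h1 : DifferentiableAt ℝ φ x := (hφ.differentiable (by simp)) x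
  have h2 : DifferentiableAt ℝ ψ x := (hψ.differentiable (by simp)) x
  simp [partialD, fderiv_add h1 h2]

theorem partialD_smul {d : ℕ} (i : Fin d) (c : ℝ) (φ : Space d → ℝ) :
    partialD i (c • φ) = c • partialD i φ := by
  funext x
  simp [partialD, fderiv_const_smul_field]

theorem contDiff_partialD {d : ℕ} (i : Fin d) {φ : Space d → ℝ} (hφ : ContDiff ℝ ∞ φ) :
    ContDiff ℝ ∞ (partialD i φ) := by
  have h : ContDiff ℝ ∞ (fderiv ℝ φ) := hφ.fderiv_right (by simp)
  exact h.clm_apply contDiff_const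

theorem tendsto_add_aux {d : ℕ} {Ω : Set (Space d)} {a b : ℕ → Space d → ℝ} {u v : L2 Ω}
    (ha : ∀ n, Continuous (a n)) (hb : ∀ n, Continuous (b n))
    (h1 : Tendsto (fun n => eLpNorm (a n - ⇑u) 2 (volume.restrict Ω)) atTop (𝓝 0))
    (h2 : Tendsto (fun n => eLpNorm (b n - ⇑v) 2 (volume.restrict Ω)) atTop (𝓝 0)) :
    Tendsto (fun n => eLpNorm ((a n + b n) - ⇑(u + v)) 2 (volume.restrict Ω)) atTop (𝓝 0) := by
  have h3 := h1.add h2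
  rw [add_zero] at h3
  refine tendsto_of_tendsto_of_tendsto_of_le_of_le tendsto_const_nhds h3 (fun n => bot_le) ?_
  intro n
  have e : eLpNorm ((a n + b n) - ⇑(u + v)) 2 (volume.restrict Ω)
      = eLpNorm ((a n - ⇑u) + (b n - ⇑v)) 2 (volume.restrict Ω) := by
    refine eLpNorm_congr_ae ?_
    filter_upwards [Lp.coeFn_add u v] with x hx
    simp only [Pi.sub_apply, Pi.add_apply, hx]
    ring
  simp only [e]
  exact eLpNorm_add_le ((ha n).aestronglyMeasurable.sub (Lp.aestronglyMeasurable u))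
    ((hb n).aestronglyMeasurable.sub (Lp.aestronglyMeasurable v)) (by norm_num)

theorem tendsto_smul_aux {d : ℕ} {Ω : Set (Space d)} {a : ℕ → Space d → ℝ} {u : L2 Ω} (c : ℝ)
    (h1 : Tendsto (fun n => eLpNorm (a n - ⇑u) 2 (volume.restrict Ω)) atTop (𝓝 0)) :
    Tendsto (fun n => eLpNorm ((c • a n) - ⇑(c • u)) 2 (volume.restrict Ω)) atTop (𝓝 0) := by
  have h3 := ENNReal.Tendsto.const_mul (a := ‖c‖ₑ) h1 (Or.inr (by simp))
  rw [mul_zero] at h3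
  refine h3.congr ?_
  intro n
  rw [← eLpNorm_const_smul]
  refine eLpNorm_congr_ae ?_
  filter_upwards [Lp.coeFn_smul c u] with x hx
  simp only [Pi.sub_apply, Pi.smul_apply, hx, smul_eq_mul]
  ring

/-- The space `H²₀(Ω)`, as a subspace of `L²(Ω)`. -/
def H20 {d : ℕ} (Ω : Set (Space d)) : Submodule ℝ (L2 Ω) where
  carrier := {u | MemH20 Ω u}
  zero_mem' := by
    have hp : ∀ i : Fin d, partialD i (0 : Space d → ℝ) = 0 := by
      intro i
      funext x
      simp [partialD]
    have h0 : eLpNorm ((0 : Space d → ℝ) - ⇑(0 : L2 Ω)) 2 (volume.restrict Ω) = 0 := by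
      rw [eLpNorm_congr_ae (g := 0)]
      · simp
      · filter_upwards [Lp.coeFn_zero ℝ 2 (volume.restrict Ω)] with x hx
        rw [Pi.sub_apply, hx]
        simp
    refine ⟨fun _ => 0, fun _ => 0, fun _ _ => 0, ?_, ?_, ?_, ?_⟩
    · intro n
      exact ⟨contDiff_const, HasCompactSupport.zero, by simp [tsupport]⟩
    · simp only [h0]
      exact tendsto_const_nhds
    · intro i
      simp only [hp, h0]
      exact tendsto_const_nhds
    · intro i j
      simp only [hp, h0]
      exact tendsto_const_nhds
  add_mem' := by
    rintro u v ⟨φ, g, h, hφ, h1, h2, h3⟩ ⟨ψ, g', h', hψ, h1', h2', h3'⟩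
    have e1 : ∀ i n, partialD i (φ n + ψ n) = partialD i (φ n) + partialD i (ψ n) :=
      fun i n => partialD_add i (hφ n).1 (hψ n).1
    have e2 : ∀ i j n, partialD i (partialD j (φ n + ψ n))
        = partialD i (partialD j (φ n)) + partialD i (partialD j (ψ n)) := fun i j n => by
      rw [e1, partialD_add i (contDiff_partialD j (hφ n).1) (contDiff_partialD j (hψ n).1)]
    refine ⟨fun n => φ n + ψ n, fun i => g i + g' i, fun i j => h i j + h' i j, ?_, ?_, ?_, ?_⟩
    · intro n
      exact ⟨(hφ n).1.add (hψ n).1, (hφ n).2.1.add (hψ n).2.1,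
        (tsupport_add (φ n) (ψ n)).trans (union_subset (hφ n).2.2 (hψ n).2.2)⟩
    · exact tendsto_add_aux (fun n => (hφ n).1.continuous) (fun n => (hψ n).1.continuous) h1 h1'
    · intro i
      simp only [e1]
      exact tendsto_add_aux (fun n => (contDiff_partialD i (hφ n).1).continuous)
        (fun n => (contDiff_partialD i (hψ n).1).continuous) (h2 i) (h2' i)
    · intro i j
      simp only [e2]
      exact tendsto_add_aux
        (fun n => (contDiff_partialD i (contDiff_partialD j (hφ n).1)).continuous)
        (fun n => (contDiff_partialD i (contDiff_partialD j (hψ n).1)).continuous)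
        (h3 i j) (h3' i j)
  smul_mem' := by
    rintro c u ⟨φ, g, h, hφ, h1, h2, h3⟩
    refine ⟨fun n => c • φ n, fun i => c • g i, fun i j => c • h i j, ?_, ?_, ?_, ?_⟩
    · intro n
      exact ⟨contDiff_const.smul (hφ n).1, (hφ n).2.1.smul_left (f := fun _ => c),
        (tsupport_smul_subset_right (fun _ => c) (φ n)).trans (hφ n).2.2⟩
    · exact tendsto_smul_aux c h1
    · intro i
      simp only [partialD_smul]
      exact tendsto_smul_aux c (h2 i)
    · intro i j
      simp only [partialD_smul]
      exact tendsto_smul_aux c (h3 i j)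

/-! ### The spectral spaces of the Dirichlet Laplacian -/

/-- The eigenpairs of the Dirichlet Laplacian: an orthonormal basis of `L²(Ω)` of functions
`φ_k ∈ H¹₀(Ω)` with `-Δφ_k = λ_k φ_k` in the weak sense. -/
structure DirichletEigensystem {d : ℕ} (Ω : Set (Space d)) where
  eigval : ℕ → ℝ
  eigfun : HilbertBasis ℕ ℝ (L2 Ω)
  eigval_pos : ∀ k, 0 < eigval k
  mem_H10 : ∀ k, MemH10 Ω (eigfun k)
  eigen_eq : ∀ k, ∀ v : L2 Ω, MemH10 Ω v →
    ∑ i, inner ℝ (weakD Ω i (eigfun k)) (weakD Ω i v) = eigval k * inner ℝ (eigfun k) v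

/-- The norm of `ℍ^s(Ω)`, with value `∞` outside this space. -/
def hsNorm {d : ℕ} {Ω : Set (Space d)} (eig : DirichletEigensystem Ω) (s : ℝ) (w : L2 Ω) :
    ℝ≥0∞ :=
  (∑' k, ENNReal.ofReal (eig.eigval k ^ s * (inner ℝ (eig.eigfun k) w) ^ 2)) ^ (1 / 2 : ℝ)

/-- `f = ∑ F_k φ_k` (a formal series, given by its coefficients) belongs to `ℍ^{-s}(Ω)`. -/
def MemHNeg {d : ℕ} {Ω : Set (Space d)} (eig : DirichletEigensystem Ω) (s : ℝ) (F : ℕ → ℝ) :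
    Prop :=
  Summable fun k => eig.eigval k ^ (-s) * F k ^ 2

/-- The duality pairing `⟨f, w⟩` of `ℍ^{-s}(Ω)` and `ℍ^s(Ω)`, for `f = ∑ F_k φ_k`. -/
def pairing {d : ℕ} {Ω : Set (Space d)} (eig : DirichletEigensystem Ω) (F : ℕ → ℝ) (w : L2 Ω) :
    ℝ :=
  ∑' k, F k * inner ℝ (eig.eigfun k) w

/-! ### Weighted spaces in the extended variable -/

/-- The measure `y^b dy` on `(0, Y)`. -/
def wMeasure (b Y : ℝ) : Measure ℝ :=
  (volume.restrict (Ioo 0 Y)).withDensity fun y => ENNReal.ofReal (y ^ b)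

/-- The norm of `L²(y^b, (0,Y); X)`; for `X = L²(Ω)` it is the norm of `L²(y^b, Ω × (0,Y))`. -/
def wNorm {X : Type*} [NormedAddCommGroup X] (b Y : ℝ) (w : ℝ → X) : ℝ≥0∞ :=
  eLpNorm w 2 (wMeasure b Y)

/-- `𝒟_b w = - y^{-b} ∂_y (y^b ∂_y w)`. -/
def opD {X : Type*} [NormedAddCommGroup X] [NormedSpace ℝ X] (b : ℝ) (w : ℝ → X) (y : ℝ) : X :=
  -(y ^ (-b) • deriv (fun t => t ^ b • deriv w t) y)

/-- `w ∈ H²(y^b, (0,Y); X)` with `lim_{y ↓ 0} y^b ∂_y w = 0`; that is, `w, ∂_y w ∈ L²(y^b)`,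
`∂_y (y^b ∂_y w) ∈ L²(y^{-b})`. For `|b| < 1` both `w` and the flux `y^b ∂_y w` have locally
absolutely continuous representatives, so that `w` is continuous on `[0,Y]` and `C¹` on `(0,Y)`;
`w` stands for that representative, and its values outside `[0,Y]` are irrelevant. -/
structure MemH2N {X : Type*} [NormedAddCommGroup X] [NormedSpace ℝ X] (b Y : ℝ) (w : ℝ → X) :
    Prop where
  cont : ContinuousOn w (Icc 0 Y)
  diff : ∀ y ∈ Ioo 0 Y, DifferentiableAt ℝ w y
  memLp : MemLp w 2 (wMeasure b Y)
  memLp_deriv : MemLp (deriv w) 2 (wMeasure b Y)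
  flux : ∃ g : ℝ → X, MemLp g 2 (wMeasure (-b) Y) ∧ ∀ a ∈ Ioo 0 Y, ∀ c ∈ Ioo 0 Y,
    IntervalIntegrable g volume a c ∧
      c ^ b • deriv w c - a ^ b • deriv w a = ∫ t in a..c, g t
  flux_zero : Tendsto (fun y => y ^ b • deriv w y) (𝓝[Ioo 0 Y] 0) (𝓝 0)

theorem deriv_add_aux {b Y : ℝ} {w v : ℝ → ℝ} (hw : MemH2N b Y w) (hv : MemH2N b Y v) :
    ∀ y ∈ Ioo 0 Y, deriv (w + v) y = deriv w y + deriv v y :=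
  fun y hy => deriv_add (hw.diff y hy) (hv.diff y hy)

theorem ae_mem_Ioo (b Y : ℝ) : ∀ᵐ y ∂(wMeasure b Y), y ∈ Ioo 0 Y :=
  (withDensity_absolutelyContinuous _ _).ae_le (ae_restrict_mem measurableSet_Ioo)

/-- The real-valued space `H²(y^b, (0,Y))` with `lim_{y ↓ 0} y^b ∂_y w = 0`. -/
def H2N (b Y : ℝ) : Submodule ℝ (ℝ → ℝ) where
  carrier := {w | MemH2N b Y w}
  zero_mem' := by
    have h0 : deriv (0 : ℝ → ℝ) = 0 := by
      funext y
      simp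
    refine ⟨continuousOn_const, fun y _ => differentiableAt_const _, MemLp.zero, ?_, ?_, ?_⟩
    · rw [h0]
      exact MemLp.zero
    · refine ⟨0, MemLp.zero, fun a _ c _ => ⟨?_, ?_⟩⟩
      · exact intervalIntegrable_const
      · simp
    · rw [h0]
      simp only [Pi.zero_apply, smul_zero]
      exact tendsto_const_nhds
  add_mem' := by
    intro w v hw hv
    obtain ⟨g, hg, hg'⟩ := hw.flux
    obtain ⟨k, hk, hk'⟩ := hv.flux
    have hd := deriv_add_aux hw hv
    refine ⟨hw.cont.add hv.cont, fun y hy => (hw.diff y hy).add (hv.diff y hy),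
      hw.memLp.add hv.memLp, ?_, ?_, ?_⟩
    · refine (memLp_congr_ae ?_).2 (hw.memLp_deriv.add hv.memLp_deriv)
      filter_upwards [ae_mem_Ioo b Y] with y hy
      exact hd y hy
    · refine ⟨g + k, hg.add hk, fun a ha c hc => ⟨(hg' a ha c hc).1.add (hk' a ha c hc).1, ?_⟩⟩
      have e := intervalIntegral.integral_add (hg' a ha c hc).1 (hk' a ha c hc).1
      simp only [Pi.add_apply]
      rw [e, ← (hg' a ha c hc).2, ← (hk' a ha c hc).2, hd a ha, hd c hc]
      simp only [smul_eq_mul]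
      ring
    · have h := hw.flux_zero.add hv.flux_zero
      rw [add_zero] at h
      refine h.congr' ?_
      filter_upwards [self_mem_nhdsWithin] with y hy
      rw [hd y hy, smul_add]
  smul_mem' := by
    intro c w hw
    obtain ⟨g, hg, hg'⟩ := hw.flux
    have hd : ∀ y, deriv (c • w) y = c * deriv w y := fun y => deriv_const_smul_field c w
    have hd' : deriv (c • w) = c • deriv w := by
      funext y
      exact hd y
    refine ⟨hw.cont.const_smul c, fun y hy => (hw.diff y hy).const_smul c,
      hw.memLp.const_smul c, ?_, ?_, ?_⟩
    · rw [hd']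
      exact hw.memLp_deriv.const_smul c
    · refine ⟨c • g, hg.const_smul c, fun a ha e he => ⟨(hg' a ha e he).1.smul c, ?_⟩⟩
      simp only [Pi.smul_apply, hd]
      rw [intervalIntegral.integral_smul, ← (hg' a ha e he).2]
      simp only [smul_eq_mul]
      ring
    · have h := hw.flux_zero.const_smul c
      rw [smul_zero] at h
      refine h.congr ?_
      intro y
      simp only [hd, smul_eq_mul]
      ring

/-- The norm of `H²(y^b, (0,Y))`. -/
def h2nNorm (b Y : ℝ) (g : ℝ → ℝ) : ℝ≥0∞ :=
  wNorm b Y g + wNorm b Y (deriv g) + wNorm b Y (opD b g)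

/-! ### The truncated extension problem

Functions on the cylinder `Ω × (0,Y)` are functions of `y` with values in `L²(Ω)`, and
`L²(y^b, Ω × (0,Y)) = L²(y^b, (0,Y); L²(Ω))`. -/

/-- `𝕃_b w = 𝒟_b w - Δ_x w`. -/
def opL {d : ℕ} (Ω : Set (Space d)) (b : ℝ) (w : ℝ → L2 Ω) (y : ℝ) : L2 Ω :=
  opD b w y - lap Ω (w y)

/-- The space of all `w ∈ H²(y^b, Ω × (0,Y))` with `lim_{y ↓ 0} y^b ∂_y w = 0`, with
`w = ∂_n w = 0` on the lateral boundary (`w(y) ∈ H²₀(Ω)` for almost every `y`), and with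
`w = ∂_y w = 0` at `y = Y`. -/
structure MemHtwoLY {d : ℕ} (Ω : Set (Space d)) (b Y : ℝ) (w : ℝ → L2 Ω) : Prop where
  memH2N : MemH2N b Y w
  lateral : ∀ᵐ y ∂(wMeasure b Y), MemH20 Ω (w y)
  grad : ∀ i, MemLp (fun y => weakD Ω i (w y)) 2 (wMeasure b Y)
  hess : ∀ i j, MemLp (fun y => weakD Ω i (weakD Ω j (w y))) 2 (wMeasure b Y)
  mixed_exists : ∀ᵐ y ∂(wMeasure b Y), ∀ i, ∃ g, IsWeakPartial Ω i (deriv w y) g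
  mixed : ∀ i, MemLp (fun y => weakD Ω i (deriv w y)) 2 (wMeasure b Y)
  top : w Y = 0
  top_deriv : Tendsto (deriv w) (𝓝[Ioo 0 Y] Y) (𝓝 0)

/-- The energy norm `‖w‖ = ‖𝕃_b w‖_{L²(y^b, Ω × (0,Y))}`. -/
def energyNorm {d : ℕ} (Ω : Set (Space d)) (b Y : ℝ) (w : ℝ → L2 Ω) : ℝ≥0∞ :=
  wNorm b Y (opL Ω b w)

/-- The bilinear form `∫ y^b 𝕃_b w 𝕃_b v dx dy` over `Ω × (0,Y)`. -/
def energyForm {d : ℕ} (Ω : Set (Space d)) (b Y : ℝ) (w v : ℝ → L2 Ω) : ℝ :=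
  ∫ y, inner ℝ (opL Ω b w y) (opL Ω b v y) ∂(wMeasure b Y)

/-- The trace on `Ω × {0}`; the functions in question are continuous on `[0,Y]` with values in
`L²(Ω)`. -/
def trace {d : ℕ} {Ω : Set (Space d)} (w : ℝ → L2 Ω) : L2 Ω := w 0

/-- The parameter `b = 3 - 2s`. -/
def bPar (s : ℝ) : ℝ := 3 - 2 * s

/-- The constant `d_s = 2^b Γ(2-s) / Γ(s)`. -/
def dConst (s : ℝ) : ℝ := 2 ^ bPar s * Real.Gamma (2 - s) / Real.Gamma s

/-- `u` solves the truncated extension problem with data `f = ∑ F_k φ_k`. -/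
def IsTruncatedSolution {d : ℕ} {Ω : Set (Space d)} (eig : DirichletEigensystem Ω) (s Y : ℝ)
    (F : ℕ → ℝ) (u : ℝ → L2 Ω) : Prop :=
  MemHtwoLY Ω (bPar s) Y u ∧ ∀ v, MemHtwoLY Ω (bPar s) Y v →
    energyForm Ω (bPar s) Y u v = dConst s * pairing eig F (trace v)

/-! ### Finite element spaces -/

/-- `K` is a conforming triangulation of the polytope `Ω`: a finite simplicial complex with
union `closure Ω`, each simplex of which is a face of a `d`-simplex. -/
structure IsTriangulation {d : ℕ} (Ω : Set (Space d)) (K : Geometry.SimplicialComplex ℝ (Space d)) :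
    Prop where
  finite : K.faces.Finite
  space_eq : K.space = closure Ω
  pure : ∀ S ∈ K.faces, ∃ T ∈ K.faces, S ⊆ T ∧ T.card = d + 1

/-- `r ∈ C¹(closure Ω)`, and on each cell `T` (a `d`-simplex, given by its vertices) `r` is an
element of the local space `P T`. -/
def IsPiecewiseC1 {d : ℕ} (Ω : Set (Space d)) (K : Geometry.SimplicialComplex ℝ (Space d))
    (P : Finset (Space d) → Submodule ℝ (Space d → ℝ)) (r : Space d → ℝ) : Prop :=
  ContDiffOn ℝ 1 r (closure Ω) ∧ ∀ T ∈ K.faces, T.card = d + 1 →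
    ∃ p ∈ P T, EqOn r p (convexHull ℝ (T : Set (Space d)))

/-- The local spaces `P T` form an `H²`-conforming finite element: they are finite-dimensional,
and the `C¹` functions on `closure Ω` that are piecewise in `P T` are in `H²(Ω)`. -/
structure IsH2Conforming {d : ℕ} (Ω : Set (Space d))
    (K : Geometry.SimplicialComplex ℝ (Space d))
    (P : Finset (Space d) → Submodule ℝ (Space d → ℝ)) : Prop where
  finite_dim : ∀ T ∈ K.faces, T.card = d + 1 → FiniteDimensional ℝ (P T)
  conforming : ∀ r, IsPiecewiseC1 Ω K P r →
    ∃ u : L2 Ω, u =ᵐ[volume.restrict Ω] r ∧ MemH2 Ω u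

/-- `W(𝒯_h)`, as a subset of `L²(Ω)`. The normal derivative is required to vanish along all
outward normals `ν` of the convex set `Ω` at each boundary point. -/
def femW {d : ℕ} (Ω : Set (Space d)) (K : Geometry.SimplicialComplex ℝ (Space d))
    (P : Finset (Space d) → Submodule ℝ (Space d → ℝ)) : Set (L2 Ω) :=
  {v | ∃ r : Space d → ℝ, v =ᵐ[volume.restrict Ω] r ∧ IsPiecewiseC1 Ω K P r ∧
    (∀ x ∈ frontier Ω, r x = 0) ∧
    ∀ x ∈ frontier Ω, ∀ ν : Space d, (∀ z ∈ Ω, inner ℝ ν (z - x) ≤ 0) →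
      fderivWithin ℝ r (closure Ω) x ν = 0}

/-- A partition `0 = τ 0 < τ 1 < ⋯ < τ M = Y` of `[0,Y]`. -/
def IsPartition {M : ℕ} (Y : ℝ) (τ : Fin (M + 1) → ℝ) : Prop :=
  StrictMono τ ∧ τ 0 = 0 ∧ τ (Fin.last M) = Y

/-- `𝒮(ℳ_M)`: the `C¹` piecewise cubics `p` with `p(Y) = p'(0) = p'(Y) = 0`. -/
def femS {M : ℕ} (Y : ℝ) (τ : Fin (M + 1) → ℝ) : Set (ℝ → ℝ) :=
  {p | ContDiffOn ℝ 1 p (Icc 0 Y) ∧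
    (∀ m : Fin M, ∃ q : Polynomial ℝ, q.degree ≤ 3 ∧
      EqOn p (fun y => q.eval y) (Icc (τ m.castSucc) (τ m.succ))) ∧
    p Y = 0 ∧ derivWithin p (Icc 0 Y) 0 = 0 ∧ derivWithin p (Icc 0 Y) Y = 0}

/-- `W ⊗ S`: the span of the functions `v(x) p(y)` with `v ∈ W`, `p ∈ S`. -/
def tensorSpace {d : ℕ} {Ω : Set (Space d)} (W : Set (L2 Ω)) (S : Set (ℝ → ℝ)) :
    Submodule ℝ (ℝ → L2 Ω) :=
  Submodule.span ℝ {w | ∃ v ∈ W, ∃ p ∈ S, w = fun y => p y • v}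

/-- `uh` is the Galerkin solution in the discrete space `V`, with data `f = ∑ F_k φ_k`. -/
def IsDiscreteSolution {d : ℕ} {Ω : Set (Space d)} (eig : DirichletEigensystem Ω) (s Y : ℝ)
    (F : ℕ → ℝ) (V : Submodule ℝ (ℝ → L2 Ω)) (uh : ℝ → L2 Ω) : Prop :=
  uh ∈ V ∧ ∀ v ∈ V, energyForm Ω (bPar s) Y uh v = dConst s * pairing eig F (trace v)

/-! ### Directional projections -/

/-- `Π_x : H²₀(Ω) → W` is a linear projection with
`‖Π_x w‖ ≤ c₀ ‖w‖` and `‖Δ Π_x w‖ ≤ c₁ ‖Δ w‖` in `L²(Ω)`. -/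
structure IsStableProjX {d : ℕ} (Ω : Set (Space d)) (W : Set (L2 Ω)) (c₀ c₁ : ℝ≥0)
    (prX : H20 Ω →ₗ[ℝ] L2 Ω) : Prop where
  range_mem : ∀ w, prX w ∈ W
  proj : ∀ w : H20 Ω, (w : L2 Ω) ∈ W → prX w = w
  stable : ∀ w : H20 Ω, ‖prX w‖ ≤ c₀ * ‖(w : L2 Ω)‖
  stable_lap : ∀ w : H20 Ω, ‖lap Ω (prX w)‖ ≤ c₁ * ‖lap Ω (w : L2 Ω)‖

/-- The unique extension by continuity of `Π_x` from the dense subspace `H²₀(Ω)` to `L²(Ω)`. -/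
def extX {d : ℕ} {Ω : Set (Space d)} (prX : H20 Ω →ₗ[ℝ] L2 Ω) : L2 Ω →L[ℝ] L2 Ω :=
  prX.extendOfNorm (H20 Ω).subtype

/-- `Π_y : H²(y^b, (0,Y)) → S` is a linear projection (acting on functions on `[0,Y]`). -/
structure IsProjY (b Y : ℝ) (S : Set (ℝ → ℝ)) (prY : H2N b Y →ₗ[ℝ] (ℝ → ℝ)) : Prop where
  range_mem : ∀ g, prY g ∈ S
  proj : ∀ g : H2N b Y, (g : ℝ → ℝ) ∈ S → EqOn (prY g) g (Icc 0 Y)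
  congr : ∀ g k : H2N b Y, EqOn (g : ℝ → ℝ) k (Icc 0 Y) → EqOn (prY g) (prY k) (Icc 0 Y)

/-- `Π_y` is bounded. (`S` being finite-dimensional, any norm can be used there.) -/
def IsBoundedY (b Y : ℝ) (prY : H2N b Y →ₗ[ℝ] (ℝ → ℝ)) : Prop :=
  ∃ c : ℝ≥0, ∀ g : H2N b Y, ∀ y ∈ Icc 0 Y, ‖prY g y‖ₑ ≤ c * h2nNorm b Y g

/-- `v = (id ⊗ Π_y) w` on `[0,Y]`, for functions with values in `L²(Ω)`:
`⟨φ, v(·)⟩ = Π_y ⟨φ, w(·)⟩` for all `φ ∈ L²(Ω)`. -/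
def IsProjYOf {d : ℕ} {Ω : Set (Space d)} {b Y : ℝ} (prY : H2N b Y →ₗ[ℝ] (ℝ → ℝ))
    (w v : ℝ → L2 Ω) : Prop :=
  ∀ φ : L2 Ω, ∃ h : (fun y => inner ℝ φ (w y)) ∈ H2N b Y,
    ∀ y ∈ Icc 0 Y, inner ℝ φ (v y) = prY ⟨fun y => inner ℝ φ (w y), h⟩ y

end PolyExt

end

open PolyExt

/-! Write `𝕃 = 𝒟_b - Δ`. The energy form is the inner product of the images `𝕃w`, `𝕃v` in `L²(y^b,
(0,Y); L²(Ω))`. Since `u` and `uh` satisfy the same identity on `V`, the image of `u - uh` is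
orthogonal to the image of `V`, and Pythagoras (`energyNorm_sub_le_of_galerkin`) makes `uh` itself
the minimiser. The hypothesis on `u` may be tested with `V` only if `V` lies in the energy space,
and this conformity is the longest part of the proof.

In `x` one has to show `W ⊆ H²₀(Ω)` (`memH20_of_mem_femW`). A `C¹` function on the closed convex set
with vanishing value and normal derivative has vanishing full gradient on the boundary, so its
extension by zero is `C¹` on the whole space. Its second weak derivatives on `Ω` do not see a
boundary layer, so the Laplacian of the extension is again square integrable. Dilating about an
interior point and mollifying gives test functions that converge in `L²` and have bounded
Laplacians. For test functions the Laplacian controls all second derivatives, so `Δ` on `H²₀(Ω)` is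
a closed operator, and weak convergence of the Laplacians puts the limit in `H²₀(Ω)`. In `y`, the
condition `p'(0) = 0` gives `|p'(t)| ≤ C t`, which is enough for the singular weight
(`memH2N_of_mem_femS`).

For the trace, pairing with the eigenfunction `φ_k` turns `𝕃` into the scalar operator `𝒟_b + λ_k`.
Integration by parts gives `∫ y^b (𝒟w + λw)² = ∫ y^b (𝒟w)² + 2λ ∫ y^b w'² + λ² ∫ y^b w²`. Comparing
`w(0)` with `w` on the length scale `λ^(-1/2)` bounds `λ^s w(0)²` by this energy, with a constant
independent of `λ` and `Y` (`MemH2N.trace_le`). Summation over `k` is Parseval's identity.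

For the second estimate the competitor is `v = Π_x Π_y u`. The function `Π_y u` takes values in a
finite-dimensional space, so `v` belongs to `W ⊗ S`. The graph of `Δ` on `H²₀(Ω)` is its own double
orthogonal complement, so belonging to it can be tested by scalar products, through which `Π_y`
acts; hence `Δ Π_y u = Π_y Δu`. Then `𝕃(u - v) = (1-Π_x)𝒟u - Δ(1-Π_x)u + Π_x 𝒟(1-Π_y)u - Δ Π_x
(1-Π_y)u`, and the stability of `Π_x` bounds the last two terms. -/

noncomputable section

namespace PolyExt

/-! ### Test functions as elements of `L²(Ω)` -/

variable {d : ℕ} {Ω : Set (Space d)}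

open Classical in
/-- A function on `ℝ^d` as an element of `L²(Ω)` (and `0` if it is not square integrable). -/
def toL2 (Ω : Set (Space d)) (φ : Space d → ℝ) : L2 Ω :=
  if h : MemLp φ 2 (volume.restrict Ω) then h.toLp φ else 0

theorem coeFn_toL2 {φ : Space d → ℝ} (h : MemLp φ 2 (volume.restrict Ω)) :
    toL2 Ω φ =ᵐ[volume.restrict Ω] φ := by
  rw [toL2, dif_pos h]
  exact h.coeFn_toLp

theorem tsupport_partialD_subset (i : Fin d) (φ : Space d → ℝ) :
    tsupport (partialD i φ) ⊆ tsupport φ := by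
  refine closure_minimal ?_ (isClosed_tsupport φ)
  intro x hx
  by_contra h
  apply hx
  have : fderiv ℝ φ x = 0 := by
    by_contra h'
    exact h (support_fderiv_subset ℝ h')
  simp [partialD, this]

theorem IsTest.partialD {φ : Space d → ℝ} (h : IsTest Ω φ) (i : Fin d) :
    IsTest Ω (partialD i φ) :=
  ⟨contDiff_partialD i h.1,
    h.2.1.mono' ((subset_tsupport _).trans (tsupport_partialD_subset i φ)),
    (tsupport_partialD_subset i φ).trans h.2.2⟩

theorem IsTest.memLp {φ : Space d → ℝ} (h : IsTest Ω φ) :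
    MemLp φ 2 (volume.restrict Ω) :=
  (h.1.continuous.memLp_of_hasCompactSupport h.2.1).restrict Ω

theorem IsTest.coeFn {φ : Space d → ℝ} (h : IsTest Ω φ) :
    toL2 Ω φ =ᵐ[volume.restrict Ω] φ := coeFn_toL2 h.memLp

theorem inner_toL2 {φ : Space d → ℝ} (h : MemLp φ 2 (volume.restrict Ω)) (u : L2 Ω) :
    inner ℝ u (toL2 Ω φ) = ∫ x in Ω, u x * φ x := by
  rw [L2.inner_def]
  refine integral_congr_ae ?_
  filter_upwards [coeFn_toL2 h] with x hx
  simp [hx, mul_comm]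

theorem toL2_add {φ ψ : Space d → ℝ} (hφ : MemLp φ 2 (volume.restrict Ω))
    (hψ : MemLp ψ 2 (volume.restrict Ω)) :
    toL2 Ω (φ + ψ) = toL2 Ω φ + toL2 Ω ψ := by
  rw [toL2, toL2, toL2, dif_pos hφ, dif_pos hψ, dif_pos (hφ.add hψ)]
  exact MemLp.toLp_add hφ hψ

theorem toL2_smul {φ : Space d → ℝ} (c : ℝ) (hφ : MemLp φ 2 (volume.restrict Ω)) :
    toL2 Ω (c • φ) = c • toL2 Ω φ := by
  rw [toL2, toL2, dif_pos hφ, dif_pos (hφ.const_smul c)]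
  exact MemLp.toLp_const_smul c hφ

theorem isTest_zero : IsTest Ω (0 : Space d → ℝ) :=
  ⟨contDiff_const, HasCompactSupport.zero, by simp [tsupport]⟩

theorem IsTest.add {φ ψ : Space d → ℝ} (hφ : IsTest Ω φ) (hψ : IsTest Ω ψ) :
    IsTest Ω (φ + ψ) :=
  ⟨hφ.1.add hψ.1, hφ.2.1.add hψ.2.1,
    (tsupport_add φ ψ).trans (union_subset hφ.2.2 hψ.2.2)⟩

theorem IsTest.smul {φ : Space d → ℝ} (c : ℝ) (hφ : IsTest Ω φ) : IsTest Ω (c • φ) :=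
  ⟨contDiff_const.smul hφ.1, hφ.2.1.smul_left (f := fun _ => c),
    (tsupport_smul_subset_right (fun _ => c) φ).trans hφ.2.2⟩

/-- The classical Laplacian. -/
def lapC (φ : Space d → ℝ) : Space d → ℝ := ∑ i, partialD i (partialD i φ)

theorem toL2_sum {ι : Type*} (s : Finset ι) {φ : ι → Space d → ℝ}
    (h : ∀ i ∈ s, MemLp (φ i) 2 (volume.restrict Ω)) :
    toL2 Ω (∑ i ∈ s, φ i) = ∑ i ∈ s, toL2 Ω (φ i) := by
  classical
  induction s using Finset.induction_on with
  | empty =>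
    simp only [Finset.sum_empty]
    rw [toL2, dif_pos MemLp.zero]
    exact MemLp.toLp_zero _
  | insert a s ha ih =>
    rw [Finset.sum_insert ha, Finset.sum_insert ha, toL2_add (h a (Finset.mem_insert_self a s)),
      ih fun i hi => h i (Finset.mem_insert_of_mem hi)]
    exact memLp_finsetSum' s fun i hi => h i (Finset.mem_insert_of_mem hi)

theorem IsTest.toL2_lapC {φ : Space d → ℝ} (h : IsTest Ω φ) :
    toL2 Ω (lapC φ) = ∑ i, toL2 Ω (PolyExt.partialD i (PolyExt.partialD i φ)) :=
  toL2_sum _ fun i _ => ((h.partialD i).partialD i).memLp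

/-- Integration by parts against a compactly supported smooth function. -/
theorem integral_mul_partialD {f g : Space d → ℝ} (i : Fin d) (hf : ContDiff ℝ 1 f)
    (hg : ContDiff ℝ 1 g) (hc : HasCompactSupport g) :
    ∫ x, f x * partialD i g x = - ∫ x, partialD i f x * g x := by
  have hf' : Continuous (partialD i f) :=
    (hf.continuous_fderiv (by simp)).clm_apply continuous_const
  have hg' : Continuous (partialD i g) :=
    (hg.continuous_fderiv (by simp)).clm_apply continuous_const
  have hgc : HasCompactSupport (partialD i g) :=
    hc.mono' ((subset_tsupport _).trans (tsupport_partialD_subset i g))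
  refine integral_mul_fderiv_eq_neg_fderiv_mul_of_integrable ?_ ?_ ?_
    (fun x _ => hf.differentiable (by simp) x) (fun x _ => hg.differentiable (by simp) x)
  · exact (hf'.mul hg.continuous).integrable_of_hasCompactSupport (hc.mul_left)
  · exact (hf.continuous.mul hg').integrable_of_hasCompactSupport (hgc.mul_left)
  · exact (hf.continuous.mul hg.continuous).integrable_of_hasCompactSupport (hc.mul_left)

theorem setIntegral_eq_of_tsupport_subset {f g : Space d → ℝ} (hg : tsupport g ⊆ Ω) :
    ∫ x in Ω, f x * g x = ∫ x, f x * g x := by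
  refine setIntegral_eq_integral_of_forall_compl_eq_zero fun x hx => ?_
  have : g x = 0 := by
    by_contra h
    exact hx (hg (subset_tsupport g h))
  simp [this]

theorem inner_toL2_toL2 {φ ψ : Space d → ℝ} (hφ : MemLp φ 2 (volume.restrict Ω))
    (hψ : IsTest Ω ψ) :
    inner ℝ (toL2 Ω φ) (toL2 Ω ψ) = ∫ x, φ x * ψ x := by
  rw [inner_toL2 hψ.memLp, ← setIntegral_eq_of_tsupport_subset hψ.2.2]
  refine integral_congr_ae ?_
  filter_upwards [coeFn_toL2 hφ] with x hx
  rw [hx]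

theorem isWeakPartial_iff {i : Fin d} {u g : L2 Ω} :
    IsWeakPartial Ω i u g ↔ ∀ φ, IsTest Ω φ →
      inner ℝ u (toL2 Ω (partialD i φ)) = - inner ℝ g (toL2 Ω φ) := by
  refine forall₂_congr fun φ hφ => ?_
  rw [inner_toL2 (hφ.partialD i).memLp, inner_toL2 hφ.memLp]

theorem IsTest.isWeakPartial {φ : Space d → ℝ} (hφ : IsTest Ω φ) (i : Fin d) :
    IsWeakPartial Ω i (toL2 Ω φ) (toL2 Ω (PolyExt.partialD i φ)) := by
  refine isWeakPartial_iff.2 fun ψ hψ => ?_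
  rw [inner_toL2_toL2 hφ.memLp (hψ.partialD i),
    inner_toL2_toL2 (hφ.partialD i).memLp hψ]
  exact integral_mul_partialD i (hφ.1.of_le (by simp)) (hψ.1.of_le (by simp)) hψ.2.1

/-- A square integrable function is locally integrable on the open set, so the fundamental lemma of
the calculus of variations applies. This is the source of uniqueness of weak derivatives. -/
theorem eq_zero_of_inner_test (hΩ : IsOpen Ω) {u : L2 Ω}
    (h : ∀ φ, IsTest Ω φ → inner ℝ u (toL2 Ω φ) = 0) : u = 0 := by
  have hloc : LocallyIntegrableOn u Ω volume := by
    intro x hx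
    obtain ⟨K, hK, hKx, hKc⟩ : ∃ K, K ∈ 𝓝 x ∧ K ⊆ Ω ∧ IsCompact K := by
      obtain ⟨K, h1, h2, h3⟩ := local_compact_nhds (hΩ.mem_nhds hx)
      exact ⟨K, h1, h2, h3⟩
    refine ⟨K, mem_nhdsWithin_of_mem_nhds hK, ?_⟩
    have h2 : MemLp u 2 (volume.restrict K) :=
      (Lp.memLp u).mono_measure (Measure.restrict_mono hKx le_rfl)
    have : IsFiniteMeasure (volume.restrict K) := ⟨by simpa using hKc.measure_lt_top⟩
    exact h2.integrable (by norm_num)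
  have h0 := hΩ.ae_eq_zero_of_integral_contDiff_smul_eq_zero hloc (by
    intro g hg hgc hgs
    have := h g ⟨hg, hgc, hgs⟩
    rw [inner_toL2 (IsTest.memLp ⟨hg, hgc, hgs⟩), setIntegral_eq_of_tsupport_subset hgs] at this
    rw [← this]
    exact integral_congr_ae (ae_of_all _ fun x => by simp [mul_comm]))
  refine Lp.ext ?_
  filter_upwards [(ae_restrict_iff' hΩ.measurableSet).2 h0,
    Lp.coeFn_zero ℝ 2 (volume.restrict Ω)] with x hx hx'
  rw [hx, hx']
  rfl

theorem IsWeakPartial.unique (hΩ : IsOpen Ω) {i : Fin d} {u g g' : L2 Ω}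
    (h : IsWeakPartial Ω i u g) (h' : IsWeakPartial Ω i u g') : g = g' := by
  rw [← sub_eq_zero]
  refine eq_zero_of_inner_test hΩ fun φ hφ => ?_
  have h1 := isWeakPartial_iff.1 h φ hφ
  have h2 := isWeakPartial_iff.1 h' φ hφ
  rw [inner_sub_left]
  linarith

theorem IsWeakPartial.weakD_eq (hΩ : IsOpen Ω) {i : Fin d} {u g : L2 Ω}
    (h : IsWeakPartial Ω i u g) : weakD Ω i u = g := by
  have hex : ∃ g, IsWeakPartial Ω i u g := ⟨g, h⟩
  rw [weakD, dif_pos hex]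
  exact hex.choose_spec.unique hΩ h

theorem IsWeakPartial.add {i : Fin d} {u v g g' : L2 Ω}
    (h : IsWeakPartial Ω i u g) (h' : IsWeakPartial Ω i v g') :
    IsWeakPartial Ω i (u + v) (g + g') := by
  rw [isWeakPartial_iff] at *
  intro φ hφ
  rw [inner_add_left, inner_add_left, h φ hφ, h' φ hφ]
  ring

theorem IsWeakPartial.smul {i : Fin d} {u g : L2 Ω} (c : ℝ)
    (h : IsWeakPartial Ω i u g) : IsWeakPartial Ω i (c • u) (c • g) := by
  rw [isWeakPartial_iff] at *
  intro φ hφ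
  rw [real_inner_smul_left, real_inner_smul_left, h φ hφ]
  ring

/-- Both sides of the defining identity are continuous in `L²` for a fixed test function. -/
theorem IsWeakPartial.tendsto {i : Fin d} {u g : ℕ → L2 Ω} {u' g' : L2 Ω}
    (h : ∀ n, IsWeakPartial Ω i (u n) (g n)) (hu : Tendsto u atTop (𝓝 u'))
    (hg : Tendsto g atTop (𝓝 g')) : IsWeakPartial Ω i u' g' := by
  rw [isWeakPartial_iff]
  intro φ hφ
  refine tendsto_nhds_unique (hu.inner tendsto_const_nhds) ?_
  refine ((hg.inner tendsto_const_nhds).neg).congr fun n => ?_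
  exact (isWeakPartial_iff.1 (h n) φ hφ).symm

/-! ### The spaces `H¹₀(Ω)` and `H²₀(Ω)` through sequences in `L²(Ω)` -/

theorem tendsto_eLpNorm_iff {φ : ℕ → Space d → ℝ} (h : ∀ n, IsTest Ω (φ n)) {u : L2 Ω} :
    Tendsto (fun n => eLpNorm (φ n - ⇑u) 2 (volume.restrict Ω)) atTop (𝓝 0) ↔
      Tendsto (fun n => toL2 Ω (φ n)) atTop (𝓝 u) := by
  rw [Lp.tendsto_Lp_iff_tendsto_eLpNorm']
  refine tendsto_congr fun n => eLpNorm_congr_ae ?_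
  exact ((h n).coeFn.symm).sub (EventuallyEq.refl _ _)

theorem memH10_iff {u : L2 Ω} : MemH10 Ω u ↔
    ∃ (φ : ℕ → Space d → ℝ) (g : Fin d → L2 Ω), (∀ n, IsTest Ω (φ n)) ∧
      Tendsto (fun n => toL2 Ω (φ n)) atTop (𝓝 u) ∧
      ∀ i, Tendsto (fun n => toL2 Ω (partialD i (φ n))) atTop (𝓝 (g i)) := by
  refine exists₂_congr fun φ g => and_congr_right fun h => ?_
  rw [tendsto_eLpNorm_iff h]
  refine and_congr_right fun _ => forall_congr' fun i => ?_
  exact tendsto_eLpNorm_iff fun n => (h n).partialD i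

theorem memH20_iff {u : L2 Ω} : MemH20 Ω u ↔
    ∃ (φ : ℕ → Space d → ℝ) (g : Fin d → L2 Ω) (h : Fin d → Fin d → L2 Ω),
      (∀ n, IsTest Ω (φ n)) ∧
      Tendsto (fun n => toL2 Ω (φ n)) atTop (𝓝 u) ∧
      (∀ i, Tendsto (fun n => toL2 Ω (partialD i (φ n))) atTop (𝓝 (g i))) ∧
      ∀ i j, Tendsto (fun n => toL2 Ω (partialD i (partialD j (φ n)))) atTop (𝓝 (h i j)) := by
  refine exists₃_congr fun φ g h => and_congr_right fun ht => ?_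
  rw [tendsto_eLpNorm_iff ht]
  refine and_congr_right fun _ => and_congr (forall_congr' fun i => ?_)
    (forall₂_congr fun i j => ?_)
  · exact tendsto_eLpNorm_iff fun n => (ht n).partialD i
  · exact tendsto_eLpNorm_iff fun n => ((ht n).partialD j).partialD i

theorem MemH20.memH10 {u : L2 Ω} (h : MemH20 Ω u) : MemH10 Ω u := by
  obtain ⟨φ, g, _, h1, h2, h3, _⟩ := h
  exact ⟨φ, g, h1, h2, h3⟩

/-- The weak derivatives of `u ∈ H²₀(Ω)` are the limits of those of the test functions. -/
theorem MemH20.exists_seq (hΩ : IsOpen Ω) {u : L2 Ω} (h : MemH20 Ω u) :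
    ∃ φ : ℕ → Space d → ℝ, (∀ n, IsTest Ω (φ n)) ∧
      Tendsto (fun n => toL2 Ω (φ n)) atTop (𝓝 u) ∧
      (∀ i, Tendsto (fun n => toL2 Ω (partialD i (φ n))) atTop (𝓝 (weakD Ω i u))) ∧
      (∀ i j, Tendsto (fun n => toL2 Ω (partialD i (partialD j (φ n)))) atTop
        (𝓝 (weakD Ω i (weakD Ω j u)))) ∧
      (∀ i, IsWeakPartial Ω i u (weakD Ω i u)) ∧
      ∀ i j, IsWeakPartial Ω i (weakD Ω j u) (weakD Ω i (weakD Ω j u)) := by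
  obtain ⟨φ, g, k, ht, h0, h1, h2⟩ := memH20_iff.1 h
  have w1 : ∀ i, IsWeakPartial Ω i u (g i) := fun i =>
    IsWeakPartial.tendsto (fun n => (ht n).isWeakPartial i) h0 (h1 i)
  have w2 : ∀ i j, IsWeakPartial Ω i (g j) (k i j) := fun i j =>
    IsWeakPartial.tendsto (fun n => ((ht n).partialD j).isWeakPartial i) (h1 j) (h2 i j)
  have e1 : ∀ i, weakD Ω i u = g i := fun i => (w1 i).weakD_eq hΩ
  have e2 : ∀ i j, weakD Ω i (weakD Ω j u) = k i j := fun i j => by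
    rw [e1, (w2 i j).weakD_eq hΩ]
  refine ⟨φ, ht, h0, fun i => ?_, fun i j => ?_, fun i => ?_, fun i j => ?_⟩
  · rw [e1]; exact h1 i
  · rw [e2]; exact h2 i j
  · rw [e1]; exact w1 i
  · rw [e2, e1]; exact w2 i j

theorem MemH20.isWeakPartial (hΩ : IsOpen Ω) {u : L2 Ω} (h : MemH20 Ω u) (i : Fin d) :
    IsWeakPartial Ω i u (weakD Ω i u) := by
  obtain ⟨_, _, _, _, _, h, _⟩ := h.exists_seq hΩ
  exact h i

theorem MemH20.isWeakPartial₂ (hΩ : IsOpen Ω) {u : L2 Ω} (h : MemH20 Ω u) (i j : Fin d) :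
    IsWeakPartial Ω i (weakD Ω j u) (weakD Ω i (weakD Ω j u)) := by
  obtain ⟨_, _, _, _, _, _, h⟩ := h.exists_seq hΩ
  exact h i j

theorem MemH20.add {u v : L2 Ω} (hu : MemH20 Ω u) (hv : MemH20 Ω v) : MemH20 Ω (u + v) :=
  (H20 Ω).add_mem hu hv

theorem MemH20.smul {u : L2 Ω} (c : ℝ) (hu : MemH20 Ω u) : MemH20 Ω (c • u) :=
  (H20 Ω).smul_mem c hu

theorem MemH20.sub {u v : L2 Ω} (hu : MemH20 Ω u) (hv : MemH20 Ω v) : MemH20 Ω (u - v) :=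
  (H20 Ω).sub_mem hu hv

theorem MemH20.weakD_add (hΩ : IsOpen Ω) {u v : L2 Ω} (hu : MemH20 Ω u) (hv : MemH20 Ω v)
    (i : Fin d) : weakD Ω i (u + v) = weakD Ω i u + weakD Ω i v :=
  ((hu.isWeakPartial hΩ i).add (hv.isWeakPartial hΩ i)).weakD_eq hΩ

theorem MemH20.weakD_smul (hΩ : IsOpen Ω) {u : L2 Ω} (c : ℝ) (hu : MemH20 Ω u)
    (i : Fin d) : weakD Ω i (c • u) = c • weakD Ω i u :=
  ((hu.isWeakPartial hΩ i).smul c).weakD_eq hΩ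

theorem MemH20.weakD₂_add (hΩ : IsOpen Ω) {u v : L2 Ω} (hu : MemH20 Ω u) (hv : MemH20 Ω v)
    (i j : Fin d) : weakD Ω i (weakD Ω j (u + v))
      = weakD Ω i (weakD Ω j u) + weakD Ω i (weakD Ω j v) := by
  rw [hu.weakD_add hΩ hv]
  exact ((hu.isWeakPartial₂ hΩ i j).add (hv.isWeakPartial₂ hΩ i j)).weakD_eq hΩ

theorem MemH20.weakD₂_smul (hΩ : IsOpen Ω) {u : L2 Ω} (c : ℝ) (hu : MemH20 Ω u)
    (i j : Fin d) : weakD Ω i (weakD Ω j (c • u)) = c • weakD Ω i (weakD Ω j u) := by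
  rw [hu.weakD_smul hΩ]
  exact ((hu.isWeakPartial₂ hΩ i j).smul c).weakD_eq hΩ

theorem MemH20.lap_add (hΩ : IsOpen Ω) {u v : L2 Ω} (hu : MemH20 Ω u) (hv : MemH20 Ω v) :
    lap Ω (u + v) = lap Ω u + lap Ω v := by
  simp only [lap, hu.weakD₂_add hΩ hv, Finset.sum_add_distrib]

theorem MemH20.lap_sub (hΩ : IsOpen Ω) {u v : L2 Ω} (hu : MemH20 Ω u) (hv : MemH20 Ω v) :
    lap Ω (u - v) = lap Ω u - lap Ω v := by
  have := (hu.sub hv).lap_add hΩ hv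
  rw [sub_add_cancel] at this
  rw [this, add_sub_cancel_right]

/-! ### The Laplacian on `H²₀(Ω)` is a closed operator -/

theorem partialD_comm {φ : Space d → ℝ} (hφ : ContDiff ℝ ∞ φ) (i j : Fin d) :
    partialD i (partialD j φ) = partialD j (partialD i φ) := by
  funext x
  have hd : Differentiable ℝ (fderiv ℝ φ) :=
    (hφ.fderiv_right (m := ∞) (by simp)).differentiable (by simp)
  have key : ∀ k l : Fin d, partialD k (partialD l φ) x
      = fderiv ℝ (fderiv ℝ φ) x (EuclideanSpace.single k 1) (EuclideanSpace.single l 1) := by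
    intro k l
    have : partialD l φ = fun x => fderiv ℝ φ x (EuclideanSpace.single l 1) := rfl
    rw [partialD, this, fderiv_clm_apply (hd x) (differentiableAt_const _)]
    simp
  rw [key, key]
  have hs : IsSymmSndFDerivAt ℝ φ x := hφ.contDiffAt.isSymmSndFDerivAt (by
    rw [minSmoothness_of_isRCLikeNormedField]
    exact WithTop.coe_le_coe.2 (le_top : (2 : ℕ∞) ≤ ⊤))
  exact hs _ _

theorem IsTest.inner_ibp {φ ψ : Space d → ℝ} (hφ : IsTest Ω φ) (hψ : IsTest Ω ψ) (i : Fin d) :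
    inner ℝ (toL2 Ω φ) (toL2 Ω (PolyExt.partialD i ψ))
      = - inner ℝ (toL2 Ω (PolyExt.partialD i φ)) (toL2 Ω ψ) :=
  isWeakPartial_iff.1 (hφ.isWeakPartial i) ψ hψ

/-- Integration by parts gives `∑ⱼ ‖∂ⱼφ‖² = -⟨φ, Δφ⟩`. Gradients are thereby controlled by `φ` and
`Δφ`. -/
theorem IsTest.norm_partialD_sq_le {φ : Space d → ℝ} (hφ : IsTest Ω φ) (i : Fin d) :
    ‖toL2 Ω (PolyExt.partialD i φ)‖ ^ 2 ≤ ‖toL2 Ω φ‖ * ‖toL2 Ω (lapC φ)‖ := by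
  have h1 : ∑ j, ‖toL2 Ω (PolyExt.partialD j φ)‖ ^ 2
      = - inner ℝ (toL2 Ω φ) (toL2 Ω (lapC φ)) := by
    rw [hφ.toL2_lapC, inner_sum, ← Finset.sum_neg_distrib]
    refine Finset.sum_congr rfl fun j _ => ?_
    rw [hφ.inner_ibp (hφ.partialD j), neg_neg, real_inner_self_eq_norm_sq]
  calc ‖toL2 Ω (PolyExt.partialD i φ)‖ ^ 2
      ≤ ∑ j, ‖toL2 Ω (PolyExt.partialD j φ)‖ ^ 2 :=
        Finset.single_le_sum (f := fun j => ‖toL2 Ω (PolyExt.partialD j φ)‖ ^ 2)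
          (fun j _ => sq_nonneg _) (Finset.mem_univ i)
    _ ≤ |inner ℝ (toL2 Ω φ) (toL2 Ω (lapC φ))| := by
        rw [h1]; exact neg_le_abs _
    _ ≤ _ := abs_real_inner_le_norm _ _

/-- Two integrations by parts and the symmetry of mixed derivatives give `‖∂ᵢ∂ⱼφ‖² = ⟨∂ᵢ²φ, ∂ⱼ²φ⟩`,
and the sum over `i`, `j` is `‖Δφ‖²`. Compact support removes all boundary terms, so the shape of
`Ω` plays no role. -/
theorem IsTest.norm_partialD₂_le {φ : Space d → ℝ} (hφ : IsTest Ω φ) (i j : Fin d) :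
    ‖toL2 Ω (PolyExt.partialD i (PolyExt.partialD j φ))‖ ≤ ‖toL2 Ω (lapC φ)‖ := by
  have h0 : ∀ i j, ‖toL2 Ω (PolyExt.partialD i (PolyExt.partialD j φ))‖ ^ 2
      = inner ℝ (toL2 Ω (PolyExt.partialD i (PolyExt.partialD i φ)))
          (toL2 Ω (PolyExt.partialD j (PolyExt.partialD j φ))) := by
    intro i j
    have e : PolyExt.partialD i (PolyExt.partialD i (PolyExt.partialD j φ))
        = PolyExt.partialD j (PolyExt.partialD i (PolyExt.partialD i φ)) := by
      rw [partialD_comm hφ.1 i j, partialD_comm (contDiff_partialD i hφ.1) i j]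
    rw [← real_inner_self_eq_norm_sq,
      ((hφ.partialD j).partialD i).inner_ibp (hφ.partialD j) i, e,
      ((hφ.partialD i).partialD i).inner_ibp (hφ.partialD j) j]
  have h1 : ∑ i, ∑ j, ‖toL2 Ω (PolyExt.partialD i (PolyExt.partialD j φ))‖ ^ 2
      = ‖toL2 Ω (lapC φ)‖ ^ 2 := by
    rw [← real_inner_self_eq_norm_sq, hφ.toL2_lapC, sum_inner]
    refine Finset.sum_congr rfl fun i _ => ?_
    rw [inner_sum]
    exact Finset.sum_congr rfl fun j _ => h0 i j
  refine (sq_le_sq₀ (norm_nonneg _) (norm_nonneg _)).1 ?_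
  rw [← h1]
  refine le_trans ?_ (Finset.single_le_sum
    (f := fun i => ∑ j, ‖toL2 Ω (PolyExt.partialD i (PolyExt.partialD j φ))‖ ^ 2)
    (fun i _ => Finset.sum_nonneg fun j _ => sq_nonneg _) (Finset.mem_univ i))
  exact Finset.single_le_sum
    (f := fun j => ‖toL2 Ω (PolyExt.partialD i (PolyExt.partialD j φ))‖ ^ 2)
    (fun j _ => sq_nonneg _) (Finset.mem_univ j)

theorem lapC_add {φ ψ : Space d → ℝ} (hφ : ContDiff ℝ ∞ φ) (hψ : ContDiff ℝ ∞ ψ) :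
    lapC (φ + ψ) = lapC φ + lapC ψ := by
  simp only [lapC, ← Finset.sum_add_distrib]
  refine Finset.sum_congr rfl fun i _ => ?_
  rw [partialD_add i hφ hψ, partialD_add i (contDiff_partialD i hφ) (contDiff_partialD i hψ)]

theorem lapC_smul (c : ℝ) (φ : Space d → ℝ) : lapC (c • φ) = c • lapC φ := by
  simp only [lapC, Finset.smul_sum, partialD_smul]

theorem IsTest.lapC {φ : Space d → ℝ} (h : IsTest Ω φ) : IsTest Ω (lapC φ) := by
  unfold PolyExt.lapC
  refine Finset.sum_induction _ (IsTest Ω) (fun _ _ => IsTest.add) isTest_zero fun i _ =>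
    (h.partialD i).partialD i

/-- The graph of the Laplacian on test functions, in the Hilbert space `L²(Ω) × L²(Ω)`. -/
def testGraph (Ω : Set (Space d)) : Submodule ℝ (WithLp 2 (L2 Ω × L2 Ω)) where
  carrier := {p | ∃ φ, IsTest Ω φ ∧ p = WithLp.toLp 2 (toL2 Ω φ, toL2 Ω (lapC φ))}
  zero_mem' := ⟨0, isTest_zero, by
    have h0 : toL2 Ω (0 : Space d → ℝ) = 0 := by
      simpa using toL2_sum (Ω := Ω) (∅ : Finset ℕ) (φ := fun _ => 0) (by simp)
    have : lapC (0 : Space d → ℝ) = 0 := by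
      have := lapC_smul 0 (0 : Space d → ℝ)
      simpa using this
    rw [this, h0]
    rfl⟩
  add_mem' := by
    rintro _ _ ⟨φ, hφ, rfl⟩ ⟨ψ, hψ, rfl⟩
    refine ⟨φ + ψ, hφ.add hψ, ?_⟩
    rw [lapC_add hφ.1 hψ.1, toL2_add hφ.memLp hψ.memLp,
      toL2_add hφ.lapC.memLp hψ.lapC.memLp]
    rfl
  smul_mem' := by
    rintro c _ ⟨φ, hφ, rfl⟩
    refine ⟨c • φ, hφ.smul c, ?_⟩
    rw [lapC_smul, toL2_smul c hφ.memLp, toL2_smul c hφ.lapC.memLp]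
    rfl

theorem MemH20.exists_seq_lap (hΩ : IsOpen Ω) {u : L2 Ω} (h : MemH20 Ω u) :
    ∃ φ : ℕ → Space d → ℝ, (∀ n, IsTest Ω (φ n)) ∧
      Tendsto (fun n => toL2 Ω (φ n)) atTop (𝓝 u) ∧
      Tendsto (fun n => toL2 Ω (lapC (φ n))) atTop (𝓝 (lap Ω u)) := by
  obtain ⟨φ, ht, h0, _, h2, _⟩ := h.exists_seq hΩ
  refine ⟨φ, ht, h0, ?_⟩
  simp only [fun n => (ht n).toL2_lapC]
  exact tendsto_finsetSum _ fun i _ => h2 i i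

/-- The two a priori bounds, applied to differences `φ n - φ m`, make every first and second
derivative a Cauchy sequence. Convergence of the functions and of their Laplacians is thus already
convergence in `H²`. -/
theorem memH20_of_tendsto (hΩ : IsOpen Ω) {φ : ℕ → Space d → ℝ} (ht : ∀ n, IsTest Ω (φ n))
    {v w : L2 Ω} (hv : Tendsto (fun n => toL2 Ω (φ n)) atTop (𝓝 v))
    (hw : Tendsto (fun n => toL2 Ω (lapC (φ n))) atTop (𝓝 w)) :
    MemH20 Ω v ∧ lap Ω v = w := by
  have hsub : ∀ n m, IsTest Ω (φ n - φ m) := fun n m => by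
    have := (ht n).add ((ht m).smul (-1))
    rwa [neg_one_smul, ← sub_eq_add_neg] at this
  have es : ∀ f g : Space d → ℝ, IsTest Ω f → IsTest Ω g →
      toL2 Ω (f - g) = toL2 Ω f - toL2 Ω g := fun f g hf hg => by
    have := toL2_add hf.memLp (hg.smul (-1)).memLp
    rw [toL2_smul _ hg.memLp, neg_one_smul, neg_one_smul, ← sub_eq_add_neg,
      ← sub_eq_add_neg] at this
    exact this
  have ep : ∀ i, ∀ f g : Space d → ℝ, ContDiff ℝ ∞ f → ContDiff ℝ ∞ g →
      partialD i (f - g) = partialD i f - partialD i g := fun i f g hf hg => by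
    have := partialD_add i hf (show ContDiff ℝ ∞ ((-1 : ℝ) • g) from contDiff_const.smul hg)
    rw [partialD_smul, neg_one_smul, neg_one_smul, ← sub_eq_add_neg, ← sub_eq_add_neg] at this
    exact this
  have el : ∀ n m, lapC (φ n - φ m) = lapC (φ n) - lapC (φ m) := fun n m => by
    have := lapC_add (ht n).1 ((ht m).smul (-1)).1
    rw [lapC_smul, neg_one_smul, neg_one_smul, ← sub_eq_add_neg, ← sub_eq_add_neg] at this
    exact this
  have cv := hv.cauchySeq
  have cw := hw.cauchySeq
  have c2 : ∀ i j, CauchySeq fun n => toL2 Ω (partialD i (partialD j (φ n))) := by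
    intro i j
    rw [Metric.cauchySeq_iff] at cw ⊢
    intro ε hε
    obtain ⟨N, hN⟩ := cw ε hε
    refine ⟨N, fun m hm n hn => ?_⟩
    refine lt_of_le_of_lt ?_ (hN m hm n hn)
    have := (hsub m n).norm_partialD₂_le i j
    rw [ep _ _ _ (ht m).1 (ht n).1, ep _ _ _ (contDiff_partialD j (ht m).1)
      (contDiff_partialD j (ht n).1), es _ _ (((ht m).partialD j).partialD i)
      (((ht n).partialD j).partialD i), el, es _ _ (ht m).lapC (ht n).lapC] at this
    rwa [dist_eq_norm, dist_eq_norm]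
  have c1 : ∀ i, CauchySeq fun n => toL2 Ω (partialD i (φ n)) := by
    intro i
    rw [Metric.cauchySeq_iff] at cw cv ⊢
    intro ε hε
    obtain ⟨N, hN⟩ := cw ε hε
    obtain ⟨N', hN'⟩ := cv ε hε
    refine ⟨max N N', fun m hm n hn => ?_⟩
    have b1 := hN m (le_of_max_le_left hm) n (le_of_max_le_left hn)
    have b2 := hN' m (le_of_max_le_right hm) n (le_of_max_le_right hn)
    have := (hsub m n).norm_partialD_sq_le i
    rw [ep _ _ _ (ht m).1 (ht n).1, es _ _ ((ht m).partialD i)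
      ((ht n).partialD i), el, es _ _ (ht m).lapC (ht n).lapC, es _ _ (ht m) (ht n)] at this
    rw [dist_eq_norm] at b1 b2 ⊢
    have b3 := mul_lt_mul'' b2 b1 (norm_nonneg _) (norm_nonneg _)
    refine lt_of_pow_lt_pow_left₀ 2 hε.le ?_
    rw [sq ε]
    exact this.trans_lt b3
  choose g hg using fun i => cauchySeq_tendsto_of_complete (c1 i)
  choose k hk using fun i j => cauchySeq_tendsto_of_complete (c2 i j)
  have hm : MemH20 Ω v := memH20_iff.2 ⟨φ, g, k, ht, hv, hg, hk⟩
  refine ⟨hm, ?_⟩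
  have w1 : ∀ i, IsWeakPartial Ω i v (g i) := fun i =>
    IsWeakPartial.tendsto (fun n => (ht n).isWeakPartial i) hv (hg i)
  have w2 : ∀ i j, IsWeakPartial Ω i (g j) (k i j) := fun i j =>
    IsWeakPartial.tendsto (fun n => ((ht n).partialD j).isWeakPartial i) (hg j) (hk i j)
  refine tendsto_nhds_unique (f := fun n => toL2 Ω (lapC (φ n))) (l := atTop) ?_ hw
  simp only [fun n => (ht n).toL2_lapC, lap]
  refine tendsto_finsetSum _ fun i _ => ?_
  rw [(w1 i).weakD_eq hΩ, (w2 i i).weakD_eq hΩ]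
  exact hk i i

/-- The graph of the Laplacian on `H²₀(Ω)` is the orthogonal complement of the orthogonal
complement of the graph on test functions. -/
theorem memH20_and_lap_eq_iff (hΩ : IsOpen Ω) {v w : L2 Ω} :
    (MemH20 Ω v ∧ lap Ω v = w) ↔
      ∀ α β : L2 Ω, (∀ φ, IsTest Ω φ → inner ℝ α (toL2 Ω φ) + inner ℝ β (toL2 Ω (lapC φ)) = 0) →
        inner ℝ α v + inner ℝ β w = 0 := by
  constructor
  · rintro ⟨hv, rfl⟩ α β h
    obtain ⟨φ, ht, h1, h2⟩ := hv.exists_seq_lap hΩ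
    refine tendsto_nhds_unique (f := fun n => inner ℝ α (toL2 Ω (φ n))
      + inner ℝ β (toL2 Ω (lapC (φ n)))) (l := atTop)
      ((tendsto_const_nhds.inner h1).add (tendsto_const_nhds.inner h2)) ?_
    simp only [fun n => h _ (ht n)]
    exact tendsto_const_nhds
  · intro h
    -- In a Hilbert space the double orthogonal complement of a subspace is its closure. Membership
    -- in the graph thus becomes a family of scalar identities, stable under weak limits and under
    -- operations that act on scalar products only.
    have hmem : WithLp.toLp 2 (v, w) ∈ (testGraph Ω).topologicalClosure := by
      rw [← Submodule.orthogonal_orthogonal_eq_closure, Submodule.mem_orthogonal]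
      intro p hp
      rw [Submodule.mem_orthogonal'] at hp
      have := h p.fst p.snd fun φ hφ => by
        have := hp _ ⟨φ, hφ, rfl⟩
        simpa [WithLp.prod_inner_apply] using this
      simpa [WithLp.prod_inner_apply] using this
    rw [← SetLike.mem_coe, Submodule.topologicalClosure_coe,
      mem_closure_iff_seq_limit] at hmem
    obtain ⟨p, hp, hlim⟩ := hmem
    choose φ ht hφ using hp
    have hfst : Continuous (fun q : WithLp 2 (L2 Ω × L2 Ω) => q.fst) := by fun_prop
    have hsnd : Continuous (fun q : WithLp 2 (L2 Ω × L2 Ω) => q.snd) := by fun_prop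
    have l1 := (hfst.tendsto _).comp hlim
    have l2 := (hsnd.tendsto _).comp hlim
    refine memH20_of_tendsto hΩ ht (l1.congr fun n => ?_) (l2.congr fun n => ?_)
    · simp [hφ]
    · simp [hφ]

/-- A test function, taken as a constant sequence, lies in `H²₀(Ω)`; anything orthogonal to all of
these vanishes. -/
theorem dense_H20 (hΩ : IsOpen Ω) : DenseRange (H20 Ω).subtype := by
  have hcl : (H20 Ω).topologicalClosure = ⊤ := by
    rw [Submodule.topologicalClosure_eq_top_iff, Submodule.eq_bot_iff]
    intro u hu
    rw [Submodule.mem_orthogonal'] at hu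
    refine eq_zero_of_inner_test hΩ fun φ hφ => hu _ ?_
    exact (memH20_of_tendsto hΩ (fun _ => hφ) tendsto_const_nhds tendsto_const_nhds).1
  have : Dense ((H20 Ω : Submodule ℝ (L2 Ω)) : Set (L2 Ω)) := by
    rw [dense_iff_closure_eq, ← Submodule.topologicalClosure_coe, hcl]
    rfl
  rw [DenseRange]
  convert this
  ext x
  simp

/-- A function with a bounded sequence of Laplacians of approximating test functions
is in `H²₀(Ω)`. -/
theorem memH20_of_bounded (hΩ : IsOpen Ω) {φ : ℕ → Space d → ℝ} (ht : ∀ n, IsTest Ω (φ n))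
    {v w : L2 Ω} (hv : Tendsto (fun n => toL2 Ω (φ n)) atTop (𝓝 v))
    {C : ℝ} (hC : ∀ n, ‖toL2 Ω (lapC (φ n))‖ ≤ C)
    (hw : ∀ ψ, IsTest Ω ψ → inner ℝ v (toL2 Ω (lapC ψ)) = inner ℝ w (toL2 Ω ψ)) :
    MemH20 Ω v ∧ lap Ω v = w := by
  have hG : ∀ f g : Space d → ℝ, IsTest Ω f → IsTest Ω g →
      inner ℝ (toL2 Ω (lapC f)) (toL2 Ω g) = inner ℝ (toL2 Ω f) (toL2 Ω (lapC g)) := by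
    intro f g hf hg
    rw [hf.toL2_lapC, hg.toL2_lapC, sum_inner, inner_sum]
    refine Finset.sum_congr rfl fun i _ => ?_
    rw [hf.inner_ibp (hg.partialD i), (hf.partialD i).inner_ibp hg, neg_neg]
  -- Weak convergence of the Laplacians to `w`: Green's formula gives it against test functions, and
  -- their density together with the uniform bound `C` gives it against every `β`.
  have hlim : ∀ β : L2 Ω, Tendsto (fun n => inner ℝ β (toL2 Ω (lapC (φ n)))) atTop
      (𝓝 (inner ℝ β w)) := by
    have hcl : ∀ β : L2 Ω, β ∈ closure {β : L2 Ω | ∃ ψ, IsTest Ω ψ ∧ β = toL2 Ω ψ} := by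
      intro β
      obtain ⟨u, hu⟩ := mem_closure_iff_seq_limit.1 ((dense_H20 hΩ).closure_range ▸ mem_univ β)
      refine closure_minimal ?_ isClosed_closure ((dense_H20 hΩ).closure_range ▸ mem_univ β)
      rintro _ ⟨y, rfl⟩
      obtain ⟨ψ, hψ, h1, _⟩ := y.2.exists_seq_lap hΩ
      exact mem_closure_of_tendsto h1 (Eventually.of_forall fun n => ⟨_, hψ n, rfl⟩)
    intro β
    have hC0 : 0 ≤ C := (norm_nonneg _).trans (hC 0)
    rw [Metric.tendsto_atTop]
    intro ε hε
    obtain ⟨_, ⟨ψ, hψ, rfl⟩, hb⟩ := Metric.mem_closure_iff.1 (hcl β) (ε / (2 * (C + ‖w‖ + 1)))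
      (by positivity)
    have t1 : Tendsto (fun n => inner ℝ (toL2 Ω ψ) (toL2 Ω (lapC (φ n)))) atTop
        (𝓝 (inner ℝ (toL2 Ω ψ) w)) := by
      rw [real_inner_comm, ← hw ψ hψ]
      refine (hv.inner tendsto_const_nhds).congr fun n => ?_
      rw [← hG _ _ (ht n) hψ, real_inner_comm]
    obtain ⟨N, hN⟩ := Metric.tendsto_atTop.1 t1 (ε / 2) (by positivity)
    refine ⟨N, fun n hn => ?_⟩
    have h1 := hN n hn
    rw [Real.dist_eq] at h1 ⊢
    rw [dist_eq_norm] at hb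
    have e : inner ℝ β (toL2 Ω (lapC (φ n))) - inner ℝ β w
        = inner ℝ (β - toL2 Ω ψ) (toL2 Ω (lapC (φ n)) - w)
          + (inner ℝ (toL2 Ω ψ) (toL2 Ω (lapC (φ n))) - inner ℝ (toL2 Ω ψ) w) := by
      simp only [inner_sub_left, inner_sub_right]
      ring
    rw [e]
    have h2 : |inner ℝ (β - toL2 Ω ψ) (toL2 Ω (lapC (φ n)) - w)| ≤ ε / 2 := by
      refine (abs_real_inner_le_norm _ _).trans ?_
      have h3 : ‖toL2 Ω (lapC (φ n)) - w‖ ≤ C + ‖w‖ + 1 :=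
        (norm_sub_le _ _).trans (by linarith [hC n])
      calc _ ≤ ε / (2 * (C + ‖w‖ + 1)) * (C + ‖w‖ + 1) :=
            mul_le_mul hb.le h3 (norm_nonneg _) (by positivity)
        _ = ε / 2 := by
            have : C + ‖w‖ + 1 ≠ 0 := by positivity
            field_simp
    exact (abs_add_le _ _).trans_lt (by linarith)
  -- The orthogonality criterion involves the Laplacians only through scalar products, so weak
  -- convergence suffices.
  refine (memH20_and_lap_eq_iff hΩ).2 fun α β h => ?_
  refine tendsto_nhds_unique (f := fun n => inner ℝ α (toL2 Ω (φ n))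
    + inner ℝ β (toL2 Ω (lapC (φ n)))) (l := atTop)
    ((tendsto_const_nhds.inner hv).add (hlim β)) ?_
  simp only [fun n => h _ (ht n)]
  exact tendsto_const_nhds

/-- The eigenfunction is only known to be in `H¹₀(Ω)`, so the derivative is moved from `Δv` onto
test functions approximating the eigenfunction. The weak eigenvalue equation, tested with `v`, then
applies. -/
theorem DirichletEigensystem.inner_lap (hΩ : IsOpen Ω) (eig : DirichletEigensystem Ω) (k : ℕ)
    {v : L2 Ω} (hv : MemH20 Ω v) :
    inner ℝ (eig.eigfun k) (lap Ω v) = - (eig.eigval k * inner ℝ (eig.eigfun k) v) := by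
  rw [← eig.eigen_eq k v hv.memH10, lap, inner_sum, ← Finset.sum_neg_distrib]
  refine Finset.sum_congr rfl fun i _ => ?_
  obtain ⟨ψ, g, ht, h0, h1⟩ := memH10_iff.1 (eig.mem_H10 k)
  have w1 : weakD Ω i (eig.eigfun k) = g i :=
    (IsWeakPartial.tendsto (fun n => (ht n).isWeakPartial i) h0 (h1 i)).weakD_eq hΩ
  rw [w1]
  refine tendsto_nhds_unique (h0.inner tendsto_const_nhds) ?_
  refine (((h1 i).inner tendsto_const_nhds).neg).congr fun n => ?_
  have := isWeakPartial_iff.1 (hv.isWeakPartial₂ hΩ i i) (ψ n) (ht n)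
  rw [real_inner_comm, this, real_inner_comm, neg_neg]

end PolyExt

end

noncomputable section

namespace PolyExt

variable {d : ℕ} {Ω : Set (Space d)}

/-! ### Functions of class `C¹` with vanishing trace and normal derivative on a convex domain -/

theorem inter_frontier_nonempty_of_isPreconnected {X : Type*} [TopologicalSpace X] {s u : Set X}
    (hu : IsOpen u) (hs : IsPreconnected s) (h1 : (s ∩ u).Nonempty) (h2 : (s ∩ uᶜ).Nonempty) :
    (s ∩ frontier u).Nonempty := by
  by_contra hne
  rw [not_nonempty_iff_eq_empty] at hne
  have hcov : ∀ y ∈ s, y ∉ u → y ∈ (closure u)ᶜ := by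
    intro y hy hyu hyc
    have : y ∈ s ∩ frontier u := ⟨hy, hyc, by rwa [hu.interior_eq]⟩
    rw [hne] at this
    exact this
  obtain ⟨y, hy, hyu⟩ := h2
  obtain ⟨w, _, hw, hw'⟩ := hs u (closure u)ᶜ hu isClosed_closure.isOpen_compl
    (fun y hy => or_iff_not_imp_left.2 (hcov y hy)) h1 ⟨y, hy, hcov y hy hyu⟩
  exact hw' (subset_closure hw)

/-- At a boundary point touched from inside by a ball centred at `z`, the vector `n = x - z` is an
outward normal, which handles the derivative along `n`. The boundary is squeezed between the
supporting hyperplane and the ball, so within `O(t²)` of `x + t e`, with `e ⊥ n`, there is a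
boundary point. Since `r` vanishes there, the tangential derivative is zero as well. -/
theorem fderivWithin_eq_zero_of_inner_ball (hΩ : IsOpen Ω) (hconv : Convex ℝ Ω)
    {r : Space d → ℝ} (hr : DifferentiableOn ℝ r (closure Ω))
    (h0 : ∀ x ∈ frontier Ω, r x = 0)
    (hn : ∀ x ∈ frontier Ω, ∀ ν : Space d, (∀ z ∈ Ω, inner ℝ ν (z - x) ≤ 0) →
      fderivWithin ℝ r (closure Ω) x ν = 0)
    {x z : Space d} (hx : x ∈ frontier Ω) (hxz : x ≠ z) (hball : Metric.ball z (dist x z) ⊆ Ω) :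
    fderivWithin ℝ r (closure Ω) x = 0 := by
  have hxΩ : x ∉ Ω := fun h => hx.2 (hΩ.interior_eq.symm ▸ h)
  set n : Space d := x - z with hn_def
  have hnpos : 0 < ‖n‖ := norm_pos_iff.2 (sub_ne_zero.2 hxz)
  have hball' : ∀ w : Space d, ‖w - z‖ ^ 2 < ‖n‖ ^ 2 → w ∈ Ω := fun w hw =>
    hball (by
      rw [Metric.mem_ball, dist_eq_norm, dist_eq_norm]
      exact lt_of_pow_lt_pow_left₀ 2 (norm_nonneg _) hw)
  have hsupp : ∀ a ∈ Ω, inner ℝ n (a - x) ≤ 0 := by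
    intro a ha
    by_contra! hpos
    have hax : 0 < ‖a - x‖ := norm_pos_iff.2 fun h => by simp [h] at hpos
    -- If `a ∈ Ω` lay beyond the hyperplane, the point of the line through `a` and `x` nearest to
    -- `z` would be `x - s(a - x)`. It lies in the ball, so `x` would be a convex combination of two
    -- points of `Ω`.
    set s : ℝ := inner ℝ n (a - x) / ‖a - x‖ ^ 2 with hs
    have hspos : 0 < s := by positivity
    have hw : x - s • (a - x) ∈ Ω := by
      refine hball' _ ?_
      have e : x - s • (a - x) - z = n - s • (a - x) := by rw [hn_def]; abel
      rw [e, norm_sub_sq_real, real_inner_smul_right, norm_smul, mul_pow, Real.norm_eq_abs, sq_abs]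
      have : s ^ 2 * ‖a - x‖ ^ 2 = s * inner ℝ n (a - x) := by
        rw [hs]; field_simp
      rw [this]
      nlinarith [mul_pos hspos hpos]
    refine hxΩ ?_
    have := hconv hw ha (a := 1 / (1 + s)) (b := s / (1 + s)) (by positivity) (by positivity)
      (by field_simp)
    convert this using 1
    have h1 : (1 + s) ≠ 0 := by positivity
    have : (1 + s) • x = (1 + s) • ((1 / (1 + s)) • (x - s • (a - x)) + (s / (1 + s)) • a) := by
      rw [smul_add, smul_smul, smul_smul, mul_div_cancel₀ _ h1, mul_div_cancel₀ _ h1, one_smul]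
      module
    exact smul_right_injective _ h1 this
  have hLn := hn x hx n hsupp
  set L := fderivWithin ℝ r (closure Ω) x with hL
  have hder : HasFDerivWithinAt r L (closure Ω) x :=
    (hr x (frontier_subset_closure hx)).hasFDerivWithinAt
  have hLe : ∀ e : Space d, inner ℝ n e = 0 → L e = 0 := by
    intro e he
    -- Chosen so that `x + t e - κ t² n` is strictly inside the ball: using `(1-κt²)² ≤ 1-κt²`, its
    -- squared distance to `z` is at most `‖n‖² - t²`. At `c = 0` the point is on the supporting
    -- hyperplane, hence outside `Ω`. The segment between them must cross the frontier.
    set κ : ℝ := (‖e‖ ^ 2 + 1) / ‖n‖ ^ 2 with hκ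
    have hκpos : 0 < κ := by positivity
    have hex : ∀ t : ℝ, 0 < t → κ * t ^ 2 ≤ 1 → ∃ c, 0 ≤ c ∧ c ≤ κ * t ^ 2 ∧
        x + t • e - c • n ∈ frontier Ω := by
      intro t ht hκt
      have hc : IsPreconnected ((fun c : ℝ => x + t • e - c • n) '' Icc 0 (κ * t ^ 2)) :=
        isPreconnected_Icc.image _ (by fun_prop)
      have hpos : 0 ≤ κ * t ^ 2 := by positivity
      have h1 : ((fun c : ℝ => x + t • e - c • n) '' Icc 0 (κ * t ^ 2) ∩ Ω).Nonempty := by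
        refine ⟨_, ⟨κ * t ^ 2, ⟨hpos, le_rfl⟩, rfl⟩, hball' _ ?_⟩
        have e1 : x + t • e - (κ * t ^ 2) • n - z = (1 - κ * t ^ 2) • n + t • e := by
          rw [hn_def]; module
        dsimp only
        rw [e1, norm_add_sq_real, real_inner_smul_left, real_inner_smul_right, he, norm_smul,
          norm_smul, mul_pow, mul_pow, Real.norm_eq_abs, sq_abs, Real.norm_eq_abs, sq_abs]
        have e2 : κ * ‖n‖ ^ 2 = ‖e‖ ^ 2 + 1 := by rw [hκ]; field_simp
        have e3 : 0 < t ^ 2 := by positivity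
        nlinarith [mul_nonneg hpos (sub_nonneg.2 hκt), mul_pos e3 hκpos, sq_nonneg ‖n‖,
          mul_nonneg (mul_nonneg hpos (sub_nonneg.2 hκt)) (sq_nonneg ‖n‖)]
      have h2 : ((fun c : ℝ => x + t • e - c • n) '' Icc 0 (κ * t ^ 2) ∩ Ωᶜ).Nonempty := by
        refine ⟨_, ⟨0, ⟨le_rfl, hpos⟩, rfl⟩, fun hmem => ?_⟩
        dsimp only at hmem
        rw [zero_smul, sub_zero] at hmem
        have hcont : Continuous fun s : ℝ => x + t • e + s • n := by fun_prop
        have hev : ∀ᶠ s in 𝓝[>] (0 : ℝ), x + t • e + s • n ∈ Ω := by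
          refine mem_nhdsWithin_of_mem_nhds (hcont.continuousAt.preimage_mem_nhds ?_)
          rw [zero_smul, add_zero]
          exact hΩ.mem_nhds hmem
        obtain ⟨s, hs, hs0⟩ := (hev.and self_mem_nhdsWithin).exists
        have := hsupp _ hs
        have e1 : x + t • e + s • n - x = t • e + s • n := by abel
        rw [e1, inner_add_right, real_inner_smul_right, real_inner_smul_right, he,
          real_inner_self_eq_norm_sq] at this
        have : 0 < s * ‖n‖ ^ 2 := mul_pos hs0 (by positivity)
        linarith
      obtain ⟨_, ⟨c, hc, rfl⟩, hf⟩ := inter_frontier_nonempty_of_isPreconnected hΩ hc h1 h2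
      exact ⟨c, hc.1, hc.2, hf⟩
    by_contra hne
    have hLpos : 0 < |L e| := abs_pos.2 hne
    set δ : ℝ := |L e| / (2 * (‖e‖ + ‖n‖ + 1)) with hδ
    have hδpos : 0 < δ := by positivity
    have hbound := hder.isLittleO.bound hδpos
    obtain ⟨ε, hε, hball⟩ := Metric.mem_nhdsWithin_iff.1 hbound
    have ht : ∃ t : ℝ, 0 < t ∧ κ * t ≤ 1 ∧ t ≤ 1 ∧ t * (‖e‖ + ‖n‖) < ε := by
      refine ⟨min (min (1 / κ) 1) (ε / (2 * (‖e‖ + ‖n‖ + 1))), by positivity, ?_, ?_, ?_⟩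
      · have : min (min (1 / κ) 1) (ε / (2 * (‖e‖ + ‖n‖ + 1))) ≤ 1 / κ :=
          (min_le_left _ _).trans (min_le_left _ _)
        calc κ * _ ≤ κ * (1 / κ) := by gcongr
          _ = 1 := by field_simp
      · exact (min_le_left _ _).trans (min_le_right _ _)
      · calc _ ≤ ε / (2 * (‖e‖ + ‖n‖ + 1)) * (‖e‖ + ‖n‖) := by
              gcongr; exact min_le_right _ _
          _ < ε := by
              rw [div_mul_eq_mul_div, div_lt_iff₀ (by positivity)]
              nlinarith [norm_nonneg e, norm_nonneg n]
    obtain ⟨t, ht0, ht1, ht2, ht3⟩ := ht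
    have hκt : κ * t ^ 2 ≤ t := by nlinarith
    obtain ⟨c, hc0, hc1, hfr⟩ := hex t ht0 (hκt.trans ht2)
    have hnorm : ‖x + t • e - c • n - x‖ ≤ t * (‖e‖ + ‖n‖) := by
      have e1 : x + t • e - c • n - x = t • e - c • n := by abel
      rw [e1]
      refine (norm_sub_le _ _).trans ?_
      rw [norm_smul, norm_smul, Real.norm_of_nonneg ht0.le, Real.norm_of_nonneg hc0, mul_add]
      gcongr
      exact hc1.trans hκt
    have hmem := hball (a := x + t • e - c • n)
      ⟨by rw [Metric.mem_ball, dist_eq_norm]; exact hnorm.trans_lt ht3,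
        frontier_subset_closure hfr⟩
    simp only [mem_ofPred_eq, h0 _ hfr, h0 _ hx] at hmem
    have e1 : x + t • e - c • n - x = t • e - c • n := by abel
    rw [e1, map_sub, map_smul, map_smul, hLn, ← e1] at hmem
    simp only [smul_eq_mul, mul_zero, sub_zero, zero_sub, norm_neg, norm_mul,
      Real.norm_eq_abs, abs_of_pos ht0] at hmem
    have h3 : t * |L e| ≤ δ * (t * (‖e‖ + ‖n‖)) :=
      hmem.trans (by gcongr)
    have h4 : |L e| ≤ δ * (‖e‖ + ‖n‖) := by
      refine le_of_mul_le_mul_left ?_ ht0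
      linarith
    have h5 : δ * (‖e‖ + ‖n‖ + 1) = |L e| / 2 := by
      rw [hδ]; field_simp
    nlinarith
  ext w
  have hdec : w = (w - (inner ℝ n w / ‖n‖ ^ 2) • n) + (inner ℝ n w / ‖n‖ ^ 2) • n := by abel
  rw [hdec, map_add, map_smul, hLn, hLe]
  · simp
  · rw [inner_sub_right, real_inner_smul_right, real_inner_self_eq_norm_sq]
    field_simp
    ring

/-- Boundary points touched by an inner ball are dense: for `z ∈ Ω` near `x`, the point of the
complement nearest to `z` is one, and it is close to `x`. Continuity of the gradient up to the
boundary covers the remaining points, so edges and corners need no separate treatment. -/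
theorem fderivWithin_eq_zero_of_normal (hΩ : IsOpen Ω) (hconv : Convex ℝ Ω)
    {r : Space d → ℝ} (hr : ContDiffOn ℝ 1 r (closure Ω))
    (h0 : ∀ x ∈ frontier Ω, r x = 0)
    (hn : ∀ x ∈ frontier Ω, ∀ ν : Space d, (∀ z ∈ Ω, inner ℝ ν (z - x) ≤ 0) →
      fderivWithin ℝ r (closure Ω) x ν = 0)
    {x : Space d} (hx : x ∈ frontier Ω) : fderivWithin ℝ r (closure Ω) x = 0 := by
  have hne : Ω.Nonempty := by
    by_contra h
    rw [not_nonempty_iff_eq_empty] at h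
    simp [h] at hx
  have hu : UniqueDiffOn ℝ (closure Ω) := uniqueDiffOn_convex hconv.closure
    (hne.mono (hΩ.subset_interior_iff.2 subset_closure))
  have hcont := hr.continuousOn_fderivWithin hu le_rfl
  have hxΩ : x ∉ Ω := fun h => hx.2 (hΩ.interior_eq.symm ▸ h)
  set Z : Set (Space d) := {y | y ∈ frontier Ω ∧ fderivWithin ℝ r (closure Ω) y = 0} with hZ
  have hcl : x ∈ closure Z := by
    rw [Metric.mem_closure_iff]
    intro ε hε
    obtain ⟨z, hz, hxz⟩ := Metric.mem_closure_iff.1 hx.1 (ε / 2) (by positivity)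
    obtain ⟨y, hy, hdist⟩ := hΩ.isClosed_compl.exists_infDist_eq_dist ⟨x, hxΩ⟩ z
    have hle : dist y z ≤ dist x z := by
      rw [dist_comm, ← hdist, dist_comm x z]
      exact Metric.infDist_le_dist_of_mem hxΩ
    have hball : Metric.ball z (dist y z) ⊆ Ω := by
      rw [dist_comm, ← hdist]
      exact Metric.ball_infDist_compl_subset
    have hyz : y ≠ z := fun h => hy (h ▸ hz)
    have hfr : y ∈ frontier Ω := by
      refine ⟨?_, by rw [hΩ.interior_eq]; exact hy⟩
      refine closure_mono hball ?_
      rw [closure_ball z (dist_ne_zero.2 hyz)]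
      exact Metric.mem_closedBall.2 le_rfl
    refine ⟨y, ⟨hfr, fderivWithin_eq_zero_of_inner_ball hΩ hconv
      (hr.differentiableOn (by simp)) h0 hn hfr hyz hball⟩, ?_⟩
    calc dist x y ≤ dist x z + dist z y := dist_triangle _ _ _
      _ < ε := by rw [dist_comm z y]; linarith
  have hsub : Z ⊆ closure Ω := fun y hy => hy.1.1
  have hm := (hcont x hx.1).mono hsub |>.mem_closure_image hcl
  have himg : fderivWithin ℝ r (closure Ω) '' Z ⊆ {0} := by
    rintro _ ⟨y, hy, rfl⟩
    exact hy.2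
  simpa using closure_mono himg hm

/-- The extension by zero of such a function is of class `C¹`. -/
theorem contDiff_indicator_of_normal (hΩ : IsOpen Ω) (hconv : Convex ℝ Ω)
    {r : Space d → ℝ} (hr : ContDiffOn ℝ 1 r (closure Ω))
    (h0 : ∀ x ∈ frontier Ω, r x = 0)
    (hn : ∀ x ∈ frontier Ω, ∀ ν : Space d, (∀ z ∈ Ω, inner ℝ ν (z - x) ≤ 0) →
      fderivWithin ℝ r (closure Ω) x ν = 0) :
    ContDiff ℝ 1 (Ω.indicator r) ∧ ∀ x, x ∉ Ω → fderiv ℝ (Ω.indicator r) x = 0 := by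
  rcases Ω.eq_empty_or_nonempty with rfl | hne
  · rw [indicator_empty]
    exact ⟨contDiff_const (c := (0 : ℝ)), fun x _ => fderiv_const_apply (0 : ℝ)⟩
  have hu : UniqueDiffOn ℝ (closure Ω) := uniqueDiffOn_convex hconv.closure
    (hne.mono (hΩ.subset_interior_iff.2 subset_closure))
  have hz : ∀ x ∈ frontier Ω, fderivWithin ℝ r (closure Ω) x = 0 := fun x hx =>
    fderivWithin_eq_zero_of_normal hΩ hconv hr h0 hn hx
  have hG : Continuous (Ω.indicator (fderivWithin ℝ r (closure Ω))) :=
    continuous_indicator hz (hr.continuousOn_fderivWithin hu le_rfl)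
  suffices h : ∀ x, HasFDerivAt (Ω.indicator r)
      (Ω.indicator (fderivWithin ℝ r (closure Ω)) x) x from
    ⟨contDiff_one_iff_hasFDerivAt.2 ⟨_, hG, h⟩, fun x hx => by
      rw [(h x).fderiv, indicator_of_notMem hx]⟩
  intro x
  by_cases hx : x ∈ Ω
  · rw [indicator_of_mem hx]
    have h1 : HasFDerivAt r (fderivWithin ℝ r (closure Ω) x) x :=
      ((hr.differentiableOn (by simp) x (subset_closure hx)).hasFDerivWithinAt).hasFDerivAt
        (mem_of_superset (hΩ.mem_nhds hx) subset_closure)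
    refine h1.congr_of_eventuallyEq ?_
    filter_upwards [hΩ.mem_nhds hx] with y hy
    exact indicator_of_mem hy r
  · rw [indicator_of_notMem hx]
    have hzero : HasFDerivWithinAt (Ω.indicator r) (0 : Space d →L[ℝ] ℝ) Ωᶜ x := by
      refine (hasFDerivWithinAt_const (0 : ℝ) x Ωᶜ).congr (fun y hy => ?_) ?_
      · exact indicator_of_notMem hy r
      · exact indicator_of_notMem hx r
    by_cases hc : x ∈ closure Ω
    · have hfr : x ∈ frontier Ω := ⟨hc, by rwa [hΩ.interior_eq]⟩
      have e : ∀ y ∈ closure Ω, Ω.indicator r y = r y := by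
        intro y hy
        by_cases hyΩ : y ∈ Ω
        · exact indicator_of_mem hyΩ r
        · rw [indicator_of_notMem hyΩ, h0 y ⟨hy, by rwa [hΩ.interior_eq]⟩]
      have h1 : HasFDerivWithinAt (Ω.indicator r) (0 : Space d →L[ℝ] ℝ) (closure Ω) x := by
        have := (hr.differentiableOn (by simp) x hc).hasFDerivWithinAt
        rw [hz x hfr] at this
        exact this.congr e (e x hc)
      -- The derivative is zero both within the closure of `Ω` and within the complement, and these
      -- two sets cover the space.
      have h2 := h1.union hzero
      rwa [(compl_subset_iff_union).1 (compl_subset_compl.2 subset_closure),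
        hasFDerivWithinAt_univ] at h2
    · refine hzero.hasFDerivAt ?_
      exact mem_of_superset (isClosed_closure.isOpen_compl.mem_nhds hc)
        (compl_subset_compl.2 subset_closure)

end PolyExt

end

noncomputable section

namespace PolyExt

variable {d : ℕ} {Ω : Set (Space d)}

/-! ### Mollification -/

/-- The convolution of two functions on `ℝ^d`. -/
def conv (f g : Space d → ℝ) (x : Space d) : ℝ := ∫ y, f y * g (x - y)

theorem conv_eq (f g : Space d → ℝ) :
    conv f g = convolution f g (ContinuousLinearMap.mul ℝ ℝ) volume := rfl

theorem contDiff_conv {f g : Space d → ℝ} (hf : LocallyIntegrable f volume)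
    (hg : ContDiff ℝ ∞ g) (hc : HasCompactSupport g) : ContDiff ℝ ∞ (conv f g) := by
  rw [conv_eq]
  exact hc.contDiff_convolution_right (n := ⊤) _ hf hg

theorem partialD_conv {f g : Space d → ℝ} (hf : LocallyIntegrable f volume)
    (hg : ContDiff ℝ ∞ g) (hc : HasCompactSupport g) (i : Fin d) :
    partialD i (conv f g) = conv f (partialD i g) := by
  funext x
  have h := hc.hasFDerivAt_convolution_right (ContinuousLinearMap.mul ℝ ℝ) hf
    (hg.of_le (by simp)) x
  rw [partialD, conv_eq, h.fderiv]
  exact convolution_precompR_apply _ hf (hc.fderiv ℝ)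
    ((hg.fderiv_right (m := ∞) (by simp)).continuous) x (EuclideanSpace.single i 1)

/-- The normalized bump function of radius `ε`. -/
def bump (d : ℕ) {ε : ℝ} (hε : 0 < ε) : ContDiffBump (0 : Space d) :=
  ⟨ε / 2, ε, by positivity, by linarith⟩

/-- The normalized smooth kernel supported in the ball of radius `ε`. -/
def mol (d : ℕ) {ε : ℝ} (hε : 0 < ε) : Space d → ℝ := (bump d hε).normed volume

theorem contDiff_mol {ε : ℝ} (hε : 0 < ε) : ContDiff ℝ ∞ (mol d hε) :=
  (bump d hε).contDiff_normed (n := ⊤)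

theorem hasCompactSupport_mol {ε : ℝ} (hε : 0 < ε) : HasCompactSupport (mol d hε) :=
  (bump d hε).hasCompactSupport_normed

theorem conv_mol {ε : ℝ} (hε : 0 < ε) (f : Space d → ℝ) (x : Space d) :
    conv f (mol d hε) x
      = (convolution ((bump d hε).normed volume) f (ContinuousLinearMap.lsmul ℝ ℝ) volume) x := by
  rw [convolution_lsmul_swap]
  refine integral_congr_ae (ae_of_all _ fun y => ?_)
  simp only [mol, smul_eq_mul, mul_comm]

theorem conv_mol_eq {ε : ℝ} (hε : 0 < ε) {f : Space d → ℝ} {x : Space d} {c : ℝ}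
    (h : ∀ y ∈ Metric.ball x ε, f y = c) : conv f (mol d hε) x = c := by
  have hx := h x (Metric.mem_ball_self hε)
  rw [conv_mol, ContDiffBump.normed_convolution_eq_right, hx]
  intro y hy
  rw [hx]
  exact h y hy

theorem abs_conv_mol_sub_le {ε δ : ℝ} (hε : 0 < ε) {f : Space d → ℝ}
    (hf : AEStronglyMeasurable f volume) {x : Space d}
    (h : ∀ y ∈ Metric.ball x ε, |f y - f x| ≤ δ) : |conv f (mol d hε) x - f x| ≤ δ := by
  rw [conv_mol, ← Real.dist_eq]
  exact (bump d hε).dist_normed_convolution_le hf h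

theorem partialD_comp_affine (i : Fin d) {f : Space d → ℝ} (hf : Differentiable ℝ f)
    (a : Space d) (c : ℝ) :
    partialD i (fun x => f (a + c • x)) = c • fun x => partialD i f (a + c • x) := by
  funext x
  have h1 : HasFDerivAt (fun x : Space d => a + c • x) (c • ContinuousLinearMap.id ℝ _) x :=
    ((hasFDerivAt_id x).const_smul c).const_add a
  have h2 := ((hf (a + c • x)).hasFDerivAt.comp x h1).fderiv
  have e : (f ∘ fun x : Space d => a + c • x) = fun x => f (a + c • x) := rfl
  rw [e] at h2
  simp [partialD, h2]

theorem lapC_comp_affine {f : Space d → ℝ} (hf : ContDiff ℝ ∞ f) (a : Space d) (c : ℝ) :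
    lapC (fun x => f (a + c • x)) = c ^ 2 • fun x => lapC f (a + c • x) := by
  funext x
  simp only [lapC, Finset.sum_apply, Pi.smul_apply, smul_eq_mul, Finset.mul_sum]
  refine Finset.sum_congr rfl fun i _ => ?_
  rw [partialD_comp_affine i (hf.differentiable (by simp)), partialD_smul,
    partialD_comp_affine i ((contDiff_partialD i hf).differentiable (by simp))]
  simp only [Pi.smul_apply, smul_eq_mul]
  ring

/-! ### Smooth cut-off functions -/

/-- Smooth cut-off functions of a bounded open set, whose gradients are of the order of
the inverse distance to the complement. -/
theorem exists_cutoff (hb : Bornology.IsBounded Ω) :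
    ∃ C : ℝ, 0 ≤ C ∧ ∀ ε : ℝ, 0 < ε → ∃ χ : Space d → ℝ, IsTest Ω χ ∧ (∀ x, |χ x| ≤ 2) ∧
      (∀ x, 3 * ε < Metric.infDist x Ωᶜ → χ x = 1) ∧
      (∀ i x, |partialD i χ x| ≤ C / ε) ∧
      ∀ i x, partialD i χ x ≠ 0 → x ∈ Ω ∧ Metric.infDist x Ωᶜ ≤ 3 * ε := by
  set η : Space d → ℝ := mol d one_pos with hη
  have hηi : ∀ i, Integrable (partialD i η) volume := fun i =>
    (contDiff_partialD i (contDiff_mol one_pos)).continuous.integrable_of_hasCompactSupport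
      ((hasCompactSupport_mol one_pos).mono'
        ((subset_tsupport _).trans (tsupport_partialD_subset i η)))
  refine ⟨∑ i, ∫ y, |partialD i η y|, Finset.sum_nonneg fun i _ =>
    integral_nonneg fun _ => abs_nonneg _, fun ε hε => ?_⟩
  have hcont : Continuous fun x : Space d => Metric.infDist x Ωᶜ :=
    Metric.continuous_infDist_pt _
  -- The set is rescaled by `ε` and its indicator mollified at unit scale. One fixed kernel then
  -- serves all `ε`, and undoing the scaling produces the factor `1/ε` in the gradient bound.
  set A : Set (Space d) := {y | 2 * ε ≤ Metric.infDist (ε • y) Ωᶜ} with hA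
  have hAc : IsClosed A :=
    isClosed_le continuous_const (hcont.comp (continuous_const_smul ε))
  set f : Space d → ℝ := A.indicator 1 with hf
  have hfm : Measurable f := measurable_one.indicator hAc.measurableSet
  have hf1 : ∀ y, |f y| ≤ 1 := fun y => by
    by_cases h : y ∈ A <;> simp [hf, h]
  have hfl : LocallyIntegrable f volume := by
    refine (locallyIntegrable_const (1 : ℝ)).mono hfm.aestronglyMeasurable (ae_of_all _ fun y => ?_)
    simpa using hf1 y
  have hF : ContDiff ℝ ∞ (conv f η) :=
    contDiff_conv hfl (contDiff_mol one_pos) (hasCompactSupport_mol one_pos)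
  set χ : Space d → ℝ := fun x => conv f η (0 + ε⁻¹ • x) with hχ
  have hball : ∀ x y : Space d, y ∈ Metric.ball (0 + ε⁻¹ • x) 1 → dist (ε • y) x < ε := by
    intro x y hy
    rw [zero_add, Metric.mem_ball] at hy
    have e : dist (ε • y) x = ε * dist y (ε⁻¹ • x) := by
      conv_lhs => rw [← smul_inv_smul₀ hε.ne' x]
      rw [dist_smul₀, Real.norm_of_nonneg hε.le]
    rw [e]
    nlinarith
  have hlip : ∀ x y : Space d, Metric.infDist x Ωᶜ ≤ Metric.infDist y Ωᶜ + dist x y :=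
    fun x y => Metric.infDist_le_infDist_add_dist
  have hone : ∀ x, 3 * ε < Metric.infDist x Ωᶜ → χ x = 1 := by
    intro x hx
    refine conv_mol_eq one_pos fun y hy => ?_
    have h1 := hball x y hy
    have h2 := hlip x (ε • y)
    rw [dist_comm] at h1
    have : y ∈ A := by
      change 2 * ε ≤ Metric.infDist (ε • y) Ωᶜ
      linarith
    simp [hf, this]
  have hzero : ∀ x, Metric.infDist x Ωᶜ < ε → χ x = 0 := by
    intro x hx
    refine conv_mol_eq one_pos fun y hy => ?_
    have h1 := hball x y hy
    have h2 := hlip (ε • y) x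
    have : y ∉ A := by
      change ¬ (2 * ε ≤ Metric.infDist (ε • y) Ωᶜ)
      linarith
    simp [hf, this]
  have hcd : ContDiff ℝ ∞ χ := by
    refine hF.comp (g := conv f η) ?_
    fun_prop
  have hts : tsupport χ ⊆ {x | ε ≤ Metric.infDist x Ωᶜ} := by
    refine closure_minimal (fun x hx => ?_) (isClosed_le continuous_const hcont)
    by_contra h
    exact hx (hzero x (not_le.1 h))
  have hsub : {x | ε ≤ Metric.infDist x Ωᶜ} ⊆ Ω := by
    intro x hx
    by_contra h
    have : Metric.infDist x Ωᶜ = 0 := Metric.infDist_zero_of_mem h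
    have hx' : ε ≤ Metric.infDist x Ωᶜ := hx
    linarith
  have htest : IsTest Ω χ := by
    refine ⟨hcd, ?_, hts.trans hsub⟩
    exact Metric.isCompact_of_isClosed_isBounded (isClosed_tsupport χ)
      (hb.subset (hts.trans hsub))
  refine ⟨χ, htest, ?_, hone, ?_, ?_⟩
  · intro x
    have h1 : |χ x - f (0 + ε⁻¹ • x)| ≤ 1 := by
      refine abs_conv_mol_sub_le one_pos hfm.aestronglyMeasurable fun y _ => ?_
      have h0 := fun y => indicator_nonneg (s := A) (f := (1 : Space d → ℝ)) (fun _ _ => zero_le_one) y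
      rw [abs_le]
      constructor <;> linarith [h0 y, h0 (0 + ε⁻¹ • x), (abs_le.1 (hf1 y)).2,
        (abs_le.1 (hf1 (0 + ε⁻¹ • x))).2]
    have h2 := hf1 (0 + ε⁻¹ • x)
    rw [abs_le] at *
    constructor <;> linarith [h1.1, h1.2, h2.1, h2.2]
  · intro i x
    have h1 : partialD i χ x = ε⁻¹ * conv f (partialD i η) (0 + ε⁻¹ • x) := by
      rw [hχ, partialD_comp_affine i (hF.differentiable (by simp)),
        partialD_conv hfl (contDiff_mol one_pos) (hasCompactSupport_mol one_pos)]
      rfl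
    rw [h1, abs_mul, abs_of_pos (inv_pos.2 hε), div_eq_inv_mul]
    refine mul_le_mul_of_nonneg_left ?_ (inv_pos.2 hε).le
    refine le_trans ?_ (Finset.single_le_sum (f := fun i => ∫ y, |partialD i η y|)
      (fun i _ => integral_nonneg fun _ => abs_nonneg _) (Finset.mem_univ i))
    set z := 0 + ε⁻¹ • x
    have h2 : ∫ y, |partialD i η y| = ∫ y, |partialD i η (z - y)| :=
      (integral_sub_left_eq_self (fun y => |partialD i η y|) volume z).symm
    rw [h2, ← Real.norm_eq_abs, conv]
    refine norm_integral_le_of_norm_le ((hηi i).comp_sub_left z).abs (ae_of_all _ fun y => ?_)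
    rw [norm_mul]
    calc ‖f y‖ * ‖partialD i η (z - y)‖ ≤ 1 * ‖partialD i η (z - y)‖ := by
          gcongr; exact hf1 y
      _ = _ := by rw [one_mul]; rfl
  · intro i x hx
    have hxs : x ∈ tsupport χ := tsupport_partialD_subset i χ (subset_tsupport _ hx)
    refine ⟨htest.2.2 hxs, ?_⟩
    by_contra! hlt
    refine hx ?_
    have : χ =ᶠ[𝓝 x] fun _ => (1 : ℝ) := by
      filter_upwards [(isOpen_lt continuous_const hcont).mem_nhds hlt] with y hy
      exact hone y hy
    rw [partialD, this.fderiv_eq]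
    simp

/-- The measure of a boundary strip of a bounded convex open set. -/
theorem exists_volume_strip_le (hΩ : IsOpen Ω) (hconv : Convex ℝ Ω)
    (hb : Bornology.IsBounded Ω) (hne : Ω.Nonempty) (hnc : (Ωᶜ).Nonempty) :
    ∃ C : ℝ, 0 ≤ C ∧ ∀ ε : ℝ, 0 < ε →
      volume.real {x | x ∈ Ω ∧ Metric.infDist x Ωᶜ ≤ ε} ≤ C * ε := by
  obtain ⟨x₀, hx₀⟩ := hne
  obtain ⟨ρ, hρ, hball⟩ := Metric.isOpen_iff.1 hΩ x₀ hx₀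
  have hfin : volume Ω ≠ ⊤ := hb.measure_lt_top.ne
  refine ⟨2 * (d + 1) / ρ * volume.real Ω, by positivity, fun ε hε => ?_⟩
  have hSub : {x | x ∈ Ω ∧ Metric.infDist x Ωᶜ ≤ ε} ⊆ Ω := fun x hx => hx.1
  -- For wide strips the whole volume is an admissible bound; the constant contains `d + 1` instead
  -- of `d` so that it covers this case too.
  rcases le_or_gt ρ (2 * ε) with hle | hlt
  · calc volume.real {x | x ∈ Ω ∧ Metric.infDist x Ωᶜ ≤ ε} ≤ volume.real Ω :=
          measureReal_mono hSub hfin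
      _ = 1 * volume.real Ω := (one_mul _).symm
      _ ≤ (2 * (d + 1) / ρ * ε) * volume.real Ω := by
          gcongr
          rw [div_mul_eq_mul_div, le_div_iff₀ hρ]
          nlinarith [(Nat.cast_nonneg d : (0 : ℝ) ≤ d), mul_nonneg (Nat.cast_nonneg d : (0 : ℝ) ≤ d) hε.le]
      _ = _ := by ring
  -- Shrinking `Ω` towards `x₀` by the factor `1 - s` leaves, by convexity, a margin of `sρ = 2ε` to
  -- the complement. The strip of width `ε` thus misses the shrunken copy, and its volume is at most
  -- `(1 - (1-s)^d)` times that of `Ω`, which Bernoulli's inequality makes linear in `s`.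
  · set s : ℝ := 2 * ε / ρ with hs
    have hs0 : 0 < s := by positivity
    have hs1 : s < 1 := by rw [hs, div_lt_one hρ]; exact hlt
    have hsρ : s * ρ = 2 * ε := by rw [hs]; field_simp
    set H := AffineMap.homothety x₀ (1 - s) '' Ω with hH
    have hHeq : ∀ y, AffineMap.homothety x₀ (1 - s) y = (1 - s) • y + s • x₀ := by
      intro y
      rw [AffineMap.homothety_apply, vsub_eq_sub, vadd_eq_add]
      module
    have hHd : ∀ x ∈ H, x ∈ Ω ∧ 2 * ε ≤ Metric.infDist x Ωᶜ := by
      rintro _ ⟨y, hy, rfl⟩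
      rw [hHeq]
      refine ⟨hconv hy hx₀ (by linarith) hs0.le (by ring), ?_⟩
      rw [Metric.le_infDist hnc]
      intro z hz
      by_contra! hlt
      refine hz ?_
      have hw : x₀ + s⁻¹ • (z - ((1 - s) • y + s • x₀)) ∈ Ω := by
        refine hball ?_
        rw [Metric.mem_ball, dist_eq_norm, add_sub_cancel_left, norm_smul, norm_inv,
          Real.norm_of_nonneg hs0.le, inv_mul_lt_iff₀ hs0, hsρ, ← dist_eq_norm, dist_comm]
        exact hlt
      have := hconv hy hw (a := 1 - s) (b := s) (by linarith) hs0.le (by ring)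
      rw [smul_add, smul_inv_smul₀ hs0.ne'] at this
      convert this using 1
      abel
    have hHo : IsOpen H := by
      have := AffineMap.homothety_isOpenMap x₀ (1 - s) (by linarith)
      exact this _ hΩ
    have hsub : {x | x ∈ Ω ∧ Metric.infDist x Ωᶜ ≤ ε} ⊆ Ω \ H := by
      rintro x ⟨hx, hx'⟩
      refine ⟨hx, fun hxH => ?_⟩
      linarith [(hHd x hxH).2]
    have hHsub : H ⊆ Ω := fun x hx => (hHd x hx).1
    have hvolH : volume.real H = (1 - s) ^ d * volume.real Ω := by
      rw [measureReal_def, hH, Measure.addHaar_image_homothety, finrank_euclideanSpace,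
        Fintype.card_fin, ENNReal.toReal_mul, ENNReal.toReal_ofReal (abs_nonneg _),
        abs_of_nonneg (pow_nonneg (by linarith) d), measureReal_def]
    calc volume.real {x | x ∈ Ω ∧ Metric.infDist x Ωᶜ ≤ ε} ≤ volume.real (Ω \ H) :=
          measureReal_mono hsub (measure_ne_top_of_subset sdiff_subset hfin)
      _ = volume.real Ω - volume.real H :=
          measureReal_sdiff hHsub hHo.measurableSet hfin
      _ = (1 - (1 - s) ^ d) * volume.real Ω := by rw [hvolH]; ring
      _ ≤ (2 * (d + 1) / ρ * ε) * volume.real Ω := by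
          gcongr
          have hB := one_add_mul_le_pow (a := -s) (by linarith) d
          have e : 2 * ((d : ℝ) + 1) / ρ * ε = (d + 1) * s := by rw [hs]; ring
          rw [e, sub_eq_add_neg 1 s]
          nlinarith
      _ = _ := by ring

end PolyExt

end

noncomputable section

namespace PolyExt

variable {d : ℕ} {Ω : Set (Space d)}

/-! ### Square integrals under mollification and dilation -/

theorem eLpNorm_two_sq {α E : Type*} [MeasurableSpace α] [NormedAddCommGroup E] (f : α → E)
    (μ : Measure α) : eLpNorm f 2 μ ^ 2 = ∫⁻ x, ‖f x‖ₑ ^ 2 ∂μ := by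
  have := eLpNorm_nnreal_pow_eq_lintegral (f := f) (μ := μ) (p := 2) (by norm_num)
  simpa using this

theorem lintegral_sq_le {α : Type*} [MeasurableSpace α] (P : Measure α) [IsProbabilityMeasure P]
    {a : α → ℝ≥0∞} (ha : AEMeasurable a P) : (∫⁻ z, a z ∂P) ^ 2 ≤ ∫⁻ z, a z ^ 2 ∂P := by
  have h := ENNReal.lintegral_mul_le_Lp_mul_Lq P Real.HolderConjugate.two_two ha
    (aemeasurable_const (b := (1 : ℝ≥0∞)))
  simp only [Pi.mul_apply, mul_one, ENNReal.one_rpow, lintegral_const, measure_univ] at h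
  calc (∫⁻ z, a z ∂P) ^ 2 ≤ ((∫⁻ z, a z ^ (2 : ℝ) ∂P) ^ (1 / 2 : ℝ)) ^ 2 := by gcongr
    _ = ∫⁻ z, a z ^ 2 ∂P := by
      rw [← ENNReal.rpow_natCast, ← ENNReal.rpow_mul]
      norm_num

/-- Young's inequality for the mollification of a square integrable function. -/
theorem lintegral_conv_mol_sq_le {ε : ℝ} (hε : 0 < ε) {f : Space d → ℝ} (hf : Measurable f) :
    ∫⁻ x, ‖conv f (mol d hε) x‖ₑ ^ 2 ≤ ∫⁻ x, ‖f x‖ₑ ^ 2 := by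
  set η := mol d hε with hη
  have hηm : Measurable η := (contDiff_mol hε).continuous.measurable
  -- The kernel is a probability density, so the convolution is an average of translates. Jensen's
  -- inequality, Tonelli and translation invariance give the bound.
  set P : Measure (Space d) := volume.withDensity fun z => ‖η z‖ₑ with hP
  have hprob : IsProbabilityMeasure P := by
    refine ⟨?_⟩
    rw [hP, withDensity_apply _ MeasurableSet.univ, Measure.restrict_univ]
    have h1 : ∀ z, ‖η z‖ₑ = ENNReal.ofReal ((bump d hε).normed volume z) := fun z =>
      Real.enorm_eq_ofReal ((bump d hε).nonneg_normed z)
    simp only [h1]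
    rw [← ofReal_integral_eq_lintegral_ofReal (bump d hε).integrable_normed
      (ae_of_all _ fun z => (bump d hε).nonneg_normed z)]
    rw [(bump d hε).integral_normed, ENNReal.ofReal_one]
  have h1 : ∀ x, ‖conv f η x‖ₑ ≤ ∫⁻ z, ‖f (x - z)‖ₑ ∂P := by
    intro x
    calc ‖conv f η x‖ₑ ≤ ∫⁻ y, ‖f y * η (x - y)‖ₑ := enorm_integral_le_lintegral_enorm _
      _ = ∫⁻ z, ‖f (x - z) * η (x - (x - z))‖ₑ :=
        (lintegral_sub_left_eq_self (fun y => ‖f y * η (x - y)‖ₑ) x).symm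
      _ = ∫⁻ z, ‖f (x - z)‖ₑ ∂P := by
        rw [hP, lintegral_withDensity_eq_lintegral_mul _ (by fun_prop) (by fun_prop)]
        refine lintegral_congr fun z => ?_
        rw [sub_sub_cancel, enorm_mul, Pi.mul_apply, mul_comm]
  calc ∫⁻ x, ‖conv f η x‖ₑ ^ 2 ≤ ∫⁻ x, ∫⁻ z, ‖f (x - z)‖ₑ ^ 2 ∂P := by
        refine lintegral_mono fun x => ?_
        refine le_trans (by gcongr; exact h1 x) (lintegral_sq_le P ?_)
        fun_prop
    _ = ∫⁻ z, (∫⁻ x, ‖f (x - z)‖ₑ ^ 2) ∂P := by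
        refine lintegral_lintegral_swap (f := fun x z => ‖f (x - z)‖ₑ ^ 2) ?_
        refine Measurable.aemeasurable ?_
        unfold Function.uncurry
        fun_prop
    _ = ∫⁻ z, (∫⁻ x, ‖f x‖ₑ ^ 2) ∂P :=
        lintegral_congr (μ := P) fun z => lintegral_sub_right_eq_self (fun x => ‖f x‖ₑ ^ 2) z
    _ = _ := by simp

theorem lintegral_comp_affine_le {k : Space d → ℝ≥0∞} (hk : Measurable k) (a : Space d)
    {c : ℝ} (hc : 1 ≤ c) : ∫⁻ x, k (a + c • x) ≤ ∫⁻ x, k x := by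
  have hc0 : c ≠ 0 := by positivity
  have h1 : ∫⁻ x, k (a + c • x) = ∫⁻ x, k (a + x) ∂(Measure.map (c • ·) volume) :=
    (lintegral_map (f := fun x => k (a + x)) (by fun_prop) (by fun_prop)).symm
  rw [h1, Measure.map_addHaar_smul _ hc0, lintegral_smul_measure,
    lintegral_add_left_eq_self (fun x => k x) a]
  refine (mul_le_mul' (b := (1 : ℝ≥0∞)) ?_ le_rfl).trans_eq (one_mul _)
  rw [← ENNReal.ofReal_one]
  refine ENNReal.ofReal_le_ofReal ?_
  have : (1 : ℝ) ≤ c ^ Module.finrank ℝ (Space d) := one_le_pow₀ hc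
  rw [abs_of_pos (by positivity)]
  exact inv_le_one_of_one_le₀ this

/-! ### Extension by zero of weak derivatives -/

theorem partialD_mul (i : Fin d) {f g : Space d → ℝ} (hf : Differentiable ℝ f)
    (hg : Differentiable ℝ g) :
    partialD i (f * g) = f * partialD i g + partialD i f * g := by
  funext x
  simp [partialD, fderiv_mul (hf x) (hg x), mul_comm]

/-- If a continuous function vanishes outside the convex set `Ω`, then its weak derivatives
on `Ω` are weak derivatives on the whole space. -/
theorem setIntegral_mul_partialD_of_vanishing (hΩ : IsOpen Ω) (hconv : Convex ℝ Ω)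
    (hb : Bornology.IsBounded Ω) (hne : Ω.Nonempty) (hnc : (Ωᶜ).Nonempty) {G : Space d → ℝ}
    (hG : Continuous G) (hG0 : ∀ x, x ∉ Ω → G x = 0) (j : Fin d) {h : L2 Ω}
    (hw : IsWeakPartial Ω j (toL2 Ω G) h) {φ : Space d → ℝ} (hφ : ContDiff ℝ ∞ φ)
    (hφc : HasCompactSupport φ) :
    ∫ x in Ω, G x * partialD j φ x = - ∫ x in Ω, h x * φ x := by
  have hfin : volume Ω ≠ ⊤ := hb.measure_lt_top.ne
  have hGc : HasCompactSupport G := by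
    refine HasCompactSupport.intro (Metric.isCompact_of_isClosed_isBounded isClosed_closure
      hb.closure) fun x hx => hG0 x fun h => hx (subset_closure h)
  have hGL : MemLp G 2 (volume.restrict Ω) := (hG.memLp_of_hasCompactSupport hGc).restrict Ω
  have hφL : MemLp φ 2 (volume.restrict Ω) :=
    (hφ.continuous.memLp_of_hasCompactSupport hφc).restrict Ω
  obtain ⟨C, hC, hcut⟩ := exists_cutoff hb
  obtain ⟨C', hC', hstrip⟩ := exists_volume_strip_le hΩ hconv hb hne hnc
  have hpos : ∀ n : ℕ, (0 : ℝ) < 1 / ((n : ℝ) + 1) := fun n => by positivity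
  choose χ hχt hχ2 hχ1 hχd hχs using fun n : ℕ => hcut _ (hpos n)
  have hlim0 : Tendsto (fun n : ℕ => 1 / ((n : ℝ) + 1)) atTop (𝓝 0) :=
    tendsto_one_div_add_atTop_nhds_zero_nat
  have hdct : ∀ k : Space d → ℝ, Integrable k (volume.restrict Ω) →
      Tendsto (fun n => ∫ x in Ω, χ n x * k x) atTop (𝓝 (∫ x in Ω, k x)) := by
    intro k hk
    refine tendsto_integral_of_dominated_convergence (fun x => 2 * |k x|) ?_
      (hk.abs.const_mul 2) ?_ ?_
    · exact fun n => (hχt n).1.continuous.aestronglyMeasurable.mul hk.aestronglyMeasurable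
    · refine fun n => ae_of_all _ fun x => ?_
      rw [norm_mul]
      exact mul_le_mul_of_nonneg_right (hχ2 n x) (abs_nonneg _)
    · filter_upwards [ae_restrict_mem hΩ.measurableSet] with x hx
      have hd : 0 < Metric.infDist x Ωᶜ :=
        (hΩ.isClosed_compl.notMem_iff_infDist_pos hnc).1 (fun h => h hx)
      have hev : ∀ᶠ n : ℕ in atTop, 3 * (1 / ((n : ℝ) + 1)) < Metric.infDist x Ωᶜ := by
        have := hlim0.const_mul 3
        rw [mul_zero] at this
        exact this.eventually_lt_const hd
      refine tendsto_const_nhds.congr' ?_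
      filter_upwards [hev] with n hn
      rw [hχ1 n x hn, one_mul]
  have hi1 : Integrable (fun x => h x * φ x) (volume.restrict Ω) :=
    (Lp.memLp h).integrable_mul hφL
  have hi2 : Integrable (fun x => G x * partialD j φ x) (volume.restrict Ω) :=
    ((hG.mul (contDiff_partialD j hφ).continuous).integrable_of_hasCompactSupport
      hGc.mul_right).integrableOn
  have hi3 : ∀ n, Integrable (fun x => G x * φ x * partialD j (χ n) x) (volume.restrict Ω) :=
    fun n => (((hG.mul hφ.continuous).mul
      (contDiff_partialD j (hχt n).1).continuous).integrable_of_hasCompactSupport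
      hGc.mul_right.mul_right).integrableOn
  have hi4 : ∀ n, Integrable (fun x => χ n x * (G x * partialD j φ x)) (volume.restrict Ω) :=
    fun n => (((hχt n).1.continuous.mul (hG.mul
      (contDiff_partialD j hφ).continuous)).integrable_of_hasCompactSupport
      (hGc.mul_right).mul_left).integrableOn
  -- The function `φ` need not vanish near the boundary, but `χ n * φ` does. Testing with it leaves,
  -- by the product rule, one extra term containing the gradient of the cut-off.
  have hT : ∀ n, ∫ x in Ω, G x * φ x * partialD j (χ n) x
      = - (∫ x in Ω, χ n x * (h x * φ x)) - ∫ x in Ω, χ n x * (G x * partialD j φ x) := by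
    intro n
    have htest : IsTest Ω (χ n * φ) :=
      ⟨(hχt n).1.mul hφ, (hχt n).2.1.mul_right,
        (tsupport_mul_subset_left).trans (hχt n).2.2⟩
    have h1 := hw _ htest
    have h2 : ∫ x in Ω, toL2 Ω G x * partialD j (χ n * φ) x
        = ∫ x in Ω, (χ n x * (G x * partialD j φ x) + G x * φ x * partialD j (χ n) x) := by
      refine integral_congr_ae ?_
      filter_upwards [coeFn_toL2 hGL] with x hx
      rw [hx, partialD_mul j ((hχt n).1.differentiable (by simp)) (hφ.differentiable (by simp))]
      simp only [Pi.add_apply, Pi.mul_apply]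
      ring
    have h3 : ∫ x in Ω, h x * (χ n * φ) x = ∫ x in Ω, χ n x * (h x * φ x) := by
      refine integral_congr_ae (ae_of_all _ fun x => ?_)
      simp only [Pi.mul_apply]
      ring
    rw [h2, h3, integral_add (hi4 n) (hi3 n)] at h1
    linarith
  -- The cut-off gradient has size `C/ε` on a strip of volume `O(ε)`, so the integral is bounded by
  -- a constant times the supremum of `|G|` on the strip. That supremum tends to zero, since `G` is
  -- uniformly continuous and vanishes outside `Ω`.
  have hT0 : Tendsto (fun n => ∫ x in Ω, G x * φ x * partialD j (χ n) x) atTop (𝓝 0) := by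
    obtain ⟨M, hM⟩ := hφc.exists_bound_of_continuous hφ.continuous
    have hM0 : 0 ≤ M := (norm_nonneg _).trans (hM 0)
    have huc : UniformContinuous G := hGc.uniformContinuous_of_continuous hG
    rw [Metric.tendsto_atTop]
    intro δ hδ
    set θ : ℝ := δ / (2 * (M * C * (C' * 3) + 1)) with hθ
    have hθpos : 0 < θ := by positivity
    obtain ⟨m, hm, hmG⟩ := Metric.uniformContinuous_iff.1 huc θ hθpos
    have hev : ∀ᶠ n : ℕ in atTop, 3 * (1 / ((n : ℝ) + 1)) < m := by
      have := hlim0.const_mul 3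
      rw [mul_zero] at this
      exact this.eventually_lt_const hm
    obtain ⟨N, hN⟩ := eventually_atTop.1 hev
    refine ⟨N, fun n hn => ?_⟩
    have hn' := hN n hn
    set ε : ℝ := 1 / ((n : ℝ) + 1) with hε
    have hε0 : 0 < ε := hpos n
    set S : Set (Space d) := {x | x ∈ Ω ∧ Metric.infDist x Ωᶜ ≤ 3 * ε} with hS
    have hSsub : S ⊆ Ω := fun x hx => hx.1
    have hGs : ∀ x ∈ S, |G x| ≤ θ := by
      intro x hx
      obtain ⟨y, hy, hxy⟩ := (Metric.infDist_lt_iff hnc).1 (hx.2.trans_lt hn')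
      have := hmG hxy
      rw [hG0 y hy, Real.dist_eq, sub_zero] at this
      exact this.le
    have he : ∫ x in Ω, G x * φ x * partialD j (χ n) x
        = ∫ x in S, G x * φ x * partialD j (χ n) x := by
      refine (setIntegral_eq_of_subset_of_forall_sdiff_eq_zero hΩ.measurableSet hSsub ?_)
      intro x hx
      by_contra hne
      exact hx.2 (hχs n j x (right_ne_zero_of_mul hne))
    rw [Real.dist_eq, sub_zero, he]
    have hSfin : volume S < ⊤ := (measure_ne_top_of_subset hSsub hfin).lt_top
    have hb1 := norm_setIntegral_le_of_norm_le_const (f := fun x => G x * φ x * partialD j (χ n) x)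
      (C := θ * M * (C / ε)) hSfin (fun x hx => by
        rw [norm_mul, norm_mul]
        have h1 := hGs x hx
        have h2 := hM x
        have h3 := hχd n j x
        simp only [Real.norm_eq_abs] at *
        gcongr)
    refine hb1.trans_lt ?_
    calc θ * M * (C / ε) * volume.real S ≤ θ * M * (C / ε) * (C' * (3 * ε)) := by
          gcongr
          exact hstrip _ (by positivity)
      _ = θ * (M * C * (C' * 3)) := by field_simp
      _ < δ := by
          rw [hθ, div_mul_eq_mul_div, div_lt_iff₀ (by positivity)]
          have : 0 ≤ M * C * (C' * 3) := by positivity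
          nlinarith
  have hlim := ((hdct _ hi1).neg.sub (hdct _ hi2))
  have := tendsto_nhds_unique hT0 (hlim.congr fun n => (hT n).symm)
  linarith

end PolyExt

end

noncomputable section

namespace PolyExt

variable {d : ℕ} {Ω : Set (Space d)}

/-! ### Functions of class `C¹` with vanishing Cauchy data belong to `H²₀(Ω)` -/

theorem enorm_toL2 {φ : Space d → ℝ} (h : MemLp φ 2 (volume.restrict Ω)) :
    ‖toL2 Ω φ‖ₑ = eLpNorm φ 2 (volume.restrict Ω) := by
  rw [Lp.enorm_def]
  exact eLpNorm_congr_ae (coeFn_toL2 h)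

theorem toL2_eq_of_ae {φ : Space d → ℝ} {u : L2 Ω} (h : u =ᵐ[volume.restrict Ω] φ) :
    toL2 Ω φ = u := by
  have hm : MemLp φ 2 (volume.restrict Ω) := (memLp_congr_ae h).1 (Lp.memLp u)
  exact Lp.ext ((coeFn_toL2 hm).trans h.symm)

theorem hasCompactSupport_of_vanishing (hb : Bornology.IsBounded Ω) {R : Space d → ℝ}
    (hR0 : ∀ x, x ∉ Ω → R x = 0) : HasCompactSupport R :=
  HasCompactSupport.intro (Metric.isCompact_of_isClosed_isBounded isClosed_closure hb.closure)
    fun x hx => hR0 x fun h => hx (subset_closure h)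

/-- The weak Laplacian on the whole space of a `C¹` function vanishing outside `Ω`. -/
theorem integral_mul_lapC_of_vanishing (hΩ : IsOpen Ω) (hconv : Convex ℝ Ω)
    (hb : Bornology.IsBounded Ω) (hne : Ω.Nonempty) (hnc : (Ωᶜ).Nonempty) {R : Space d → ℝ}
    (hR : ContDiff ℝ 1 R) (hR0 : ∀ x, x ∉ Ω → R x = 0) (hR1 : ∀ x, x ∉ Ω → fderiv ℝ R x = 0)
    (hH2 : MemH2 Ω (toL2 Ω R)) :
    ∃ Λ : L2 Ω, ∀ φ, ContDiff ℝ ∞ φ → HasCompactSupport φ →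
      ∫ x, R x * lapC φ x = inner ℝ Λ (toL2 Ω φ) := by
  choose g hg k hk using hH2
  have hRc : HasCompactSupport R := hasCompactSupport_of_vanishing hb hR0
  have hD : ∀ i, Continuous (partialD i R) := fun i =>
    (hR.continuous_fderiv (by simp)).clm_apply continuous_const
  have hD0 : ∀ i x, x ∉ Ω → partialD i R x = 0 := by
    intro i x hx
    rw [partialD, hR1 x hx]
    rfl
  have hRL : MemLp R 2 (volume.restrict Ω) :=
    (hR.continuous.memLp_of_hasCompactSupport hRc).restrict Ω
  have hDL : ∀ i, MemLp (partialD i R) 2 (volume.restrict Ω) := fun i =>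
    ((hD i).memLp_of_hasCompactSupport (hasCompactSupport_of_vanishing hb (hD0 i))).restrict Ω
  have hge : ∀ i, g i = toL2 Ω (partialD i R) := by
    intro i
    refine (hg i).unique hΩ (isWeakPartial_iff.2 fun φ hφ => ?_)
    rw [inner_toL2_toL2 hRL (hφ.partialD i), inner_toL2_toL2 (hDL i) hφ]
    exact integral_mul_partialD i hR (hφ.1.of_le (by simp)) hφ.2.1
  refine ⟨∑ i, k i i, fun φ hφ hφc => ?_⟩
  have hφL : MemLp φ 2 (volume.restrict Ω) :=
    (hφ.continuous.memLp_of_hasCompactSupport hφc).restrict Ω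
  have hφc' : ∀ i, HasCompactSupport (partialD i φ) := fun i =>
    hφc.mono' ((subset_tsupport _).trans (tsupport_partialD_subset i φ))
  -- One integration by parts is classical, as `R` is `C¹` on the whole space. The second is the
  -- extension-by-zero result for the continuous function `∂ᵢR`, which vanishes outside `Ω`.
  have h1 : ∀ i, ∫ x, R x * partialD i (partialD i φ) x = inner ℝ (k i i) (toL2 Ω φ) := by
    intro i
    have hw := hk i i
    rw [hge i] at hw
    have h2 := setIntegral_mul_partialD_of_vanishing hΩ hconv hb hne hnc (hD i) (hD0 i) i hw hφ hφc
    rw [integral_mul_partialD i hR ((contDiff_partialD i hφ).of_le (by simp)) (hφc' i),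
      inner_toL2 hφL, ← neg_eq_iff_eq_neg.2 h2]
    congr 1
    refine (setIntegral_eq_integral_of_forall_compl_eq_zero fun x hx => ?_).symm
    rw [hD0 i x hx, zero_mul]
  rw [sum_inner, ← Finset.sum_congr rfl fun i _ => h1 i, ← integral_finsetSum]
  · refine integral_congr_ae (ae_of_all _ fun x => ?_)
    simp only [lapC, Finset.sum_apply, Finset.mul_sum]
  · intro i _
    exact (hR.continuous.mul (contDiff_partialD i
      (contDiff_partialD i hφ)).continuous).integrable_of_hasCompactSupport hRc.mul_right

/-- The Laplacian is put on the kernel, and the hypothesis is applied to the reflected kernel `y ↦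
η(x - y)`. The reflection is written as an affine map of factor `-1`, under which the Laplacian is
unchanged. -/
theorem lapC_conv_mol {ε : ℝ} (hε : 0 < ε) (hΩ : IsOpen Ω) {R : Space d → ℝ} (hR : LocallyIntegrable R volume)
    {Λ : L2 Ω} (hΛ : ∀ φ, ContDiff ℝ ∞ φ → HasCompactSupport φ →
      ∫ x, R x * lapC φ x = inner ℝ Λ (toL2 Ω φ)) :
    lapC (conv R (mol d hε)) = conv (Ω.indicator Λ) (mol d hε) := by
  have hη := contDiff_mol (d := d) hε
  have hηc := hasCompactSupport_mol (d := d) hε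
  have hηc' : ∀ i, HasCompactSupport (partialD i (mol d hε)) := fun i =>
    hηc.mono' ((subset_tsupport _).trans (tsupport_partialD_subset i _))
  have hηc'' : ∀ i, HasCompactSupport (partialD i (partialD i (mol d hε))) := fun i =>
    (hηc' i).mono' ((subset_tsupport _).trans (tsupport_partialD_subset i _))
  funext x
  set ψ : Space d → ℝ := fun y => mol d hε (x + (-1 : ℝ) • y) with hψ
  have hψd : ContDiff ℝ ∞ ψ := by
    refine hη.comp (g := mol d hε) ?_
    fun_prop
  have hψc : HasCompactSupport ψ := by
    have : ψ = mol d hε ∘ (Homeomorph.subLeft x) := by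
      funext y
      simp [hψ, sub_eq_add_neg]
    rw [this]
    exact hηc.comp_homeomorph _
  have e1 : lapC (conv R (mol d hε)) x = ∫ y, R y * lapC ψ y := by
    rw [hψ, lapC_comp_affine hη]
    simp only [lapC, Finset.sum_apply, Pi.smul_apply, Finset.mul_sum, even_two, Even.neg_pow,
      one_pow, one_smul]
    rw [integral_finsetSum]
    · refine Finset.sum_congr rfl fun i _ => ?_
      rw [partialD_conv hR hη hηc, partialD_conv hR (contDiff_partialD i hη) (hηc' i)]
      simp only [conv, neg_smul, one_smul, sub_eq_add_neg]
    · intro i _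
      have := (hηc'' i).convolutionExists_right (ContinuousLinearMap.mul ℝ ℝ) hR
        (contDiff_partialD i (contDiff_partialD i hη)).continuous x
      refine this.integrable.congr (ae_of_all _ fun y => ?_)
      simp [sub_eq_add_neg]
  have hψL : MemLp ψ 2 (volume.restrict Ω) :=
    (hψd.continuous.memLp_of_hasCompactSupport hψc).restrict Ω
  rw [e1, hΛ ψ hψd hψc, inner_toL2 hψL, conv, ← integral_indicator hΩ.measurableSet]
  refine integral_congr_ae (ae_of_all _ fun y => ?_)
  by_cases hy : y ∈ Ω <;> simp [hy, hψ, sub_eq_add_neg]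

-- The approximants are `x ↦ (R * η_ε)((1+τ)x - τx₀)` with `τ = 1/(n+1)`. The dilation pulls the
-- support away from the boundary, leaving room for the mollification. Young's inequality bounds the
-- Laplacians by a multiple of `‖Λ‖`. Bounded Laplacians and `L²` convergence are enough for
-- membership in `H²₀(Ω)`.
open scoped Pointwise in
theorem memH20_of_contDiff (hΩ : IsOpen Ω) (hconv : Convex ℝ Ω)
    (hb : Bornology.IsBounded Ω) (hne : Ω.Nonempty) {R : Space d → ℝ}
    (hR : ContDiff ℝ 1 R) (hR0 : ∀ x, x ∉ Ω → R x = 0) (hR1 : ∀ x, x ∉ Ω → fderiv ℝ R x = 0)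
    (hH2 : MemH2 Ω (toL2 Ω R)) : MemH20 Ω (toL2 Ω R) := by
  -- A bounded set can only be the whole space if the space is a point; there `R` is itself a test
  -- function. Otherwise the complement is non-empty, as the distance arguments require.
  rcases (Ωᶜ).eq_empty_or_nonempty with hemp | hnc
  · have huniv : Ω = univ := compl_empty_iff.1 hemp
    have hsub : Subsingleton (Space d) := by
      by_contra h
      rw [not_subsingleton_iff_nontrivial] at h
      exact NormedSpace.unbounded_univ ℝ (Space d) (huniv ▸ hb)
    have ht : IsTest Ω R := ⟨by
      rw [show R = fun _ => R 0 from funext fun x => by rw [Subsingleton.elim x 0]]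
      exact contDiff_const, hasCompactSupport_of_vanishing hb hR0,
      huniv ▸ subset_univ _⟩
    exact (memH20_of_tendsto hΩ (fun _ => ht) tendsto_const_nhds tendsto_const_nhds).1
  obtain ⟨Λ, hΛ⟩ := integral_mul_lapC_of_vanishing hΩ hconv hb hne hnc hR hR0 hR1 hH2
  have hRc : HasCompactSupport R := hasCompactSupport_of_vanishing hb hR0
  have hRL : MemLp R 2 (volume.restrict Ω) :=
    (hR.continuous.memLp_of_hasCompactSupport hRc).restrict Ω
  have hRl : LocallyIntegrable R volume := hR.continuous.locallyIntegrable
  have hfin : IsFiniteMeasure (volume.restrict Ω) := ⟨by simpa using hb.measure_lt_top⟩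
  obtain ⟨x₀, hx₀⟩ := hne
  obtain ⟨ρ, hρ, hball⟩ := Metric.isOpen_iff.1 hΩ x₀ hx₀
  obtain ⟨D, hD⟩ : ∃ D, ∀ x ∈ Ω, ‖x - x₀‖ ≤ D := by
    obtain ⟨D, hD⟩ := (Metric.isBounded_iff_subset_closedBall x₀).1 hb
    exact ⟨D, fun x hx => by simpa [dist_eq_norm] using hD hx⟩
  have hD0 : 0 ≤ D := (norm_nonneg _).trans (hD x₀ hx₀)
  have hτ : ∀ n : ℕ, (0 : ℝ) < 1 / ((n : ℝ) + 1) := fun n => by positivity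
  -- The dilation by `1 + τ` frees a margin of `τρ`, where `ρ` is the radius of a ball about `x₀`
  -- inside `Ω`. The mollification radius is half of it.
  have hε : ∀ n : ℕ, 0 < 1 / ((n : ℝ) + 1) * (ρ / 2) := fun n => mul_pos (hτ n) (by positivity)
  set A : ℕ → Space d → Space d := fun n x =>
    (-(1 / ((n : ℝ) + 1))) • x₀ + (1 + 1 / ((n : ℝ) + 1)) • x with hA
  set φ : ℕ → Space d → ℝ := fun n x => conv R (mol d (hε n)) (A n x) with hφ
  have hcd : ∀ n, ContDiff ℝ ∞ (conv R (mol d (hε n))) := fun n =>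
    contDiff_conv hRl (contDiff_mol _) (hasCompactSupport_mol _)
  have hAc : ∀ n, Continuous (A n) := fun n => by fun_prop
  have htest : ∀ n, IsTest Ω (φ n) := by
    intro n
    set K : Set (Space d) := closure Ω + Metric.closedBall (0 : Space d) (1 / ((n : ℝ) + 1) * (ρ / 2)) with hK
    have hKc : IsCompact K :=
      (Metric.isCompact_of_isClosed_isBounded isClosed_closure hb.closure).add
        (isCompact_closedBall _ _)
    have hts : tsupport (φ n) ⊆ A n ⁻¹' K := by
      refine closure_minimal (fun x hx => ?_) (hKc.isClosed.preimage (hAc n))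
      have h1 := support_convolution_subset (ContinuousLinearMap.mul ℝ ℝ) (μ := volume)
        (f := R) (g := mol d (hε n)) hx
      refine add_subset_add ?_ ?_ h1
      · intro y hy
        by_contra h
        exact hy (hR0 y fun h' => h (subset_closure h'))
      · rw [mol, ContDiffBump.support_normed_eq]
        exact Metric.ball_subset_closedBall
    have hsub : A n ⁻¹' K ⊆ Ω := by
      rintro x ⟨y, hy, w, hw, hyw⟩
      set τ : ℝ := 1 / ((n : ℝ) + 1) with hτ'
      have hτ0 : 0 < τ := hτ n
      -- If `A n x = y + w` with `y` in the closure of `Ω`, then `x` is a convex combination of `y`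
      -- and the interior point `x₀ + w/τ`, hence interior.
      have h1 : x₀ + τ⁻¹ • w ∈ interior Ω := by
        rw [hΩ.interior_eq]
        refine hball ?_
        rw [Metric.mem_ball, dist_eq_norm, add_sub_cancel_left, norm_smul, norm_inv,
          Real.norm_of_nonneg hτ0.le, inv_mul_lt_iff₀ hτ0]
        rw [mem_closedBall_zero_iff] at hw
        nlinarith [mul_pos hτ0 hρ]
      have h2 := hconv.combo_closure_interior_mem_interior hy h1 (a := 1 / (1 + τ))
        (b := τ / (1 + τ)) (by positivity) (by positivity) (by field_simp)
      rw [hΩ.interior_eq] at h2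
      convert h2 using 1
      have h3 : (1 + τ) ≠ 0 := by positivity
      have h4 : y + w = -τ • x₀ + (1 + τ) • x := hyw
      refine smul_right_injective _ h3 ?_
      dsimp only
      rw [smul_add, smul_smul, smul_smul, mul_div_cancel₀ _ h3, mul_div_cancel₀ _ h3, one_smul,
        smul_add, smul_inv_smul₀ hτ0.ne']
      have : (1 + τ) • x = y + w + τ • x₀ := by rw [h4]; module
      rw [this]
      abel
    refine ⟨?_, ?_, hts.trans hsub⟩
    · refine (hcd n).comp (g := conv R (mol d (hε n))) ?_
      fun_prop
    · exact Metric.isCompact_of_isClosed_isBounded (isClosed_tsupport _)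
        (hb.subset (hts.trans hsub))
  have hlim : Tendsto (fun n => toL2 Ω (φ n)) atTop (𝓝 (toL2 Ω R)) := by
    have huc : UniformContinuous R := hRc.uniformContinuous_of_continuous hR.continuous
    rw [Metric.tendsto_atTop]
    intro δ hδ
    set V : ℝ := (measureUnivNNReal (volume.restrict Ω) : ℝ) ^ ((2 : ℝ≥0∞).toReal)⁻¹ with hV
    have hV0 : 0 ≤ V := by positivity
    obtain ⟨m, hm, hmR⟩ := Metric.uniformContinuous_iff.1 huc (δ / (2 * (2 * V + 1))) (by positivity)
    have hev : ∀ᶠ n : ℕ in atTop, 1 / ((n : ℝ) + 1) * (ρ / 2 + D) < m := by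
      have := (tendsto_one_div_add_atTop_nhds_zero_nat (𝕜 := ℝ)).mul_const (ρ / 2 + D)
      rw [zero_mul] at this
      exact this.eventually_lt_const hm
    obtain ⟨N, hN⟩ := eventually_atTop.1 hev
    refine ⟨N, fun n hn => ?_⟩
    have hn' := hN n hn
    rw [mul_add] at hn'
    have hp1 := hτ n
    have hp2 : 0 ≤ 1 / ((n : ℝ) + 1) * D := mul_nonneg hp1.le hD0
    have hbound : ∀ᵐ x ∂(volume.restrict Ω),
        ‖(toL2 Ω (φ n) - toL2 Ω R : L2 Ω) x‖ ≤ 2 * (δ / (2 * (2 * V + 1))) := by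
      filter_upwards [Lp.coeFn_sub (toL2 Ω (φ n)) (toL2 Ω R), (htest n).coeFn, coeFn_toL2 hRL,
        ae_restrict_mem hΩ.measurableSet] with x h1 h2 h3 hx
      rw [h1, Pi.sub_apply, h2, h3]
      have b1 : |φ n x - R (A n x)| ≤ δ / (2 * (2 * V + 1)) := by
        refine abs_conv_mol_sub_le (hε n) hR.continuous.aestronglyMeasurable fun y hy => ?_
        exact (hmR ((Metric.mem_ball.1 hy).trans (by linarith))).le
      have b2 : |R (A n x) - R x| ≤ δ / (2 * (2 * V + 1)) := by
        refine (hmR ?_).le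
        have e : A n x - x = (1 / ((n : ℝ) + 1)) • (x - x₀) := by
          simp only [hA]; module
        rw [dist_eq_norm, e, norm_smul, Real.norm_of_nonneg hp1.le]
        have := mul_le_mul_of_nonneg_left (hD x hx) hp1.le
        linarith [hε n]
      have e : φ n x - R x = (φ n x - R (A n x)) + (R (A n x) - R x) := by ring
      rw [e, Real.norm_eq_abs]
      exact (abs_add_le _ _).trans (by linarith)
    have hle := Lp.norm_le_of_ae_bound (by positivity) hbound
    rw [dist_eq_norm]
    refine hle.trans_lt ?_
    change V * _ < δ
    have : V * (2 * (δ / (2 * (2 * V + 1)))) = δ * (V / (2 * V + 1)) := by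
      field_simp
    rw [this]
    have : V / (2 * V + 1) < 1 := by
      rw [div_lt_one (by positivity)]
      linarith
    nlinarith
  -- The chain rule contributes `c² ≤ 4` with `c = 1 + τ ≤ 2`; the change of variables and the
  -- mollification do not increase the norm.
  have hbd : ∀ n, ‖toL2 Ω (lapC (φ n))‖ ≤ 4 * ‖Λ‖ := by
    intro n
    set c : ℝ := 1 + 1 / ((n : ℝ) + 1) with hc
    have hc1 : 1 ≤ c := by linarith [hτ n]
    have hc2 : c ≤ 2 := by
      have : 1 / ((n : ℝ) + 1) ≤ 1 := by
        rw [div_le_one (by positivity)]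
        linarith [(Nat.cast_nonneg n : (0 : ℝ) ≤ n)]
      linarith
    have hΛm : Measurable (Ω.indicator (Λ : Space d → ℝ)) :=
      (Lp.stronglyMeasurable Λ).measurable.indicator hΩ.measurableSet
    have e1 : lapC (φ n) = c ^ 2 • fun x => conv (Ω.indicator Λ) (mol d (hε n)) (A n x) := by
      rw [hφ, ← lapC_conv_mol (hε n) hΩ hRl hΛ]
      exact lapC_comp_affine (hcd n) _ c
    have hkm : Measurable (conv (Ω.indicator (Λ : Space d → ℝ)) (mol d (hε n))) := by
      rw [← lapC_conv_mol (hε n) hΩ hRl hΛ]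
      unfold lapC
      simp only [Finset.sum_fn]
      exact Finset.measurable_sum _ fun i _ =>
        (contDiff_partialD i (contDiff_partialD i (hcd n))).continuous.measurable
    have hsq : ‖toL2 Ω (lapC (φ n))‖ₑ ^ 2 ≤ (‖(4 : ℝ)‖ₑ * ‖Λ‖ₑ) ^ 2 := by
      rw [enorm_toL2 (htest n).lapC.memLp, eLpNorm_two_sq]
      calc ∫⁻ x in Ω, ‖lapC (φ n) x‖ₑ ^ 2 ≤ ∫⁻ x, ‖lapC (φ n) x‖ₑ ^ 2 :=
            setLIntegral_le_lintegral _ _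
        _ = ‖c ^ 2‖ₑ ^ 2 * ∫⁻ x, ‖conv (Ω.indicator Λ) (mol d (hε n)) (A n x)‖ₑ ^ 2 := by
            rw [e1, ← lintegral_const_mul _ (by
              have := (hAc n).measurable
              fun_prop)]
            refine lintegral_congr fun x => ?_
            rw [Pi.smul_apply, smul_eq_mul, enorm_mul, mul_pow]
        _ ≤ ‖(4 : ℝ)‖ₑ ^ 2 * ∫⁻ x, ‖conv (Ω.indicator Λ) (mol d (hε n)) x‖ₑ ^ 2 := by
            refine mul_le_mul' ?_ ?_
            · gcongr 1
              rw [Real.enorm_eq_ofReal (by positivity), Real.enorm_eq_ofReal (by norm_num)]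
              exact ENNReal.ofReal_le_ofReal (by nlinarith)
            · exact lintegral_comp_affine_le
                (k := fun x => ‖conv (Ω.indicator Λ) (mol d (hε n)) x‖ₑ ^ 2) (by fun_prop) _ hc1
        _ ≤ ‖(4 : ℝ)‖ₑ ^ 2 * ∫⁻ x, ‖Ω.indicator Λ x‖ₑ ^ 2 := by
            exact mul_le_mul' le_rfl (lintegral_conv_mol_sq_le (hε n) hΛm)
        _ = (‖(4 : ℝ)‖ₑ * ‖Λ‖ₑ) ^ 2 := by
            rw [mul_pow, Lp.enorm_def, eLpNorm_two_sq, ← lintegral_indicator hΩ.measurableSet]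
            congr 1
            refine lintegral_congr fun x => ?_
            by_cases hx : x ∈ Ω <;> simp [hx]
    have h2 : ‖toL2 Ω (lapC (φ n))‖ₑ ≤ ‖(4 : ℝ)‖ₑ * ‖Λ‖ₑ :=
      (ENNReal.pow_le_pow_left_iff two_ne_zero).1 hsq
    have h3 := ENNReal.toReal_mono (by finiteness) h2
    simpa using h3
  refine (memH20_of_bounded hΩ htest hlim hbd (w := Λ) fun ψ hψ => ?_).1
  rw [inner_toL2_toL2 hRL hψ.lapC]
  exact hΛ ψ hψ.1 hψ.2.1

end PolyExt

end

noncomputable section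

namespace PolyExt

variable {d : ℕ} {Ω : Set (Space d)}

/-! ### Convex polytopes and the finite element space -/

theorem IsConvexPolytope.isOpen (h : IsConvexPolytope Ω) : IsOpen Ω := by
  obtain ⟨_, A, rfl⟩ := h
  exact isOpen_interior

theorem IsConvexPolytope.convex (h : IsConvexPolytope Ω) : Convex ℝ Ω := by
  obtain ⟨_, A, rfl⟩ := h
  exact (convex_convexHull ℝ _).interior

theorem IsConvexPolytope.isBounded (h : IsConvexPolytope Ω) : Bornology.IsBounded Ω := by
  obtain ⟨_, A, rfl⟩ := h
  exact (isBounded_convexHull.2 A.finite_toSet.isBounded).subset interior_subset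

/-- The boundary conditions provide the `C¹` extension by zero of the representative, and conformity
of the element provides its second weak derivatives in `Ω`. -/
theorem memH20_of_mem_femW (hpoly : IsConvexPolytope Ω)
    {K : Geometry.SimplicialComplex ℝ (Space d)}
    {P : Finset (Space d) → Submodule ℝ (Space d → ℝ)} (hP : IsH2Conforming Ω K P)
    {v : L2 Ω} (hv : v ∈ femW Ω K P) : MemH20 Ω v := by
  obtain ⟨r, hvr, hpc, h0, hn⟩ := hv
  have hΩ := hpoly.isOpen
  obtain ⟨hR, hR1⟩ := contDiff_indicator_of_normal hΩ hpoly.convex hpc.1 h0 hn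
  have hae : v =ᵐ[volume.restrict Ω] Ω.indicator r := by
    filter_upwards [hvr, ae_restrict_mem hΩ.measurableSet] with x hx hxΩ
    rw [hx, indicator_of_mem hxΩ]
  have hve := toL2_eq_of_ae hae
  obtain ⟨u, hu, hu2⟩ := hP.conforming r hpc
  have huv : u = v := Lp.ext (hu.trans hvr.symm)
  rw [← hve]
  refine memH20_of_contDiff hΩ hpoly.convex hpoly.isBounded hpoly.1 hR
    (fun x hx => indicator_of_notMem hx r) hR1 ?_
  rw [hve, ← huv]
  exact hu2

/-! ### Weighted spaces -/

section weighted

variable {X : Type*} [NormedAddCommGroup X] {b Y : ℝ}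

theorem measurable_weight (b : ℝ) : Measurable fun y : ℝ => ENNReal.ofReal (y ^ b) := by
  fun_prop

theorem lintegral_wMeasure (b Y : ℝ) (f : ℝ → ℝ≥0∞) :
    ∫⁻ y, f y ∂(wMeasure b Y) = ∫⁻ y in Ioo 0 Y, ENNReal.ofReal (y ^ b) * f y :=
  lintegral_withDensity_eq_lintegral_mul_non_measurable _ (measurable_weight b)
    (ae_of_all _ fun _ => ENNReal.ofReal_lt_top) f

theorem wMeasure_ac (b Y : ℝ) : wMeasure b Y ≪ volume.restrict (Ioo 0 Y) :=
  withDensity_absolutelyContinuous _ _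

theorem restrict_ac_wMeasure (b Y : ℝ) : volume.restrict (Ioo 0 Y) ≪ wMeasure b Y := by
  refine withDensity_absolutelyContinuous' (measurable_weight b).aemeasurable ?_
  filter_upwards [ae_restrict_mem measurableSet_Ioo] with y hy
  exact (ENNReal.ofReal_pos.2 (Real.rpow_pos_of_pos hy.1 b)).ne'

theorem ae_wMeasure_of_ae {p : ℝ → Prop} (h : ∀ᵐ y, y ∈ Ioo 0 Y → p y) :
    ∀ᵐ y ∂(wMeasure b Y), p y :=
  (wMeasure_ac b Y).ae_le ((ae_restrict_iff' measurableSet_Ioo).2 h)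

theorem aestronglyMeasurable_wMeasure_iff {f : ℝ → X} :
    AEStronglyMeasurable f (wMeasure b Y) ↔ AEStronglyMeasurable f (volume.restrict (Ioo 0 Y)) :=
  ⟨fun h => h.mono_ac (restrict_ac_wMeasure b Y), fun h => h.mono_ac (wMeasure_ac b Y)⟩

theorem lintegral_weight_lt_top (hb : -1 < b) (Y : ℝ) :
    ∫⁻ y in Ioo 0 Y, ENNReal.ofReal (y ^ b) < ⊤ := by
  rcases le_or_gt Y 0 with hY | hY
  · simp [Ioo_eq_empty_of_le hY]
  have h := (intervalIntegral.intervalIntegrable_rpow' (a := 0) (b := Y) hb)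
  rw [intervalIntegrable_iff_integrableOn_Ioo_of_le hY.le] at h
  have := h.2
  rw [HasFiniteIntegral] at this
  refine lt_of_le_of_lt (lintegral_mono fun y => ?_) this
  exact Real.ofReal_le_enorm _

theorem isFiniteMeasure_wMeasure (hb : -1 < b) (Y : ℝ) : IsFiniteMeasure (wMeasure b Y) := by
  refine ⟨?_⟩
  have := lintegral_wMeasure b Y 1
  simp only [Pi.one_apply, lintegral_const, one_mul, mul_one] at this
  rw [this]
  exact lintegral_weight_lt_top hb Y

theorem wNorm_sq (b Y : ℝ) (w : ℝ → X) :
    wNorm b Y w ^ 2 = ∫⁻ y in Ioo 0 Y, ENNReal.ofReal (y ^ b) * ‖w y‖ₑ ^ 2 := by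
  rw [wNorm, eLpNorm_two_sq, lintegral_wMeasure]

/-- The weights combine as `y^b · y^(-2b) = y^(-b)`. Hence `𝒟_b w ∈ L²(y^b)` expresses the same
condition as square integrability of the derivative of the flux with weight `y^(-b)`. -/
theorem wNorm_rpow_smul [NormedSpace ℝ X] (b Y : ℝ) (g : ℝ → X) :
    wNorm b Y (fun y => y ^ (-b) • g y) = wNorm (-b) Y g := by
  refine (ENNReal.pow_right_strictMono two_ne_zero).injective ?_
  rw [wNorm_sq, wNorm_sq]
  refine setLIntegral_congr_fun measurableSet_Ioo fun y hy => ?_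
  have hp : 0 < y ^ (-b) := Real.rpow_pos_of_pos hy.1 _
  rw [enorm_smul, mul_pow, ← mul_assoc, Real.enorm_eq_ofReal hp.le, sq (ENNReal.ofReal _),
    ← mul_assoc, ← ENNReal.ofReal_mul (Real.rpow_nonneg hy.1.le _), ← Real.rpow_add hy.1,
    add_neg_cancel, Real.rpow_zero, ENNReal.ofReal_one, one_mul]

theorem memLp_rpow_smul [NormedSpace ℝ X] {g : ℝ → X} (hg : MemLp g 2 (wMeasure (-b) Y)) :
    MemLp (fun y => y ^ (-b) • g y) 2 (wMeasure b Y) := by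
  refine ⟨?_, ?_⟩
  · have h1 : AEStronglyMeasurable g (wMeasure b Y) :=
      aestronglyMeasurable_wMeasure_iff.2 (aestronglyMeasurable_wMeasure_iff.1 hg.1)
    have h2 : Measurable fun y : ℝ => y ^ (-b) := by fun_prop
    exact h2.aestronglyMeasurable.smul h1
  · have := hg.2
    rwa [← wNorm, ← wNorm_rpow_smul] at this

/-- Functions in the weighted space `L²(y^b)` with `b < 1` are integrable. -/
theorem integrableOn_of_memLp (hb : b < 1) {f : ℝ → X} (hf : MemLp f 2 (wMeasure b Y)) :
    IntegrableOn f (Ioo 0 Y) := by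
  refine ⟨aestronglyMeasurable_wMeasure_iff.1 hf.1, ?_⟩
  rw [HasFiniteIntegral]
  -- Young's inequality replaces Cauchy–Schwarz; `y^(-b)` is integrable because `b < 1`.
  have hle : ∀ y ∈ Ioo 0 Y, ‖f y‖ₑ ≤ ENNReal.ofReal (y ^ (-b))
      + ENNReal.ofReal (y ^ b) * ‖f y‖ₑ ^ 2 := by
    intro y hy
    have hp : 0 < y ^ b := Real.rpow_pos_of_pos hy.1 _
    have e : ‖f y‖ₑ = ENNReal.ofReal ‖f y‖ := (ofReal_norm _).symm
    rw [e, ← ENNReal.ofReal_pow (norm_nonneg _), ← ENNReal.ofReal_mul hp.le,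
      ← ENNReal.ofReal_add (Real.rpow_nonneg hy.1.le _) (by positivity)]
    refine ENNReal.ofReal_le_ofReal ?_
    rw [Real.rpow_neg hy.1.le]
    set a := y ^ b
    have h1 : a * a⁻¹ = 1 := mul_inv_cancel₀ hp.ne'
    have h2 : 0 < a⁻¹ := inv_pos.2 hp
    nlinarith [mul_nonneg hp.le (sq_nonneg (‖f y‖ - a⁻¹)), norm_nonneg (f y)]
  calc ∫⁻ y in Ioo 0 Y, ‖f y‖ₑ
      ≤ ∫⁻ y in Ioo 0 Y, (ENNReal.ofReal (y ^ (-b)) + ENNReal.ofReal (y ^ b) * ‖f y‖ₑ ^ 2) :=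
        setLIntegral_mono' measurableSet_Ioo hle
    _ = (∫⁻ y in Ioo 0 Y, ENNReal.ofReal (y ^ (-b)))
          + ∫⁻ y in Ioo 0 Y, ENNReal.ofReal (y ^ b) * ‖f y‖ₑ ^ 2 :=
        lintegral_add_left (measurable_weight _) _
    _ < ⊤ := by
        refine ENNReal.add_lt_top.2 ⟨lintegral_weight_lt_top (by linarith) Y, ?_⟩
        rw [← wNorm_sq]
        exact ENNReal.pow_lt_top hf.2

end weighted

/-! ### The spaces `H²(y^b, (0,Y); X)` -/

section MemH2N

variable {X : Type*} [NormedAddCommGroup X] [NormedSpace ℝ X] {b Y : ℝ} {w v : ℝ → X}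

theorem deriv_eq_of_eqOn_Ioo (h : EqOn w v (Ioo 0 Y)) {y : ℝ} (hy : y ∈ Ioo 0 Y) :
    deriv w y = deriv v y :=
  (h.eventuallyEq_of_mem (isOpen_Ioo.mem_nhds hy)).deriv_eq

theorem opD_congr (h : EqOn w v (Ioo 0 Y)) {y : ℝ} (hy : y ∈ Ioo 0 Y) :
    opD b w y = opD b v y := by
  have : EqOn (fun t => t ^ b • deriv w t) (fun t => t ^ b • deriv v t) (Ioo 0 Y) :=
    fun t ht => by simp only [deriv_eq_of_eqOn_Ioo h ht]
  rw [opD, opD, deriv_eq_of_eqOn_Ioo this hy]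

theorem MemH2N.congr (hw : MemH2N b Y w) (h : EqOn v w (Icc 0 Y)) : MemH2N b Y v := by
  have h' : EqOn v w (Ioo 0 Y) := h.mono Ioo_subset_Icc_self
  obtain ⟨g, hg, hg'⟩ := hw.flux
  refine ⟨hw.cont.congr h, fun y hy => ?_, ?_, ?_, ?_, ?_⟩
  · exact (hw.diff y hy).congr_of_eventuallyEq (h'.eventuallyEq_of_mem (isOpen_Ioo.mem_nhds hy))
  · refine (memLp_congr_ae ?_).2 hw.memLp
    filter_upwards [ae_mem_Ioo b Y] with y hy
    exact h' hy
  · refine (memLp_congr_ae ?_).2 hw.memLp_deriv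
    filter_upwards [ae_mem_Ioo b Y] with y hy
    exact deriv_eq_of_eqOn_Ioo h' hy
  · refine ⟨g, hg, fun a ha c hc => ?_⟩
    rw [deriv_eq_of_eqOn_Ioo h' ha, deriv_eq_of_eqOn_Ioo h' hc]
    exact hg' a ha c hc
  · refine hw.flux_zero.congr' ?_
    filter_upwards [self_mem_nhdsWithin] with y hy
    rw [deriv_eq_of_eqOn_Ioo h' hy]

theorem MemH2N.add (hw : MemH2N b Y w) (hv : MemH2N b Y v) : MemH2N b Y (w + v) := by
  obtain ⟨g, hg, hg'⟩ := hw.flux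
  obtain ⟨k, hk, hk'⟩ := hv.flux
  have hd : ∀ y ∈ Ioo 0 Y, deriv (w + v) y = deriv w y + deriv v y :=
    fun y hy => deriv_add (hw.diff y hy) (hv.diff y hy)
  refine ⟨hw.cont.add hv.cont, fun y hy => (hw.diff y hy).add (hv.diff y hy),
    hw.memLp.add hv.memLp, ?_, ?_, ?_⟩
  · refine (memLp_congr_ae ?_).2 (hw.memLp_deriv.add hv.memLp_deriv)
    filter_upwards [ae_mem_Ioo b Y] with y hy
    exact hd y hy
  · refine ⟨g + k, hg.add hk, fun a ha c hc => ⟨(hg' a ha c hc).1.add (hk' a ha c hc).1, ?_⟩⟩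
    have e := intervalIntegral.integral_add (hg' a ha c hc).1 (hk' a ha c hc).1
    simp only [Pi.add_apply]
    rw [e, ← (hg' a ha c hc).2, ← (hk' a ha c hc).2, hd a ha, hd c hc]
    simp only [smul_add]
    abel
  · have h := hw.flux_zero.add hv.flux_zero
    rw [add_zero] at h
    refine h.congr' ?_
    filter_upwards [self_mem_nhdsWithin] with y hy
    rw [hd y hy, smul_add]

theorem MemH2N.clm_comp {Z : Type*} [NormedAddCommGroup Z] [NormedSpace ℝ Z]
    [CompleteSpace X] [CompleteSpace Z]
    (L : X →L[ℝ] Z) (hw : MemH2N b Y w) : MemH2N b Y (fun y => L (w y)) := by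
  obtain ⟨g, hg, hg'⟩ := hw.flux
  have hd : ∀ y ∈ Ioo 0 Y, deriv (fun y => L (w y)) y = L (deriv w y) :=
    fun y hy => (L.hasFDerivAt.comp_hasDerivAt y (hw.diff y hy).hasDerivAt).deriv
  refine ⟨L.continuous.comp_continuousOn hw.cont,
    fun y hy => L.differentiableAt.comp y (hw.diff y hy), L.comp_memLp' hw.memLp, ?_, ?_, ?_⟩
  · refine (memLp_congr_ae ?_).2 (L.comp_memLp' hw.memLp_deriv)
    filter_upwards [ae_mem_Ioo b Y] with y hy
    exact hd y hy
  · refine ⟨fun y => L (g y), L.comp_memLp' hg, fun a ha c hc => ⟨?_, ?_⟩⟩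
    · exact ⟨L.integrable_comp (hg' a ha c hc).1.1, L.integrable_comp (hg' a ha c hc).1.2⟩
    · rw [hd a ha, hd c hc, L.intervalIntegral_comp_comm (hg' a ha c hc).1, ← (hg' a ha c hc).2]
      simp only [map_sub, map_smul]
  · have h := (L.continuous.tendsto 0).comp hw.flux_zero
    rw [map_zero] at h
    refine h.congr' ?_
    filter_upwards [self_mem_nhdsWithin] with y hy
    simp [hd y hy]

theorem MemH2N.smul [CompleteSpace X] (c : ℝ) (hw : MemH2N b Y w) : MemH2N b Y (c • w) :=
  hw.clm_comp (c • ContinuousLinearMap.id ℝ X)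

theorem MemH2N.sub [CompleteSpace X] (hw : MemH2N b Y w) (hv : MemH2N b Y v) :
    MemH2N b Y (w - v) := by
  have := hw.add (hv.smul (-1))
  rwa [neg_one_smul, ← sub_eq_add_neg] at this

theorem MemH2N.zero : MemH2N b Y (0 : ℝ → X) := by
  have h0 : deriv (0 : ℝ → X) = 0 := by
    funext y
    simp
  refine ⟨continuousOn_const, fun y _ => differentiableAt_const _, MemLp.zero, ?_, ?_, ?_⟩
  · rw [h0]
    exact MemLp.zero
  · refine ⟨0, MemLp.zero, fun a _ c _ => ⟨?_, ?_⟩⟩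
    · exact intervalIntegrable_const
    · simp
  · rw [h0]
    simp only [Pi.zero_apply, smul_zero]
    exact tendsto_const_nhds

variable [CompleteSpace X]

/-- The flux `y^b ∂_y w` is the primitive of its derivative, which exists almost everywhere. -/
theorem MemH2N.exists_flux (hb : b ∈ Ioo (-1 : ℝ) 1) (hw : MemH2N b Y w) :
    ∃ g : ℝ → X, MemLp g 2 (wMeasure (-b) Y) ∧ IntegrableOn g (Ioo 0 Y) ∧
      (∀ y ∈ Ioo 0 Y, y ^ b • deriv w y = ∫ t in (0)..y, g t) ∧
      ∀ᵐ y ∂(wMeasure b Y), HasDerivAt (fun t => t ^ b • deriv w t) (g y) y ∧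
        opD b w y = -(y ^ (-b) • g y) := by
  obtain ⟨g, hg, hg'⟩ := hw.flux
  have hint : IntegrableOn g (Ioo 0 Y) := integrableOn_of_memLp (by linarith [hb.1]) hg
  rcases le_or_gt Y 0 with hY | hY
  · refine ⟨g, hg, hint, fun y hy => absurd (hy.1.trans hy.2) (not_lt.2 hY), ?_⟩
    filter_upwards [ae_mem_Ioo b Y] with y hy
    exact absurd (hy.1.trans hy.2) (not_lt.2 hY)
  have hii : IntervalIntegrable g volume 0 Y :=
    (intervalIntegrable_iff_integrableOn_Ioo_of_le hY.le).2 hint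
  have hprim : ∀ y ∈ Ioo 0 Y, y ^ b • deriv w y = ∫ t in (0)..y, g t := by
    intro y hy
    have hsub : ∀ a ∈ Icc 0 Y, IntervalIntegrable g volume 0 a := fun a ha =>
      hii.mono_set (by
        rw [uIcc_of_le ha.1, uIcc_of_le hY.le]
        exact Icc_subset_Icc_right ha.2)
    have hc : ContinuousOn (fun a => ∫ t in (0)..a, g t) (Icc 0 Y) :=
      by simpa [uIcc_of_le hY.le] using
        intervalIntegral.continuousOn_primitive_interval' hii left_mem_uIcc
    have h0 : Tendsto (fun a => ∫ t in (0)..a, g t) (𝓝[Ioo 0 Y] 0) (𝓝 0) := by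
      have := (hc 0 ⟨le_rfl, hY.le⟩).tendsto
      simp only [intervalIntegral.integral_same] at this
      exact this.mono_left (nhdsWithin_mono _ Ioo_subset_Icc_self)
    have hne : (𝓝[Ioo 0 Y] (0 : ℝ)).NeBot := by
      rw [← mem_closure_iff_nhdsWithin_neBot, closure_Ioo hY.ne]
      exact ⟨le_rfl, hY.le⟩
    have hl := hw.flux_zero.sub h0
    rw [sub_zero] at hl
    -- The flux and the primitive of `g` differ by a constant. Both tend to zero at `0`, so the
    -- constant is zero.
    have heq : ∀ a ∈ Ioo 0 Y, a ^ b • deriv w a - ∫ t in (0)..a, g t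
        = y ^ b • deriv w y - ∫ t in (0)..y, g t := by
      intro a ha
      have h1 := (hg' a ha y hy).2
      have h2 := intervalIntegral.integral_interval_sub_left
        (hsub y (Ioo_subset_Icc_self hy)) (hsub a (Ioo_subset_Icc_self ha))
      rw [← h2] at h1
      exact (sub_eq_sub_iff_sub_eq_sub.1 h1).symm
    have : Tendsto (fun a => a ^ b • deriv w a - ∫ t in (0)..a, g t) (𝓝[Ioo 0 Y] 0)
        (𝓝 (y ^ b • deriv w y - ∫ t in (0)..y, g t)) := by
      refine tendsto_const_nhds.congr' ?_
      filter_upwards [self_mem_nhdsWithin] with a ha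
      exact (heq a ha).symm
    exact sub_eq_zero.1 (tendsto_nhds_unique this hl)
  refine ⟨g, hg, hint, hprim, ?_⟩
  refine ae_wMeasure_of_ae ?_
  filter_upwards [hii.ae_hasDerivAt_integral] with y hy hyI
  have h1 := hy (by rw [uIcc_of_le hY.le]; exact Ioo_subset_Icc_self hyI) 0 left_mem_uIcc
  have h2 : HasDerivAt (fun t => t ^ b • deriv w t) (g y) y := by
    refine h1.congr_of_eventuallyEq ?_
    filter_upwards [isOpen_Ioo.mem_nhds hyI] with t ht
    exact hprim t ht
  exact ⟨h2, by rw [opD, h2.deriv]⟩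

theorem MemH2N.memLp_opD (hb : b ∈ Ioo (-1 : ℝ) 1) (hw : MemH2N b Y w) :
    MemLp (opD b w) 2 (wMeasure b Y) := by
  obtain ⟨g, hg, _, _, h⟩ := hw.exists_flux hb
  refine (memLp_congr_ae ?_).2 (memLp_rpow_smul hg).neg
  filter_upwards [h] with y hy
  exact hy.2

theorem MemH2N.opD_add (hb : b ∈ Ioo (-1 : ℝ) 1) (hw : MemH2N b Y w) (hv : MemH2N b Y v) :
    ∀ᵐ y ∂(wMeasure b Y), opD b (w + v) y = opD b w y + opD b v y := by
  obtain ⟨g, _, _, _, hg⟩ := hw.exists_flux hb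
  obtain ⟨k, _, _, _, hk⟩ := hv.exists_flux hb
  filter_upwards [hg, hk, ae_mem_Ioo b Y] with y h1 h2 hy
  have h3 : HasDerivAt (fun t => t ^ b • deriv (w + v) t) (g y + k y) y := by
    refine (h1.1.add h2.1).congr_of_eventuallyEq ?_
    filter_upwards [isOpen_Ioo.mem_nhds hy] with t ht
    rw [deriv_add (hw.diff t ht) (hv.diff t ht), smul_add]
    rfl
  rw [h1.2, h2.2, opD, h3.deriv, smul_add, neg_add]

theorem MemH2N.opD_clm {Z : Type*} [NormedAddCommGroup Z] [NormedSpace ℝ Z]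
    (L : X →L[ℝ] Z) (hb : b ∈ Ioo (-1 : ℝ) 1) (hw : MemH2N b Y w) :
    ∀ᵐ y ∂(wMeasure b Y), opD b (fun y => L (w y)) y = L (opD b w y) := by
  obtain ⟨g, _, _, _, hg⟩ := hw.exists_flux hb
  filter_upwards [hg, ae_mem_Ioo b Y] with y h1 hy
  have h3 : HasDerivAt (fun t => t ^ b • deriv (fun y => L (w y)) t) (L (g y)) y := by
    refine (L.hasFDerivAt.comp_hasDerivAt y h1.1).congr_of_eventuallyEq ?_
    filter_upwards [isOpen_Ioo.mem_nhds hy] with t ht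
    have : deriv (fun y => L (w y)) t = L (deriv w t) :=
      (L.hasFDerivAt.comp_hasDerivAt t (hw.diff t ht).hasDerivAt).deriv
    simp [this]
  rw [h1.2, opD, h3.deriv, map_neg, map_smul]

theorem MemH2N.opD_smul (c : ℝ) (hb : b ∈ Ioo (-1 : ℝ) 1) (hw : MemH2N b Y w) :
    ∀ᵐ y ∂(wMeasure b Y), opD b (c • w) y = c • opD b w y :=
  hw.opD_clm (c • ContinuousLinearMap.id ℝ X) hb

theorem MemH2N.opD_sub (hb : b ∈ Ioo (-1 : ℝ) 1) (hw : MemH2N b Y w) (hv : MemH2N b Y v) :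
    ∀ᵐ y ∂(wMeasure b Y), opD b (w - v) y = opD b w y - opD b v y := by
  have h := hw.opD_add hb (hv.smul (-1))
  rw [neg_one_smul, ← sub_eq_add_neg] at h
  have h' := hv.opD_smul (-1) hb
  rw [neg_one_smul] at h'
  filter_upwards [h, h'] with y h1 h2
  rw [h1, h2, neg_one_smul, ← sub_eq_add_neg]

end MemH2N

end PolyExt

end

noncomputable section

namespace PolyExt

variable {d : ℕ} {Ω : Set (Space d)}

/-! ### The piecewise cubic functions in the extended variable -/

theorem IsPartition.exists_mem_Icc {M : ℕ} {Y : ℝ} {τ : Fin (M + 1) → ℝ} (hτ : IsPartition Y τ)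
    (hY : 0 < Y) {t : ℝ} (ht : t ∈ Icc 0 Y) :
    ∃ m : Fin M, t ∈ Icc (τ m.castSucc) (τ m.succ) := by
  by_contra! hno
  have hle : ∀ k : Fin (M + 1), τ k ≤ t := by
    intro k
    induction k using Fin.induction with
    | zero => rw [hτ.2.1]; exact ht.1
    | succ m ih =>
      by_contra! h
      exact hno m ⟨ih, h.le⟩
  cases M with
  | zero =>
    have h1 := hτ.2.1
    have h2 := hτ.2.2
    rw [show Fin.last 0 = 0 from rfl, h1] at h2
    exact hY.ne h2
  | succ n =>
    refine hno (Fin.last n) ⟨hle _, ?_⟩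
    rw [Fin.succ_last, hτ.2.2]
    exact ht.2

theorem IsPartition.mem_Icc {M : ℕ} {Y : ℝ} {τ : Fin (M + 1) → ℝ} (hτ : IsPartition Y τ)
    (k : Fin (M + 1)) : τ k ∈ Icc 0 Y := by
  constructor
  · rw [← hτ.2.1]
    exact hτ.1.monotone (Fin.zero_le k)
  · rw [← hτ.2.2]
    exact hτ.1.monotone (Fin.le_last k)

theorem exists_bound_polynomial (q : Polynomial ℝ) (Y : ℝ) :
    ∃ B, 0 ≤ B ∧ ∀ t ∈ Icc 0 Y, |q.eval t| ≤ B := by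
  obtain ⟨B, hB⟩ := isCompact_Icc.exists_bound_of_continuousOn (s := Icc 0 Y)
    q.continuous.continuousOn
  exact ⟨max B 0, le_max_right _ _, fun t ht => (hB t ht).trans (le_max_left _ _)⟩

theorem femS_hasDerivWithinAt {M : ℕ} {Y : ℝ} {τ : Fin (M + 1) → ℝ} {p : ℝ → ℝ}
    (hp : p ∈ femS Y τ) {t : ℝ} (ht : t ∈ Icc 0 Y) :
    HasDerivWithinAt p (derivWithin p (Icc 0 Y) t) (Icc 0 Y) t :=
  (hp.1.differentiableOn (by simp) t ht).hasDerivWithinAt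

theorem femS_hasDerivAt {M : ℕ} {Y : ℝ} {τ : Fin (M + 1) → ℝ} {p : ℝ → ℝ}
    (hp : p ∈ femS Y τ) {t : ℝ} (ht : t ∈ Ioo 0 Y) :
    HasDerivAt p (derivWithin p (Icc 0 Y) t) t :=
  (femS_hasDerivWithinAt hp (Ioo_subset_Icc_self ht)).hasDerivAt
    (Icc_mem_nhds ht.1 ht.2)

theorem femS_continuousOn_deriv {M : ℕ} {Y : ℝ} (hY : 0 < Y) {τ : Fin (M + 1) → ℝ} {p : ℝ → ℝ}
    (hp : p ∈ femS Y τ) : ContinuousOn (derivWithin p (Icc 0 Y)) (Icc 0 Y) :=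
  hp.1.continuousOn_derivWithin (uniqueDiffOn_Icc hY) le_rfl

/-- Away from the nodes, the derivatives of `p ∈ 𝒮` exist, and `p'` is bounded by `C t`. -/
theorem femS_exists_bound {M : ℕ} {Y : ℝ} (hY : 0 < Y) {τ : Fin (M + 1) → ℝ}
    (hτ : IsPartition Y τ) {p : ℝ → ℝ} (hp : p ∈ femS Y τ) :
    ∃ C, 0 ≤ C ∧ ∀ t ∈ Ioo 0 Y, t ∉ range τ → |deriv p t| ≤ C * t ∧
      ∃ e, |e| ≤ C ∧ HasDerivAt (deriv p) e t := by
  have hm : ∀ m : Fin M, ∃ C, 0 ≤ C ∧ ∀ t ∈ Ioo (τ m.castSucc) (τ m.succ), |deriv p t| ≤ C * t ∧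
      ∃ e, |e| ≤ C ∧ HasDerivAt (deriv p) e t := by
    intro m
    obtain ⟨q, _, hq⟩ := hp.2.1 m
    have h0 := hτ.mem_Icc m.castSucc
    have h1 := hτ.mem_Icc m.succ
    have hlt : τ m.castSucc < τ m.succ := hτ.1 (Fin.castSucc_lt_succ)
    have hd : ∀ t ∈ Ioo (τ m.castSucc) (τ m.succ), deriv p t = q.derivative.eval t := by
      intro t ht
      have : p =ᶠ[𝓝 t] fun y => q.eval y :=
        hq.eventuallyEq_of_mem (Icc_mem_nhds ht.1 ht.2)
      rw [this.deriv_eq, q.deriv]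
    have hd2 : ∀ t ∈ Ioo (τ m.castSucc) (τ m.succ),
        HasDerivAt (deriv p) (q.derivative.derivative.eval t) t := by
      intro t ht
      refine (q.derivative.hasDerivAt t).congr_of_eventuallyEq ?_
      filter_upwards [isOpen_Ioo.mem_nhds ht] with y hy
      exact hd y hy
    obtain ⟨B, hB0, hB⟩ := exists_bound_polynomial q.derivative.derivative Y
    have hC : ∃ C, 0 ≤ C ∧ ∀ t ∈ Ioo (τ m.castSucc) (τ m.succ), |q.derivative.eval t| ≤ C * t := by
      -- On the cell touching `0`, the condition `p'(0) = 0` makes `q'` divisible by `X`, which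
      -- gives the linear bound. On the other cells `t` is bounded below by the left node.
      rcases h0.1.eq_or_lt with hz | hpos
      · have hzero : q.derivative.eval 0 = 0 := by
          have u1 : HasDerivWithinAt p 0 (Icc 0 (τ m.succ)) 0 := by
            have := femS_hasDerivWithinAt hp ⟨le_rfl, hY.le⟩
            rw [hp.2.2.2.1] at this
            exact this.mono (Icc_subset_Icc_right h1.2)
          have u2 : HasDerivWithinAt p (q.derivative.eval 0) (Icc 0 (τ m.succ)) 0 := by
            rw [← hz] at hq hlt
            exact (q.hasDerivAt 0).hasDerivWithinAt.congr hq (hq ⟨le_rfl, hlt.le⟩)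
          rw [← hz] at hlt
          exact (uniqueDiffOn_Icc hlt 0 ⟨le_rfl, hlt.le⟩).eq_deriv _ u2 u1
        obtain ⟨r, hr⟩ := (Polynomial.X_dvd_iff (f := q.derivative)).2 (by
          rw [Polynomial.coeff_zero_eq_eval_zero]; exact hzero)
        obtain ⟨C, hC0, hC⟩ := exists_bound_polynomial r Y
        refine ⟨C, hC0, fun t ht => ?_⟩
        have ht0 : 0 ≤ t := h0.1.trans ht.1.le
        rw [hr, Polynomial.eval_mul, Polynomial.eval_X, abs_mul, abs_of_nonneg ht0, mul_comm]
        exact mul_le_mul_of_nonneg_right (hC t ⟨ht0, ht.2.le.trans h1.2⟩) ht0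
      · obtain ⟨C, hC0, hC⟩ := exists_bound_polynomial q.derivative Y
        refine ⟨C / τ m.castSucc, by positivity, fun t ht => ?_⟩
        refine (hC t ⟨hpos.le.trans ht.1.le, ht.2.le.trans h1.2⟩).trans ?_
        rw [div_mul_eq_mul_div, le_div_iff₀ hpos]
        exact mul_le_mul_of_nonneg_left ht.1.le hC0
    obtain ⟨C, hC0, hC⟩ := hC
    refine ⟨max C B, hC0.trans (le_max_left _ _), fun t ht => ⟨?_, _, ?_, hd2 t ht⟩⟩
    · rw [hd t ht]
      refine (hC t ht).trans (mul_le_mul_of_nonneg_right (le_max_left _ _) (h0.1.trans ht.1.le))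
    · exact (hB t ⟨h0.1.trans ht.1.le, ht.2.le.trans h1.2⟩).trans (le_max_right _ _)
  choose C hC0 hC using hm
  refine ⟨∑ m, C m, Finset.sum_nonneg fun m _ => hC0 m, fun t ht htN => ?_⟩
  obtain ⟨m, hm⟩ := hτ.exists_mem_Icc hY (Ioo_subset_Icc_self ht)
  have hm' : t ∈ Ioo (τ m.castSucc) (τ m.succ) :=
    ⟨lt_of_le_of_ne hm.1 fun h => htN ⟨_, h⟩, lt_of_le_of_ne hm.2 fun h => htN ⟨_, h.symm⟩⟩
  have hle : C m ≤ ∑ m, C m := Finset.single_le_sum (fun m _ => hC0 m) (Finset.mem_univ m)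
  obtain ⟨h1, e, he, hd⟩ := hC m t hm'
  exact ⟨h1.trans (mul_le_mul_of_nonneg_right hle ht.1.le), e, he.trans hle, hd⟩

theorem femS_tendsto_deriv {M : ℕ} {Y : ℝ} (hY : 0 < Y) {τ : Fin (M + 1) → ℝ} {p : ℝ → ℝ}
    (hp : p ∈ femS Y τ) : Tendsto (deriv p) (𝓝[Ioo 0 Y] Y) (𝓝 0) := by
  have h := (femS_continuousOn_deriv hY hp Y ⟨hY.le, le_rfl⟩).tendsto
  rw [hp.2.2.2.2] at h
  refine (h.mono_left (nhdsWithin_mono _ Ioo_subset_Icc_self)).congr' ?_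
  filter_upwards [self_mem_nhdsWithin] with t ht
  exact (femS_hasDerivAt hp ht).deriv.symm

/-- Since `|p'(t)| ≤ C t`, the derivative `b t^(b-1) p' + t^b p''` of the flux is `O(t^b)`, which is
square integrable with weight `t^(-b)` because `b > -1`. The flux itself is `O(t^(b+1))` and
vanishes at `0`. -/
theorem memH2N_of_mem_femS {b : ℝ} (hb : b ∈ Ioo (-1 : ℝ) 1) {M : ℕ} {Y : ℝ} (hY : 0 < Y)
    {τ : Fin (M + 1) → ℝ} (hτ : IsPartition Y τ) {p : ℝ → ℝ} (hp : p ∈ femS Y τ) :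
    MemH2N b Y p := by
  have hfin : IsFiniteMeasure (wMeasure b Y) := isFiniteMeasure_wMeasure hb.1 Y
  have hcont := hp.1.continuousOn
  have hcd := femS_continuousOn_deriv hY hp
  have hmem : ∀ f : ℝ → ℝ, ContinuousOn f (Icc 0 Y) → MemLp f 2 (wMeasure b Y) := by
    intro f hf
    obtain ⟨B, hB⟩ := isCompact_Icc.exists_bound_of_continuousOn hf
    refine MemLp.of_bound (aestronglyMeasurable_wMeasure_iff.2
      ((hf.mono Ioo_subset_Icc_self).aestronglyMeasurable measurableSet_Ioo)) B ?_
    filter_upwards [ae_mem_Ioo b Y] with y hy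
    exact hB y (Ioo_subset_Icc_self hy)
  have hderiv : ∀ t ∈ Ioo 0 Y, deriv p t = derivWithin p (Icc 0 Y) t := fun t ht =>
    (femS_hasDerivAt hp ht).deriv
  have hcdo : ContinuousOn (deriv p) (Ioo 0 Y) :=
    (hcd.mono Ioo_subset_Icc_self).congr hderiv
  obtain ⟨C, hC0, hC⟩ := femS_exists_bound hY hτ hp
  set q : ℝ → ℝ := fun t => t ^ b * deriv p t with hq
  have hqd : ∀ t ∈ Ioo 0 Y, t ∉ range τ → HasDerivAt q (deriv q t) t ∧
      |deriv q t| ≤ 2 * C * t ^ b := by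
    intro t ht htN
    obtain ⟨h1, e, he, hd⟩ := hC t ht htN
    have h2 := (Real.hasDerivAt_rpow_const (x := t) (p := b) (Or.inl ht.1.ne')).mul hd
    have h3 : deriv q t = b * t ^ (b - 1) * deriv p t + t ^ b * e := h2.deriv
    refine ⟨h3 ▸ h2, ?_⟩
    rw [h3]
    have hp0 : 0 < t ^ (b - 1) := Real.rpow_pos_of_pos ht.1 _
    have hp1 : t ^ b = t ^ (b - 1) * t := by
      rw [← Real.rpow_add_one ht.1.ne', sub_add_cancel]
    have hb1 : |b| ≤ 1 := abs_le.2 ⟨hb.1.le, hb.2.le⟩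
    calc |b * t ^ (b - 1) * deriv p t + t ^ b * e|
        ≤ |b| * t ^ (b - 1) * |deriv p t| + t ^ b * |e| := by
          refine (abs_add_le _ _).trans ?_
          rw [abs_mul, abs_mul, abs_mul, abs_of_pos hp0,
            abs_of_pos (Real.rpow_pos_of_pos ht.1 _)]
      _ ≤ 1 * t ^ (b - 1) * (C * t) + t ^ b * C := by
          have := Real.rpow_nonneg ht.1.le b
          gcongr
      _ = 2 * C * t ^ b := by rw [hp1]; ring
  have hcount : (range τ).Countable := (finite_range τ).countable
  have hae : ∀ᵐ t ∂(wMeasure (-b) Y), ‖deriv q t‖ ≤ ‖t ^ b • (2 * C)‖ := by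
    refine ae_wMeasure_of_ae ?_
    filter_upwards [hcount.ae_notMem volume] with t htN ht
    rw [smul_eq_mul, mul_comm, Real.norm_of_nonneg
      (mul_nonneg (by positivity) (Real.rpow_nonneg ht.1.le b))]
    exact (hqd t ht htN).2
  have hg : MemLp (deriv q) 2 (wMeasure (-b) Y) := by
    have h1 : MemLp (fun t : ℝ => t ^ b • (2 * C)) 2 (wMeasure (-b) Y) := by
      have := memLp_rpow_smul (b := -b) (Y := Y) (g := fun _ : ℝ => 2 * C) (by
        rw [neg_neg]; exact memLp_const _)
      simpa only [neg_neg] using this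
    exact h1.of_le (measurable_deriv q).aestronglyMeasurable hae
  refine ⟨hcont, fun t ht => (femS_hasDerivAt hp ht).differentiableAt, hmem p hcont, ?_, ?_, ?_⟩
  · refine (memLp_congr_ae ?_).2 (hmem _ hcd)
    filter_upwards [ae_mem_Ioo b Y] with t ht
    exact hderiv t ht
  · refine ⟨deriv q, hg, fun a ha c hc => ?_⟩
    have hsub : uIcc a c ⊆ Ioo 0 Y := by
      rw [uIcc]
      exact Icc_subset_Ioo (lt_min ha.1 hc.1) (max_lt ha.2 hc.2)
    have hint : IntervalIntegrable (deriv q) volume a c :=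
      intervalIntegrable_iff.2 ((integrableOn_of_memLp (by linarith [hb.1]) hg).mono_set
        (uIoc_subset_uIcc.trans hsub))
    refine ⟨hint, ?_⟩
    symm
    -- Across a node `p'` is only continuous, so the flux may fail to be differentiable there;
    -- finitely many exceptional points are harmless.
    refine integral_eq_of_hasDerivAt_off_countable q (deriv q) hcount ?_ ?_ hint
    · refine ContinuousOn.mul ?_ (hcdo.mono hsub)
      exact fun t ht => (Real.continuousAt_rpow_const t b
        (Or.inl (hsub ht).1.ne')).continuousWithinAt
    · intro t ht
      refine (hqd t (hsub (Ioo_subset_Icc_self ht.1)) ht.2).1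
  · obtain ⟨B, hB⟩ := isCompact_Icc.exists_bound_of_continuousOn hcd
    have hlim : Tendsto (fun t : ℝ => C * t ^ (b + 1)) (𝓝[Ioo 0 Y] 0) (𝓝 0) := by
      have h1 : ContinuousAt (fun t : ℝ => C * t ^ (b + 1)) 0 :=
        continuousAt_const.mul (Real.continuousAt_rpow_const 0 (b + 1) (Or.inr (by linarith [hb.1])))
      have h2 := h1.tendsto
      rw [Real.zero_rpow (by linarith [hb.1]), mul_zero] at h2
      exact h2.mono_left nhdsWithin_le_nhds
    have hev : ∀ᶠ t in 𝓝[Ioo 0 Y] (0 : ℝ), t ∉ range τ := by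
      have hfin : ((range τ) \ {0}).Finite := (finite_range τ).subset sdiff_subset
      have h1 : ((range τ) \ {0})ᶜ ∈ 𝓝 (0 : ℝ) :=
        hfin.isClosed.isOpen_compl.mem_nhds (by simp)
      filter_upwards [mem_nhdsWithin_of_mem_nhds h1, self_mem_nhdsWithin] with t h2 ht h3
      exact h2 ⟨h3, ht.1.ne'⟩
    refine squeeze_zero_norm' ?_ hlim
    filter_upwards [hev, self_mem_nhdsWithin] with t htN ht
    rw [smul_eq_mul, norm_mul, Real.norm_of_nonneg (Real.rpow_nonneg ht.1.le b),
      Real.rpow_add_one ht.1.ne']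
    calc t ^ b * ‖deriv p t‖ ≤ t ^ b * (C * t) := by
          have := Real.rpow_nonneg ht.1.le b
          have := (hC t ht htN).1
          rw [Real.norm_eq_abs]
          gcongr
      _ = _ := by ring

end PolyExt

end

noncomputable section

namespace PolyExt

/-! ### The trace inequality for scalar functions -/

section trace

variable {b Y : ℝ}

theorem integral_wMeasure (b Y : ℝ) (f : ℝ → ℝ) :
    ∫ y, f y ∂(wMeasure b Y) = ∫ y in Ioo 0 Y, y ^ b * f y := by
  rw [wMeasure, integral_withDensity_eq_integral_toReal_smul (measurable_weight b)
    (ae_of_all _ fun _ => ENNReal.ofReal_lt_top)]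
  refine setIntegral_congr_fun measurableSet_Ioo fun y hy => ?_
  simp only [smul_eq_mul]
  rw [ENNReal.toReal_ofReal (Real.rpow_nonneg hy.1.le b)]

theorem restrict_wMeasure {δ : ℝ} (h : δ ≤ Y) :
    (wMeasure b Y).restrict (Ioo 0 δ) = wMeasure b δ := by
  rw [wMeasure, restrict_withDensity measurableSet_Ioo, Measure.restrict_restrict measurableSet_Ioo,
    inter_eq_self_of_subset_left (Ioo_subset_Ioo_right h), wMeasure]

theorem integral_one_wMeasure (hb : -1 < b) (hY : 0 ≤ Y) :
    ∫ _, (1 : ℝ) ∂(wMeasure b Y) = Y ^ (b + 1) / (b + 1) := by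
  rw [integral_wMeasure b Y fun _ => 1]
  simp only [mul_one]
  rw [← integral_Ioc_eq_integral_Ioo, ← intervalIntegral.integral_of_le hY,
    integral_rpow (Or.inl hb), Real.zero_rpow (by linarith), sub_zero]

variable {w : ℝ → ℝ}

theorem MemH2N.intervalIntegrable_deriv (hb : b < 1) (hY : 0 < Y) (hw : MemH2N b Y w) :
    IntervalIntegrable (deriv w) volume 0 Y :=
  (intervalIntegrable_iff_integrableOn_Ioo_of_le hY.le).2 (integrableOn_of_memLp hb hw.memLp_deriv)

theorem MemH2N.integral_deriv_eq_sub (hb : b < 1) (hw : MemH2N b Y w) {y : ℝ} (hy : y ∈ Icc 0 Y) :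
    ∫ t in (0)..y, deriv w t = w y - w 0 := by
  refine intervalIntegral.integral_eq_sub_of_hasDerivAt_of_le hy.1
    (hw.cont.mono (Icc_subset_Icc_right hy.2))
    (fun t ht => (hw.diff t ⟨ht.1, ht.2.trans_le hy.2⟩).hasDerivAt) ?_
  rw [intervalIntegrable_iff_integrableOn_Ioo_of_le hy.1]
  exact (integrableOn_of_memLp hb hw.memLp_deriv).mono_set (Ioo_subset_Ioo_right hy.2)

/-- Integration by parts in the extended variable. -/
theorem MemH2N.integral_opD_mul (hb : b ∈ Ioo (-1 : ℝ) 1) (hY : 0 < Y) (hw : MemH2N b Y w)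
    (hwY : w Y = 0) :
    ∫ y, opD b w y * w y ∂(wMeasure b Y) = ∫ y, deriv w y ^ 2 ∂(wMeasure b Y) := by
  obtain ⟨g, hg, hgi, hQ, hae⟩ := hw.exists_flux hb
  have hii : IntervalIntegrable g volume 0 Y :=
    (intervalIntegrable_iff_integrableOn_Ioo_of_le hY.le).2 hgi
  have hi' := hw.intervalIntegrable_deriv hb.2 hY
  -- The flux and `w` are replaced by primitives of integrable functions, for which the product
  -- formula holds. The boundary terms vanish because the flux is zero at `0` and `w` is zero at
  -- `Y`.
  have hQac := hii.absolutelyContinuousOnInterval_intervalIntegral (c := 0) left_mem_uIcc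
  have hFac := (hi'.absolutelyContinuousOnInterval_intervalIntegral (c := 0) left_mem_uIcc).fun_add
    (LipschitzOnWith.absolutelyContinuousOnInterval
      ((LipschitzWith.const (w 0)).lipschitzOnWith (s := uIcc 0 Y)))
  have hQ' : ∀ y ∈ Ioo 0 Y, ∫ t in (0)..y, g t = y ^ b • deriv w y := fun y hy => (hQ y hy).symm
  have hF : ∀ y ∈ Icc 0 Y, (∫ t in (0)..y, deriv w t) + w 0 = w y := fun y hy => by
    rw [hw.integral_deriv_eq_sub hb.2 hy, sub_add_cancel]
  have key := hQac.integral_deriv_mul_eq_sub hFac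
  rw [hF Y ⟨hY.le, le_rfl⟩, hwY, intervalIntegral.integral_same, mul_zero, zero_mul, sub_zero,
    intervalIntegral.integral_of_le hY.le, integral_Ioc_eq_integral_Ioo] at key
  have hi1 : Integrable (fun y => opD b w y * w y) (wMeasure b Y) :=
    (hw.memLp_opD hb).integrable_mul hw.memLp
  have hi2 : Integrable (fun y => deriv w y ^ 2) (wMeasure b Y) := hw.memLp_deriv.integrable_sq
  rw [← sub_eq_zero, ← integral_sub hi1 hi2, integral_wMeasure, ← neg_eq_zero, ← integral_neg]
  refine (integral_congr_ae ?_).trans key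
  filter_upwards [(restrict_ac_wMeasure b Y).ae_le hae, ae_restrict_mem measurableSet_Ioo]
    with y hy hyI
  have hp : 0 < y ^ b := Real.rpow_pos_of_pos hyI.1 b
  have d1 : deriv (fun y => ∫ t in (0)..y, g t) y = g y := by
    refine (hy.1.congr_of_eventuallyEq ?_).deriv
    filter_upwards [isOpen_Ioo.mem_nhds hyI] with t ht
    exact hQ' t ht
  have d2 : deriv (fun y => (∫ t in (0)..y, deriv w t) + w 0) y = deriv w y :=
    deriv_eq_of_eqOn_Ioo (v := w) (fun t ht => hF t (Ioo_subset_Icc_self ht)) hyI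
  rw [d1, d2, hF y (Ioo_subset_Icc_self hyI), ← hQ y hyI, hy.2, Real.rpow_neg hyI.1.le,
    smul_eq_mul, smul_eq_mul]
  field_simp
  ring

/-- The cross term of the square becomes `2c ∫ y^b w'²` by the integration by parts. For `c > 0`
every term is non-negative, so each is bounded by the energy. -/
theorem MemH2N.energy_identity (hb : b ∈ Ioo (-1 : ℝ) 1) (hY : 0 < Y) (hw : MemH2N b Y w)
    (hwY : w Y = 0) (c : ℝ) :
    ∫ y, (opD b w y + c * w y) ^ 2 ∂(wMeasure b Y) =
      (∫ y, opD b w y ^ 2 ∂(wMeasure b Y)) + 2 * c * (∫ y, deriv w y ^ 2 ∂(wMeasure b Y))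
        + c ^ 2 * ∫ y, w y ^ 2 ∂(wMeasure b Y) := by
  have hi1 : Integrable (fun y => opD b w y * w y) (wMeasure b Y) :=
    (hw.memLp_opD hb).integrable_mul hw.memLp
  have hi2 : Integrable (fun y => opD b w y ^ 2) (wMeasure b Y) := (hw.memLp_opD hb).integrable_sq
  have hi3 : Integrable (fun y => w y ^ 2) (wMeasure b Y) := hw.memLp.integrable_sq
  have hi4 : Integrable (fun y => opD b w y ^ 2 + 2 * c * (opD b w y * w y)) (wMeasure b Y) :=
    hi2.add (hi1.const_mul _)
  rw [← hw.integral_opD_mul hb hY hwY, ← integral_const_mul, ← integral_const_mul,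
    ← integral_add hi2 (hi1.const_mul _), ← integral_add hi4 (hi3.const_mul _)]
  refine integral_congr_ae (ae_of_all _ fun y => ?_)
  ring

/-- The modulus of continuity at `0`. -/
theorem MemH2N.sq_sub_le (hb : b ∈ Ioo (-1 : ℝ) 1) (hw : MemH2N b Y w) {y δ : ℝ}
    (hy : y ∈ Icc 0 Y) (hy0 : 0 < y) (hδ : y ≤ δ) :
    (w y - w 0) ^ 2 ≤ δ ^ (1 - b) / (1 - b) * ∫ t, deriv w t ^ 2 ∂(wMeasure b Y) := by
  have hb1 : 0 < 1 - b := by linarith [hb.2]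
  have hδ0 : 0 < δ := hy0.trans_le hδ
  set E := ∫ t, deriv w t ^ 2 ∂(wMeasure b Y) with hE
  have hE0 : 0 ≤ E := integral_nonneg fun t => sq_nonneg _
  set P := δ ^ (1 - b) / (1 - b) with hP
  have hP0 : 0 < P := div_pos (Real.rpow_pos_of_pos hδ0 _) hb1
  have hi2 : Integrable (fun y => deriv w y ^ 2) (wMeasure b Y) := hw.memLp_deriv.integrable_sq
  rcases eq_or_ne (w y - w 0) 0 with h0 | h0
  · rw [h0, sq, mul_zero]
    positivity
  have hint : IntegrableOn (deriv w) (Ioo 0 y) :=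
    (integrableOn_of_memLp hb.2 hw.memLp_deriv).mono_set (Ioo_subset_Ioo_right hy.2)
  have hEy : ∫ t in Ioo 0 y, t ^ b * deriv w t ^ 2 ≤ E := by
    rw [← integral_wMeasure b y fun t => deriv w t ^ 2, ← restrict_wMeasure hy.2]
    exact setIntegral_le_integral hi2 (ae_of_all _ fun t => sq_nonneg _)
  have hPy : ∫ t in Ioo 0 y, t ^ (-b) ≤ P := by
    rw [← integral_Ioc_eq_integral_Ioo, ← intervalIntegral.integral_of_le hy0.le,
      integral_rpow (Or.inl (by linarith)), Real.zero_rpow (by linarith), sub_zero, hP,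
      neg_add_eq_sub]
    gcongr
  have hiE : IntegrableOn (fun t => t ^ b * deriv w t ^ 2) (Ioo 0 y) := by
    have h1 : IntegrableOn (fun t => deriv w t ^ 2) (Ioo 0 y) (wMeasure b Y) := hi2.integrableOn
    rw [IntegrableOn, restrict_wMeasure hy.2, wMeasure,
      integrable_withDensity_iff_integrable_smul' (measurable_weight b)
        (ae_of_all _ fun _ => ENNReal.ofReal_lt_top)] at h1
    refine IntegrableOn.congr_fun h1 (fun t ht => ?_) measurableSet_Ioo
    simp only [smul_eq_mul]
    rw [ENNReal.toReal_ofReal (Real.rpow_nonneg ht.1.le b)]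
  have hiP : IntegrableOn (fun t : ℝ => t ^ (-b)) (Ioo 0 y) :=
    (intervalIntegrable_iff_integrableOn_Ioo_of_le hy0.le).1
      (intervalIntegral.intervalIntegrable_rpow' (by linarith))
  set A := |w y - w 0| with hA
  have hA0 : 0 < A := abs_pos.2 h0
  -- Young's inequality with the weights that reproduce Cauchy–Schwarz: the bound reads `A ≤ A/2 +
  -- PE/(2A)`, that is, `A² ≤ PE`.
  have hkey : A ≤ A / (2 * P) * P + P / (2 * A) * E := by
    calc A = |∫ t in Ioo 0 y, deriv w t| := by
          rw [hA, ← hw.integral_deriv_eq_sub hb.2 hy, intervalIntegral.integral_of_le hy0.le,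
            integral_Ioc_eq_integral_Ioo]
      _ ≤ ∫ t in Ioo 0 y, |deriv w t| := abs_integral_le_integral_abs
      _ ≤ ∫ t in Ioo 0 y, (A / (2 * P) * t ^ (-b) + P / (2 * A) * (t ^ b * deriv w t ^ 2)) := by
          refine setIntegral_mono_on hint.abs ((hiP.const_mul _).add (hiE.const_mul _))
            measurableSet_Ioo fun t ht => ?_
          have hp : 0 < t ^ b := Real.rpow_pos_of_pos ht.1 b
          rw [Real.rpow_neg ht.1.le, ← sq_abs (deriv w t)]
          set a := t ^ b
          set x := |deriv w t|
          have e : A / (2 * P) * a⁻¹ + P / (2 * A) * (a * x ^ 2) - x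
              = (A - P * a * x) ^ 2 / (2 * P * A * a) := by
            field_simp
            ring
          have : 0 ≤ (A - P * a * x) ^ 2 / (2 * P * A * a) := by positivity
          linarith
      _ = A / (2 * P) * (∫ t in Ioo 0 y, t ^ (-b))
            + P / (2 * A) * ∫ t in Ioo 0 y, t ^ b * deriv w t ^ 2 := by
          rw [integral_add (hiP.const_mul _) (hiE.const_mul _), integral_const_mul,
            integral_const_mul]
      _ ≤ _ := by gcongr
  rw [← sq_abs]
  have e1 : A / (2 * P) * P = A / 2 := by field_simp
  have e2 : P / (2 * A) * E = P * E / (2 * A) := by ring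
  rw [e1, e2] at hkey
  have h3 : A / 2 ≤ P * E / (2 * A) := by linarith
  rw [le_div_iff₀ (by positivity)] at h3
  nlinarith

theorem bPar_mem_Ioo {s : ℝ} (hs : s ∈ Ioo (1 : ℝ) 2) : bPar s ∈ Ioo (-1 : ℝ) 1 := by
  rw [bPar]
  exact ⟨by linarith [hs.2], by linarith [hs.1]⟩

/-- The constant of the trace inequality. -/
def traceConst (b : ℝ) : ℝ := 2 * (1 + b) + 1 / (1 - b)

/-- The trace inequality for one mode. -/
theorem MemH2N.trace_le {s : ℝ} (hs : s ∈ Ioo (1 : ℝ) 2) (hY : 0 < Y)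
    (hw : MemH2N (bPar s) Y w) (hwY : w Y = 0) {c : ℝ} (hc : 0 < c) :
    c ^ s * w 0 ^ 2 ≤ traceConst (bPar s) *
      ∫ y, (opD (bPar s) w y + c * w y) ^ 2 ∂(wMeasure (bPar s) Y) := by
  have hb := bPar_mem_Ioo hs
  set b := bPar s with hbs
  have hb1 : 0 < 1 - b := by linarith [hb.2]
  have hb2 : 0 < 1 + b := by linarith [hb.1]
  have hen := hw.energy_identity hb hY hwY c
  set E := ∫ y, (opD b w y + c * w y) ^ 2 ∂(wMeasure b Y)
  set E1 := ∫ y, deriv w y ^ 2 ∂(wMeasure b Y) with hE1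
  set E0 := ∫ y, w y ^ 2 ∂(wMeasure b Y) with hE0
  have hD : 0 ≤ ∫ y, opD b w y ^ 2 ∂(wMeasure b Y) := integral_nonneg fun t => sq_nonneg _
  have h1 : 0 ≤ E1 := integral_nonneg fun t => sq_nonneg _
  have h0 : 0 ≤ E0 := integral_nonneg fun t => sq_nonneg _
  -- The natural length of `𝒟_b + c`. As `b = 3 - 2s`, it satisfies `c^s δ^(1-b) = c` and `c²
  -- δ^(1+b) = c^s`, so the contributions of `w'` and of `w` scale exactly as the terms of the
  -- energy.
  set δ : ℝ := c ^ (-(1 / 2) : ℝ) with hδ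
  have hδ0 : 0 < δ := Real.rpow_pos_of_pos hc _
  have hδ1 : c ^ s * δ ^ (1 - b) = c := by
    rw [hδ, ← Real.rpow_mul hc.le, ← Real.rpow_add hc]
    convert Real.rpow_one c using 2
    rw [hbs, bPar]
    ring
  have hδ2 : c ^ 2 * δ ^ (b + 1) = c ^ s := by
    rw [hδ, ← Real.rpow_mul hc.le, ← Real.rpow_natCast, ← Real.rpow_add hc]
    congr 1
    rw [hbs, bPar]
    push_cast
    ring
  have hcs : 0 < c ^ s := Real.rpow_pos_of_pos hc s
  have hle1 : 2 * c * E1 ≤ E := by nlinarith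
  have hle0 : c ^ 2 * E0 + 2 * c * E1 ≤ E := by linarith
  have hEE : 0 ≤ E := (mul_nonneg (by positivity) h1).trans hle1
  suffices h : c ^ s * w 0 ^ 2 ≤ 2 * (1 + b) * (c ^ 2 * E0) + 2 / (1 - b) * (c * E1) by
    refine h.trans ?_
    rw [traceConst, add_mul]
    have e : 2 / (1 - b) * (c * E1) = 1 / (1 - b) * (2 * c * E1) := by ring
    rw [e]
    have h00 : c ^ 2 * E0 ≤ E := by nlinarith
    gcongr
  have hP1 : c ^ s * (δ ^ (1 - b) / (1 - b) * E1) = 1 / (1 - b) * (c * E1) := by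
    rw [← mul_assoc, mul_div_assoc', hδ1]
    ring
  -- If the cylinder is shorter than `δ`, then `w(0)` is compared with `w(Y) = 0`. Otherwise `w(0)²
  -- ≤ 2w(y)² + 2P` is averaged over `(0,δ)`. This keeps the constant independent of `Y`.
  rcases le_or_gt Y δ with hYδ | hYδ
  · have h2 := hw.sq_sub_le hb (y := Y) ⟨hY.le, le_rfl⟩ hY hYδ
    rw [hwY, zero_sub, neg_sq] at h2
    have h3 := mul_le_mul_of_nonneg_left h2 hcs.le
    rw [hP1] at h3
    have : 0 ≤ 1 / (1 - b) * (c * E1) := by positivity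
    have e : 2 / (1 - b) * (c * E1) = 2 * (1 / (1 - b) * (c * E1)) := by ring
    have : 0 ≤ 2 * (1 + b) * (c ^ 2 * E0) := by positivity
    linarith
  · set P := δ ^ (1 - b) / (1 - b) * E1 with hP
    have hfin : IsFiniteMeasure (wMeasure b δ) := isFiniteMeasure_wMeasure hb.1 δ
    have hisq : Integrable (fun y => w y ^ 2) (wMeasure b Y) := hw.memLp.integrable_sq
    have hi : Integrable (fun y => w y ^ 2) (wMeasure b δ) := by
      rw [← restrict_wMeasure hYδ.le]
      exact hisq.integrableOn
    have h2 : ∫ _, w 0 ^ 2 * 1 ∂(wMeasure b δ) ≤ ∫ y, (2 * w y ^ 2 + 2 * P * 1) ∂(wMeasure b δ) := by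
      refine integral_mono_ae (integrable_const _) ((hi.const_mul _).add (integrable_const _)) ?_
      filter_upwards [ae_mem_Ioo b δ] with y hy
      have := hw.sq_sub_le hb (y := y) ⟨hy.1.le, hy.2.le.trans hYδ.le⟩ hy.1 hy.2.le
      change w 0 ^ 2 * 1 ≤ 2 * w y ^ 2 + 2 * P * 1
      nlinarith [sq_nonneg (2 * w y - w 0)]
    rw [integral_add (hi.const_mul _) (integrable_const _), integral_const_mul, integral_const_mul,
      integral_const_mul, integral_one_wMeasure hb.1 hδ0.le] at h2
    have h3 : ∫ y, w y ^ 2 ∂(wMeasure b δ) ≤ E0 := by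
      rw [← restrict_wMeasure hYδ.le]
      exact setIntegral_le_integral hisq (ae_of_all _ fun t => sq_nonneg _)
    set m := δ ^ (b + 1) with hm
    have hm0 : 0 < m := Real.rpow_pos_of_pos hδ0 _
    have h4 : w 0 ^ 2 * (m / (b + 1)) ≤ 2 * E0 + 2 * P * (m / (b + 1)) := by linarith
    have h5 : w 0 ^ 2 * m ≤ 2 * (1 + b) * E0 + 2 * P * m := by
      have hb3 : 0 < b + 1 := by linarith
      have := mul_le_mul_of_nonneg_right h4 hb3.le
      have e1 : w 0 ^ 2 * (m / (b + 1)) * (b + 1) = w 0 ^ 2 * m := by field_simp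
      have e2 : (2 * E0 + 2 * P * (m / (b + 1))) * (b + 1) = 2 * (1 + b) * E0 + 2 * P * m := by
        field_simp
        ring
      rwa [e1, e2] at this
    have h6 := mul_le_mul_of_nonneg_left h5 (sq_nonneg c)
    have e3 : c ^ 2 * (w 0 ^ 2 * m) = c ^ s * w 0 ^ 2 := by rw [← hδ2]; ring
    have e4 : c ^ 2 * (2 * (1 + b) * E0 + 2 * P * m)
        = 2 * (1 + b) * (c ^ 2 * E0) + 2 * (c ^ s * P) := by rw [← hδ2]; ring
    rw [e3, e4, hP1] at h6
    refine h6.trans (le_of_eq ?_)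
    ring

end trace

end PolyExt

end

noncomputable section

namespace PolyExt

variable {d : ℕ} {Ω : Set (Space d)} {b Y : ℝ}

/-! ### The energy space -/

section energy

variable {w v : ℝ → L2 Ω}

theorem MemHtwoLY.add (hΩ : IsOpen Ω) (hw : MemHtwoLY Ω b Y w) (hv : MemHtwoLY Ω b Y v) :
    MemHtwoLY Ω b Y (w + v) := by
  have hd : ∀ y ∈ Ioo 0 Y, deriv (w + v) y = deriv w y + deriv v y := fun y hy =>
    deriv_add (hw.memH2N.diff y hy) (hv.memH2N.diff y hy)
  refine ⟨hw.memH2N.add hv.memH2N, ?_, fun i => ?_, fun i j => ?_, ?_, fun i => ?_, ?_, ?_⟩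
  · filter_upwards [hw.lateral, hv.lateral] with y h1 h2
    exact h1.add h2
  · refine (memLp_congr_ae ?_).2 ((hw.grad i).add (hv.grad i))
    filter_upwards [hw.lateral, hv.lateral] with y h1 h2
    exact h1.weakD_add hΩ h2 i
  · refine (memLp_congr_ae ?_).2 ((hw.hess i j).add (hv.hess i j))
    filter_upwards [hw.lateral, hv.lateral] with y h1 h2
    exact h1.weakD₂_add hΩ h2 i j
  · filter_upwards [hw.mixed_exists, hv.mixed_exists, ae_mem_Ioo b Y] with y h1 h2 hy i
    obtain ⟨g, hg⟩ := h1 i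
    obtain ⟨k, hk⟩ := h2 i
    rw [hd y hy]
    exact ⟨_, hg.add hk⟩
  · refine (memLp_congr_ae ?_).2 ((hw.mixed i).add (hv.mixed i))
    filter_upwards [hw.mixed_exists, hv.mixed_exists, ae_mem_Ioo b Y] with y h1 h2 hy
    obtain ⟨g, hg⟩ := h1 i
    obtain ⟨k, hk⟩ := h2 i
    rw [hd y hy, (hg.add hk).weakD_eq hΩ, Pi.add_apply, hg.weakD_eq hΩ, hk.weakD_eq hΩ]
  · rw [Pi.add_apply, hw.top, hv.top, add_zero]
  · have h := hw.top_deriv.add hv.top_deriv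
    rw [add_zero] at h
    refine h.congr' ?_
    filter_upwards [self_mem_nhdsWithin] with y hy
    exact (hd y hy).symm

theorem MemHtwoLY.smul (hΩ : IsOpen Ω) (c : ℝ) (hw : MemHtwoLY Ω b Y w) :
    MemHtwoLY Ω b Y (c • w) := by
  have hd : ∀ y, deriv (c • w) y = c • deriv w y := fun y => deriv_const_smul_field c w
  refine ⟨hw.memH2N.smul c, ?_, fun i => ?_, fun i j => ?_, ?_, fun i => ?_, ?_, ?_⟩
  · filter_upwards [hw.lateral] with y h1
    exact h1.smul c
  · refine (memLp_congr_ae ?_).2 ((hw.grad i).const_smul c)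
    filter_upwards [hw.lateral] with y h1
    exact h1.weakD_smul hΩ c i
  · refine (memLp_congr_ae ?_).2 ((hw.hess i j).const_smul c)
    filter_upwards [hw.lateral] with y h1
    exact h1.weakD₂_smul hΩ c i j
  · filter_upwards [hw.mixed_exists] with y h1 i
    obtain ⟨g, hg⟩ := h1 i
    rw [hd y]
    exact ⟨_, hg.smul c⟩
  · refine (memLp_congr_ae ?_).2 ((hw.mixed i).const_smul c)
    filter_upwards [hw.mixed_exists] with y h1
    obtain ⟨g, hg⟩ := h1 i
    rw [hd y, (hg.smul c).weakD_eq hΩ, Pi.smul_apply, hg.weakD_eq hΩ]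
  · rw [Pi.smul_apply, hw.top, smul_zero]
  · have h := hw.top_deriv.const_smul c
    rw [smul_zero] at h
    exact h.congr fun y => (hd y).symm

theorem MemHtwoLY.sub (hΩ : IsOpen Ω) (hw : MemHtwoLY Ω b Y w) (hv : MemHtwoLY Ω b Y v) :
    MemHtwoLY Ω b Y (w - v) := by
  have := hw.add hΩ (hv.smul hΩ (-1))
  rwa [neg_one_smul, ← sub_eq_add_neg] at this

/-- The functions `p(y) a(x)`. -/
theorem memHtwoLY_smul_const (hΩ : IsOpen Ω) {p : ℝ → ℝ} (hp : MemH2N b Y p) (hpY : p Y = 0)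
    (hpY' : Tendsto (deriv p) (𝓝[Ioo 0 Y] Y) (𝓝 0)) {a : L2 Ω} (ha : MemH20 Ω a) :
    MemHtwoLY Ω b Y (fun y => p y • a) := by
  have hd : ∀ y ∈ Ioo 0 Y, deriv (fun y => p y • a) y = deriv p y • a := fun y hy =>
    ((hp.diff y hy).hasDerivAt.smul_const a).deriv
  have hL : ∀ {q : ℝ → ℝ} (c : L2 Ω), MemLp q 2 (wMeasure b Y) →
      MemLp (fun y => q y • c) 2 (wMeasure b Y) := fun c hq =>
    (ContinuousLinearMap.toSpanSingleton ℝ c).comp_memLp' hq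
  refine ⟨hp.clm_comp (ContinuousLinearMap.toSpanSingleton ℝ a), ae_of_all _ fun y => ha.smul _,
    fun i => ?_, fun i j => ?_, ?_, fun i => ?_, ?_, ?_⟩
  · simp only [ha.weakD_smul hΩ]
    exact hL _ hp.memLp
  · simp only [ha.weakD₂_smul hΩ]
    exact hL _ hp.memLp
  · filter_upwards [ae_mem_Ioo b Y] with y hy i
    rw [hd y hy]
    exact ⟨_, (ha.isWeakPartial hΩ i).smul _⟩
  · refine (memLp_congr_ae ?_).2 (hL (weakD Ω i a) hp.memLp_deriv)
    filter_upwards [ae_mem_Ioo b Y] with y hy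
    rw [hd y hy, ha.weakD_smul hΩ]
  · simp only [hpY, zero_smul]
  · have h := hpY'.smul_const a
    rw [zero_smul] at h
    refine h.congr' ?_
    filter_upwards [self_mem_nhdsWithin] with y hy
    exact (hd y hy).symm

theorem memHtwoLY_zero (hΩ : IsOpen Ω) : MemHtwoLY Ω b Y 0 := by
  have h0 : deriv (0 : ℝ → ℝ) = 0 := by
    funext y
    simp
  have := memHtwoLY_smul_const (b := b) (Y := Y) (p := 0) hΩ MemH2N.zero rfl
    (by rw [h0]; exact tendsto_const_nhds) (H20 Ω).zero_mem
  simp only [Pi.zero_apply, zero_smul] at this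
  exact this

theorem memHtwoLY_of_mem_tensorSpace (hpoly : IsConvexPolytope Ω) (hb : b ∈ Ioo (-1 : ℝ) 1)
    (hY : 0 < Y) {K : Geometry.SimplicialComplex ℝ (Space d)}
    {P : Finset (Space d) → Submodule ℝ (Space d → ℝ)} (hP : IsH2Conforming Ω K P)
    {M : ℕ} {τ : Fin (M + 1) → ℝ} (hτ : IsPartition Y τ)
    (hv : v ∈ tensorSpace (femW Ω K P) (femS Y τ)) : MemHtwoLY Ω b Y v := by
  have hΩ := hpoly.isOpen
  induction hv using Submodule.span_induction with
  | mem x h =>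
    obtain ⟨a, ha, p, hp, rfl⟩ := h
    exact memHtwoLY_smul_const hΩ (memH2N_of_mem_femS hb hY hτ hp) hp.2.2.1
      (femS_tendsto_deriv hY hp) (memH20_of_mem_femW hpoly hP ha)
  | zero => exact memHtwoLY_zero hΩ
  | add x y _ _ h1 h2 => exact h1.add hΩ h2
  | smul c x _ h1 => exact h1.smul hΩ c

theorem MemHtwoLY.memLp_lap (hw : MemHtwoLY Ω b Y w) :
    MemLp (fun y => lap Ω (w y)) 2 (wMeasure b Y) :=
  memLp_finsetSum _ fun i _ => hw.hess i i

theorem MemHtwoLY.memLp_opL (hb : b ∈ Ioo (-1 : ℝ) 1) (hw : MemHtwoLY Ω b Y w) :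
    MemLp (opL Ω b w) 2 (wMeasure b Y) :=
  (hw.memH2N.memLp_opD hb).sub hw.memLp_lap

theorem MemHtwoLY.opL_sub (hΩ : IsOpen Ω) (hb : b ∈ Ioo (-1 : ℝ) 1) (hw : MemHtwoLY Ω b Y w)
    (hv : MemHtwoLY Ω b Y v) : opL Ω b (w - v) =ᵐ[wMeasure b Y] opL Ω b w - opL Ω b v := by
  filter_upwards [hw.memH2N.opD_sub hb hv.memH2N, hw.lateral, hv.lateral] with y h h1 h2
  rw [Pi.sub_apply, opL, opL, opL, h, Pi.sub_apply, h1.lap_sub hΩ h2]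
  abel

/-- `𝕃_b w`, as an element of `L²(y^b, (0,Y); L²(Ω))`. -/
def MemHtwoLY.opLp (hb : b ∈ Ioo (-1 : ℝ) 1) (hw : MemHtwoLY Ω b Y w) :
    Lp (L2 Ω) 2 (wMeasure b Y) := (hw.memLp_opL hb).toLp

theorem MemHtwoLY.opLp_sub (hΩ : IsOpen Ω) (hb : b ∈ Ioo (-1 : ℝ) 1) (hw : MemHtwoLY Ω b Y w)
    (hv : MemHtwoLY Ω b Y v) : (hw.sub hΩ hv).opLp hb = hw.opLp hb - hv.opLp hb := by
  rw [MemHtwoLY.opLp, MemHtwoLY.opLp, MemHtwoLY.opLp, ← MemLp.toLp_sub]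
  exact MemLp.toLp_congr _ _ (hw.opL_sub hΩ hb hv)

theorem MemHtwoLY.inner_opLp (hb : b ∈ Ioo (-1 : ℝ) 1) (hw : MemHtwoLY Ω b Y w)
    (hv : MemHtwoLY Ω b Y v) : inner ℝ (hw.opLp hb) (hv.opLp hb) = energyForm Ω b Y w v := by
  rw [L2.inner_def, energyForm]
  refine integral_congr_ae ?_
  filter_upwards [(hw.memLp_opL hb).coeFn_toLp, (hv.memLp_opL hb).coeFn_toLp] with y h1 h2
  rw [MemHtwoLY.opLp, MemHtwoLY.opLp, h1, h2]

theorem MemHtwoLY.enorm_opLp (hb : b ∈ Ioo (-1 : ℝ) 1) (hw : MemHtwoLY Ω b Y w) :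
    ‖hw.opLp hb‖ₑ = energyNorm Ω b Y w := by
  rw [MemHtwoLY.opLp, Lp.enorm_toLp, energyNorm, wNorm]

theorem MemHtwoLY.energyNorm_lt_top (hb : b ∈ Ioo (-1 : ℝ) 1) (hw : MemHtwoLY Ω b Y w) :
    energyNorm Ω b Y w < ⊤ := (hw.memLp_opL hb).2

end energy

/-- The Galerkin solution is the best approximation in the energy norm. -/
theorem energyNorm_sub_le_of_galerkin (hΩ : IsOpen Ω) (hb : b ∈ Ioo (-1 : ℝ) 1)
    {V : Submodule ℝ (ℝ → L2 Ω)} (hV : ∀ v ∈ V, MemHtwoLY Ω b Y v) {u uh v : ℝ → L2 Ω}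
    (hu : MemHtwoLY Ω b Y u) (huh : uh ∈ V)
    (hG : ∀ v ∈ V, energyForm Ω b Y u v = energyForm Ω b Y uh v) (hv : v ∈ V) :
    energyNorm Ω b Y (u - uh) ≤ energyNorm Ω b Y (u - v) := by
  have h1 := hV uh huh
  have h2 := hV v hv
  have h3 := hV (uh - v) (V.sub_mem huh hv)
  rw [← (hu.sub hΩ h1).enorm_opLp hb, ← (hu.sub hΩ h2).enorm_opLp hb, hu.opLp_sub hΩ hb h1,
    hu.opLp_sub hΩ hb h2]
  -- Galerkin orthogonality, tested with `uh - v`; the inequality is then Pythagoras.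
  have h0 : inner ℝ (hu.opLp hb - h1.opLp hb) (h1.opLp hb - h2.opLp hb) = (0 : ℝ) := by
    rw [← h1.opLp_sub hΩ hb h2, inner_sub_left, (hu.inner_opLp hb h3 :),
      (h1.inner_opLp hb h3 :), hG _ (V.sub_mem huh hv), sub_self]
  rw [← ofReal_norm, ← ofReal_norm]
  refine ENNReal.ofReal_le_ofReal (le_of_sq_le_sq ?_ (norm_nonneg _))
  have e : hu.opLp hb - h2.opLp hb
      = (hu.opLp hb - h1.opLp hb) + (h1.opLp hb - h2.opLp hb) := by abel
  rw [e, norm_add_sq_real, h0]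
  nlinarith [sq_nonneg ‖h1.opLp hb - h2.opLp hb‖]

/-! ### The trace inequality -/

/-- Parseval's identity in extended non-negative form, so that the sum over modes and the integral
in `y` can be exchanged by Tonelli without a summability argument. -/
theorem tsum_enorm_inner_sq {H : Type*} [NormedAddCommGroup H]
    [InnerProductSpace ℝ H] (e : HilbertBasis ℕ ℝ H) (x : H) :
    ∑' k, ‖inner ℝ (e k) x‖ₑ ^ 2 = ‖x‖ₑ ^ 2 := by
  have h := e.hasSum_inner_mul_inner x x
  have h' : HasSum (fun k => inner ℝ (e k) x ^ 2) (‖x‖ ^ 2) := by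
    rw [← real_inner_self_eq_norm_sq]
    refine h.congr_fun fun k => ?_
    rw [real_inner_comm, sq]
  rw [← ofReal_norm, ← ENNReal.ofReal_pow (norm_nonneg _), ← h'.tsum_eq,
    ENNReal.ofReal_tsum_of_nonneg (fun k => sq_nonneg _) h'.summable]
  refine tsum_congr fun k => ?_
  rw [← ofReal_norm, ← ENNReal.ofReal_pow (norm_nonneg _), Real.norm_eq_abs, sq_abs]

/-- Pairing with an eigenfunction commutes with `𝒟_b` and turns `-Δ` into its eigenvalue. Each
coefficient thus satisfies the scalar trace inequality with the same constant, and Parseval's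
identity adds them up. -/
theorem MemHtwoLY.hsNorm_trace_le (hΩ : IsOpen Ω) (eig : DirichletEigensystem Ω) {s : ℝ}
    (hs : s ∈ Ioo (1 : ℝ) 2) (hY : 0 < Y) {w : ℝ → L2 Ω} (hw : MemHtwoLY Ω (bPar s) Y w) :
    hsNorm eig s (trace w) ≤
      ((traceConst (bPar s)).toNNReal ^ (1 / 2 : ℝ) : ℝ≥0) * energyNorm Ω (bPar s) Y w := by
  have hb := bPar_mem_Ioo hs
  set b := bPar s with hbs
  have hC : 0 ≤ traceConst b := by
    have h1 : 0 < 1 - b := by linarith [hb.2]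
    have h2 : 0 < 1 + b := by linarith [hb.1]
    rw [traceConst]
    positivity
  have hmL := hw.memLp_opL hb
  have hk : ∀ k, ENNReal.ofReal (eig.eigval k ^ s * (inner ℝ (eig.eigfun k) (w 0)) ^ 2)
      ≤ ENNReal.ofReal (traceConst b) *
        ∫⁻ y, ‖inner ℝ (eig.eigfun k) (opL Ω b w y)‖ₑ ^ 2 ∂(wMeasure b Y) := by
    intro k
    set L : L2 Ω →L[ℝ] ℝ := innerSL ℝ (eig.eigfun k) with hL
    have hLw := hw.memH2N.clm_comp L
    have h1 := hLw.trace_le hs hY (by rw [hw.top, map_zero]) (eig.eigval_pos k)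
    have hae : ∀ᵐ y ∂(wMeasure b Y), opD b (fun y => L (w y)) y + eig.eigval k * L (w y)
        = L (opL Ω b w y) := by
      filter_upwards [hw.memH2N.opD_clm L hb, hw.lateral] with y hy h2
      have h3 := eig.inner_lap hΩ k h2
      rw [hy, opL, map_sub]
      simp only [hL, innerSL_apply_apply]
      rw [h3]
      ring
    have hae2 : ∀ᵐ y ∂(wMeasure b Y),
        (opD b (fun y => L (w y)) y + eig.eigval k * L (w y)) ^ 2 = L (opL Ω b w y) ^ 2 := by
      filter_upwards [hae] with y hy
      rw [hy]
    rw [← hbs, integral_congr_ae hae2] at h1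
    refine (ENNReal.ofReal_le_ofReal h1).trans ?_
    have hi : Integrable (fun y => L (opL Ω b w y) ^ 2) (wMeasure b Y) :=
      (L.comp_memLp' hmL).integrable_sq
    rw [ENNReal.ofReal_mul hC, ofReal_integral_eq_lintegral_ofReal hi (ae_of_all _ fun y => sq_nonneg _)]
    refine mul_le_mul_right (lintegral_mono fun y => ?_) _
    rw [← ofReal_norm, ← ENNReal.ofReal_pow (norm_nonneg _), Real.norm_eq_abs, sq_abs]
    exact le_rfl
  have hsum : ∑' k, ENNReal.ofReal (eig.eigval k ^ s * (inner ℝ (eig.eigfun k) (w 0)) ^ 2)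
      ≤ ENNReal.ofReal (traceConst b) * energyNorm Ω b Y w ^ 2 := by
    refine (ENNReal.tsum_le_tsum hk).trans (le_of_eq ?_)
    rw [ENNReal.tsum_mul_left, ← lintegral_tsum, energyNorm, wNorm, eLpNorm_two_sq]
    · simp only [tsum_enorm_inner_sq]
    · intro k
      exact (((innerSL ℝ (eig.eigfun k)).comp_memLp' hmL).1.enorm).pow_const 2
  rw [hsNorm, trace]
  refine (ENNReal.rpow_le_rpow hsum (by norm_num)).trans (le_of_eq ?_)
  rw [ENNReal.mul_rpow_of_nonneg _ _ (by norm_num), ← ENNReal.rpow_natCast, ← ENNReal.rpow_mul,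
    ENNReal.coe_rpow_of_nonneg _ (by norm_num), ENNReal.ofReal]
  norm_num

end PolyExt

end

noncomputable section

namespace PolyExt

variable {d : ℕ} {Ω : Set (Space d)} {b Y : ℝ}

/-! ### Projections in the extended variable -/

/-- The weight is positive on `(0,Y)`, so its null sets are Lebesgue null there, and continuity
extends the equality to the closed interval. -/
theorem eqOn_Icc_of_ae_wMeasure {f g : ℝ → ℝ} (hY : 0 < Y) (hf : ContinuousOn f (Icc 0 Y))
    (hg : ContinuousOn g (Icc 0 Y)) (h : ∀ᵐ y ∂(wMeasure b Y), f y = g y) :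
    EqOn f g (Icc 0 Y) := by
  refine Measure.eqOn_Icc_of_ae_eq (volume : Measure ℝ) hY.ne ?_ hf hg
  rw [Filter.EventuallyEq, ← Measure.restrict_congr_set Ioo_ae_eq_Icc]
  exact (restrict_ac_wMeasure b Y).ae_le h

theorem wNorm_inner_le (φ : L2 Ω) {f : ℝ → ℝ} {g : ℝ → L2 Ω}
    (h : ∀ᵐ y ∂(wMeasure b Y), f y = inner ℝ φ (g y)) :
    wNorm b Y f ≤ ‖φ‖ₑ * wNorm b Y g := by
  have := eLpNorm_le_nnreal_smul_eLpNorm_of_ae_le_mul (f := f) (g := g) (c := ‖φ‖₊)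
    (μ := wMeasure b Y) (by
      filter_upwards [h] with y hy
      rw [hy]
      exact nnnorm_inner_le_nnnorm φ (g y)) 2
  exact this

theorem MemH2N.inner_left {w : ℝ → L2 Ω} (hw : MemH2N b Y w) (φ : L2 Ω) :
    MemH2N b Y fun y => inner ℝ φ (w y) :=
  hw.clm_comp (innerSL ℝ φ)

/-- `φ ↦ ⟨φ, w(·)⟩`. -/
def innerLin {w : ℝ → L2 Ω} (hw : MemH2N b Y w) : L2 Ω →ₗ[ℝ] H2N b Y where
  toFun φ := ⟨fun y => inner ℝ φ (w y), hw.inner_left φ⟩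
  map_add' φ ψ := by
    ext y
    exact inner_add_left _ _ _
  map_smul' c φ := by
    ext y
    exact real_inner_smul_left _ _ _

theorem h2nNorm_inner_le (hb : b ∈ Ioo (-1 : ℝ) 1) {w : ℝ → L2 Ω} (hw : MemH2N b Y w) (φ : L2 Ω) :
    h2nNorm b Y (fun y => inner ℝ φ (w y)) ≤
      ‖φ‖ₑ * (wNorm b Y w + wNorm b Y (deriv w) + wNorm b Y (opD b w)) := by
  rw [h2nNorm, mul_add, mul_add]
  refine add_le_add (add_le_add ?_ ?_) ?_
  · exact wNorm_inner_le φ (ae_of_all _ fun y => rfl)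
  · refine wNorm_inner_le φ ?_
    filter_upwards [ae_mem_Ioo b Y] with y hy
    exact ((innerSL ℝ φ).hasFDerivAt.comp_hasDerivAt y (hw.diff y hy).hasDerivAt).deriv
  · exact wNorm_inner_le φ (hw.opD_clm (innerSL ℝ φ) hb)

/-- The tensorized operator exists if the scalar one is bounded. -/
theorem exists_isProjYOf (hb : b ∈ Ioo (-1 : ℝ) 1) {prY : H2N b Y →ₗ[ℝ] (ℝ → ℝ)}
    (hbd : IsBoundedY b Y prY) {w : ℝ → L2 Ω} (hw : MemH2N b Y w) :
    ∃ v : ℝ → L2 Ω, IsProjYOf prY w v := by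
  obtain ⟨c, hc⟩ := hbd
  set N := wNorm b Y w + wNorm b Y (deriv w) + wNorm b Y (opD b w) with hN
  have hNtop : N ≠ ⊤ := by
    refine (ENNReal.add_lt_top.2 ⟨ENNReal.add_lt_top.2 ⟨hw.memLp.2, hw.memLp_deriv.2⟩, ?_⟩).ne
    exact (hw.memLp_opD hb).2
  have hex : ∀ y ∈ Icc 0 Y, ∃ x : L2 Ω, ∀ φ, inner ℝ φ x = prY (innerLin hw φ) y := by
    intro y hy
    -- For fixed `y` the value `Π_y⟨φ, w⟩(y)` is a bounded functional of `φ`; its Riesz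
    -- representative is `v y`.
    set T : L2 Ω →ₗ[ℝ] ℝ := (LinearMap.proj y : (ℝ → ℝ) →ₗ[ℝ] ℝ) ∘ₗ prY ∘ₗ innerLin hw
    have hT : ∀ φ, ‖T φ‖ ≤ (c * N.toReal) * ‖φ‖ := by
      intro φ
      have h1 := (hc (innerLin hw φ) y hy).trans
        (mul_le_mul_right (h2nNorm_inner_le hb hw φ) (c : ℝ≥0∞))
      have h2 : ‖T φ‖ₑ ≤ c * (‖φ‖ₑ * N) := h1
      have h3 := ENNReal.toReal_mono
        (ENNReal.mul_ne_top ENNReal.coe_ne_top (ENNReal.mul_ne_top enorm_ne_top hNtop)) h2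
      rw [toReal_enorm, ENNReal.toReal_mul, ENNReal.toReal_mul, toReal_enorm,
        ENNReal.coe_toReal] at h3
      linarith
    refine ⟨(InnerProductSpace.toDual ℝ (L2 Ω)).symm (T.mkContinuous _ hT), fun φ => ?_⟩
    rw [real_inner_comm, InnerProductSpace.toDual_symm_apply]
    rfl
  choose! v hv using hex
  exact ⟨v, fun φ => ⟨hw.inner_left φ, fun y hy => hv y hy φ⟩⟩

/-- Four distinct points in each cell determine a cubic, so elements of `S` are determined on
`[0,Y]` by finitely many values. -/
theorem IsPartition.finite_nodes {M : ℕ} {τ : Fin (M + 1) → ℝ} (hτ : IsPartition Y τ)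
    (hY : 0 < Y) : ∃ N : Set ℝ, N.Finite ∧ N ⊆ Icc 0 Y ∧
      ∀ p ∈ femS Y τ, (∀ t ∈ N, p t = 0) → ∀ t ∈ Icc 0 Y, p t = 0 := by
  set t : Fin M → Fin 4 → ℝ := fun m j =>
    τ m.castSucc + (j : ℝ) / 3 * (τ m.succ - τ m.castSucc) with ht
  have hlt : ∀ m : Fin M, τ m.castSucc < τ m.succ := fun m => hτ.1 Fin.castSucc_lt_succ
  have hmem : ∀ m j, t m j ∈ Icc (τ m.castSucc) (τ m.succ) := by
    intro m j
    have h1 : (0 : ℝ) ≤ (j : ℝ) := Nat.cast_nonneg _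
    have h2 : (j : ℝ) ≤ 3 := by exact_mod_cast Nat.lt_succ_iff.1 j.2
    have h3 := hlt m
    simp only [ht]
    constructor <;> nlinarith
  refine ⟨range fun q : Fin M × Fin 4 => t q.1 q.2, finite_range _, ?_, ?_⟩
  · rintro _ ⟨q, rfl⟩
    exact ⟨(hτ.mem_Icc _).1.trans (hmem q.1 q.2).1, (hmem q.1 q.2).2.trans (hτ.mem_Icc _).2⟩
  · intro p hp h0 x hx
    obtain ⟨m, hm⟩ := hτ.exists_mem_Icc hY hx
    obtain ⟨q, hq, hpq⟩ := hp.2.1 m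
    have hq0 : q = 0 := by
      refine Polynomial.eq_zero_of_natDegree_lt_card_of_eval_eq_zero q (f := t m) ?_ ?_ ?_
      · intro i j hij
        have h3 := hlt m
        simp only [ht, add_right_inj] at hij
        have h4 := mul_right_cancel₀ (sub_ne_zero.2 h3.ne') hij
        have h5 : (i : ℝ) = (j : ℝ) := by linarith
        exact Fin.ext (by exact_mod_cast h5)
      · intro j
        exact (hpq (hmem m j)).symm.trans (h0 _ ⟨(m, j), rfl⟩)
      · rw [Fintype.card_fin]
        exact Nat.lt_succ_iff.2 (Polynomial.natDegree_le_of_degree_le hq)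
    rw [hpq hm, hq0]
    exact Polynomial.eval_zero

/-- The range of `v = (id ⊗ Π_y) w` is finite-dimensional. -/
theorem IsProjYOf.exists_sum {M : ℕ} {τ : Fin (M + 1) → ℝ} (hτ : IsPartition Y τ) (hY : 0 < Y)
    {prY : H2N b Y →ₗ[ℝ] (ℝ → ℝ)} (hpr : IsProjY b Y (femS Y τ) prY) {w v : ℝ → L2 Ω}
    (h : IsProjYOf prY w v) :
    ∃ (n : ℕ) (f : Fin n → L2 Ω) (p : Fin n → ℝ → ℝ),
      (∀ k, f k ∈ Submodule.span ℝ (v '' Icc 0 Y)) ∧ (∀ k, p k ∈ femS Y τ) ∧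
      ∀ y ∈ Icc 0 Y, v y = ∑ k, p k y • f k := by
  obtain ⟨N, hNf, hNsub, hN⟩ := hτ.finite_nodes hY
  set E : Submodule ℝ (L2 Ω) := Submodule.span ℝ (v '' N)
  have hfd : FiniteDimensional ℝ E := FiniteDimensional.span_of_finite ℝ (hNf.image v)
  -- If `φ` is orthogonal to the values of `v` at the nodes, then `⟨φ, v⟩` coincides on `[0,Y]` with
  -- an element of `S` vanishing at the nodes. It is therefore zero throughout, so no value of `v`
  -- leaves the span.
  have hvE : ∀ y ∈ Icc 0 Y, v y ∈ E := by
    intro y hy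
    rw [← Submodule.orthogonal_orthogonal E, Submodule.mem_orthogonal]
    intro φ hφ
    obtain ⟨hi, hφv⟩ := h φ
    rw [hφv y hy]
    refine hN _ (hpr.range_mem _) (fun t ht => ?_) y hy
    rw [← hφv t (hNsub ht), real_inner_comm]
    exact (Submodule.mem_orthogonal _ _).1 hφ _ (Submodule.subset_span (mem_image_of_mem v ht))
  set e := stdOrthonormalBasis ℝ E
  choose hi hφv using h
  refine ⟨_, fun k => (e k : L2 Ω), fun k => prY ⟨_, hi (e k)⟩, fun k => ?_,
    fun k => hpr.range_mem _, fun y hy => ?_⟩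
  · exact Submodule.span_mono (image_mono hNsub) (e k).2
  · have h1 := congrArg (Subtype.val : E → L2 Ω) (e.sum_repr' ⟨v y, hvE y hy⟩)
    rw [Submodule.coe_sum] at h1
    refine h1.symm.trans (Finset.sum_congr rfl fun k _ => ?_)
    rw [Submodule.coe_smul, Submodule.coe_inner, hφv (e k) y hy]

theorem memH2N_sum {ι : Type*} (s : Finset ι) {w : ι → ℝ → L2 Ω}
    (h : ∀ i ∈ s, MemH2N b Y (w i)) : MemH2N b Y (fun y => ∑ i ∈ s, w i y) := by
  have : (fun y => ∑ i ∈ s, w i y) = ∑ i ∈ s, w i := by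
    funext y
    rw [Finset.sum_apply]
  rw [this]
  exact Finset.sum_induction _ _ (fun _ _ => MemH2N.add) MemH2N.zero h

theorem IsProjYOf.memH2N (hb : b ∈ Ioo (-1 : ℝ) 1) {M : ℕ} {τ : Fin (M + 1) → ℝ}
    (hτ : IsPartition Y τ) (hY : 0 < Y) {prY : H2N b Y →ₗ[ℝ] (ℝ → ℝ)}
    (hpr : IsProjY b Y (femS Y τ) prY) {w v : ℝ → L2 Ω} (h : IsProjYOf prY w v) :
    MemH2N b Y v := by
  obtain ⟨n, f, p, _, hp, hv⟩ := h.exists_sum hτ hY hpr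
  refine (memH2N_sum Finset.univ fun k _ => ?_).congr hv
  exact (memH2N_of_mem_femS hb hY hτ (hp k)).clm_comp (ContinuousLinearMap.toSpanSingleton ℝ (f k))

/-- `id ⊗ Π_y` commutes with the Laplacian. -/
theorem IsProjYOf.memH20_and_lap_eq (hΩ : IsOpen Ω) (hY : 0 < Y) {S : Set (ℝ → ℝ)}
    {prY : H2N b Y →ₗ[ℝ] (ℝ → ℝ)} (hpr : IsProjY b Y S prY) {u z Pu Pz : ℝ → L2 Ω}
    (hu : MemHtwoLY Ω b Y u)
    (huz : ∀ᵐ y ∂(wMeasure b Y), z y = lap Ω (u y))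
    (hPu : IsProjYOf prY u Pu) (hPz : IsProjYOf prY z Pz) {y : ℝ} (hy : y ∈ Icc 0 Y) :
    MemH20 Ω (Pu y) ∧ lap Ω (Pu y) = Pz y := by
  rw [memH20_and_lap_eq_iff hΩ]
  intro α β hαβ
  obtain ⟨h1, e1⟩ := hPu α
  obtain ⟨h2, e2⟩ := hPz β
  rw [e1 y hy, e2 y hy]
  -- For `(α, β)` orthogonal to the graph, `⟨α, u⟩ + ⟨β, z⟩` vanishes almost everywhere, hence on
  -- `[0,Y]` by continuity. The linear map `Π_y` preserves this, which is the orthogonality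
  -- criterion for the projected pair.
  have h0 : EqOn (((⟨_, h1⟩ : H2N b Y) + ⟨_, h2⟩ : H2N b Y) : ℝ → ℝ) (0 : H2N b Y) (Icc 0 Y) := by
    refine eqOn_Icc_of_ae_wMeasure (b := b) hY (MemH2N.cont h1 |>.add (MemH2N.cont h2))
      continuousOn_const ?_
    filter_upwards [hu.lateral, huz] with t ht1 ht2
    exact (memH20_and_lap_eq_iff hΩ).1 ⟨ht1, ht2.symm⟩ α β hαβ
  have := hpr.congr _ _ h0 hy
  rw [map_add, map_zero] at this
  exact this

/-! ### The projection in `Ω` -/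

section projX

variable {W : Set (L2 Ω)} {c₀ c₁ : ℝ≥0} {prX : H20 Ω →ₗ[ℝ] L2 Ω}

theorem IsStableProjX.extX_eq (hΩ : IsOpen Ω) (h : IsStableProjX Ω W c₀ c₁ prX) {a : L2 Ω}
    (ha : MemH20 Ω a) : extX prX a = prX ⟨a, ha⟩ :=
  LinearMap.extendOfNorm_eq (dense_H20 hΩ) ⟨c₀, h.stable⟩ ⟨a, ha⟩

theorem IsStableProjX.norm_extX_le (hΩ : IsOpen Ω) (h : IsStableProjX Ω W c₀ c₁ prX) (a : L2 Ω) :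
    ‖extX prX a‖ ≤ c₀ * ‖a‖ :=
  LinearMap.norm_extendOfNorm_apply_le (dense_H20 hΩ) c₀ h.stable a

theorem IsStableProjX.norm_lap_extX_le (hΩ : IsOpen Ω) (h : IsStableProjX Ω W c₀ c₁ prX)
    {a : L2 Ω} (ha : MemH20 Ω a) : ‖lap Ω (extX prX a)‖ ≤ c₁ * ‖lap Ω a‖ := by
  rw [h.extX_eq hΩ ha]
  exact h.stable_lap _

end projX

/-! ### A weighted triangle inequality in `L²` -/

theorem eLpNorm_const_mul_norm {α E : Type*} [MeasurableSpace α] {μ : Measure α}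
    [NormedAddCommGroup E] (f : α → E) (c : ℝ≥0) :
    eLpNorm (fun x => (c : ℝ) * ‖f x‖) 2 μ = c * eLpNorm f 2 μ := by
  have h := eLpNorm_const_smul (c : ℝ) (fun x => ‖f x‖) 2 μ
  rw [eLpNorm_norm f, Real.enorm_eq_ofReal c.coe_nonneg, ENNReal.ofReal_coe_nnreal] at h
  exact h

/-- A triangle inequality in which one function need not be measurable. -/
theorem eLpNorm_le_of_norm_le {α E₁ E₂ E₃ E₄ F : Type*} [MeasurableSpace α] {μ : Measure α}
    [NormedAddCommGroup E₁] [NormedAddCommGroup E₂] [NormedAddCommGroup E₃]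
    [NormedAddCommGroup E₄] [NormedAddCommGroup F] {f : α → F} {f₁ : α → E₁} {f₂ : α → E₂}
    {f₃ : α → E₃} {f₄ : α → E₄} (hf : AEStronglyMeasurable f μ) (h₁ : AEStronglyMeasurable f₁ μ)
    (h₃ : AEStronglyMeasurable f₃ μ) (h₄ : AEStronglyMeasurable f₄ μ) (c₀ c₁ : ℝ≥0)
    (h : ∀ᵐ x ∂μ, ‖f x‖ ≤ ‖f₁ x‖ + ‖f₂ x‖ + c₀ * ‖f₃ x‖ + c₁ * ‖f₄ x‖) :
    eLpNorm f 2 μ ≤ (1 + c₀ + c₁ : ℝ≥0) *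
      (eLpNorm f₁ 2 μ + eLpNorm f₂ 2 μ + eLpNorm f₃ 2 μ + eLpNorm f₄ 2 μ) := by
  set g₃ : α → ℝ := fun x => (c₀ : ℝ) * ‖f₃ x‖ with hg₃
  set g₄ : α → ℝ := fun x => (c₁ : ℝ) * ‖f₄ x‖ with hg₄
  set G : α → ℝ := fun x => ‖f₁ x‖ + g₃ x + g₄ x with hG
  -- The part of `f` not accounted for by the measurable terms is itself measurable and dominated by
  -- `‖f₂‖`. Only monotonicity of the norm is applied to `f₂`, and this needs no measurability.
  set H : α → ℝ := fun x => max (‖f x‖ - G x) 0 with hH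
  have m₃ : AEStronglyMeasurable g₃ μ := h₃.norm.const_smul (c₀ : ℝ)
  have m₄ : AEStronglyMeasurable g₄ μ := h₄.norm.const_smul (c₁ : ℝ)
  have m₁₃ : AEStronglyMeasurable (fun x => ‖f₁ x‖ + g₃ x) μ := h₁.norm.add m₃
  have mG : AEStronglyMeasurable G μ := m₁₃.add m₄
  have mH : AEStronglyMeasurable H μ := (hf.norm.sub mG).sup aestronglyMeasurable_const
  have e₃ : eLpNorm g₃ 2 μ = c₀ * eLpNorm f₃ 2 μ := eLpNorm_const_mul_norm f₃ c₀
  have e₄ : eLpNorm g₄ 2 μ = c₁ * eLpNorm f₄ 2 μ := eLpNorm_const_mul_norm f₄ c₁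
  have hGle : eLpNorm G 2 μ ≤ eLpNorm f₁ 2 μ + c₀ * eLpNorm f₃ 2 μ + c₁ * eLpNorm f₄ 2 μ := by
    rw [← e₃, ← e₄, ← eLpNorm_norm f₁]
    exact (eLpNorm_add_le m₁₃ m₄ (by norm_num)).trans
      (add_le_add (eLpNorm_add_le h₁.norm m₃ (by norm_num)) le_rfl)
  have hHle : eLpNorm H 2 μ ≤ eLpNorm f₂ 2 μ := by
    refine eLpNorm_mono_ae ?_
    filter_upwards [h] with x hx
    rw [Real.norm_of_nonneg (le_max_right _ _)]
    refine max_le ?_ (norm_nonneg _)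
    simp only [hG, hg₃, hg₄]
    linarith
  have hle : eLpNorm f 2 μ ≤ eLpNorm G 2 μ + eLpNorm H 2 μ := by
    refine (eLpNorm_mono_ae_real (ae_of_all _ fun x => ?_)).trans
      (eLpNorm_add_le mG mH (by norm_num))
    have := le_max_left (‖f x‖ - G x) 0
    change ‖f x‖ ≤ G x + max (‖f x‖ - G x) 0
    linarith
  refine hle.trans ((add_le_add hGle hHle).trans ?_)
  set a₁ := eLpNorm f₁ 2 μ
  set a₂ := eLpNorm f₂ 2 μ
  set a₃ := eLpNorm f₃ 2 μ
  set a₄ := eLpNorm f₄ 2 μ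
  set C : ℝ≥0 := 1 + c₀ + c₁ with hC
  have b1 : (1 : ℝ≥0∞) ≤ C := by
    exact_mod_cast (by rw [hC, add_assoc]; exact le_self_add : (1 : ℝ≥0) ≤ C)
  have b2 : (c₀ : ℝ≥0∞) ≤ C := by
    exact_mod_cast (by rw [hC, add_comm 1 c₀, add_assoc]; exact le_self_add : c₀ ≤ C)
  have b3 : (c₁ : ℝ≥0∞) ≤ C := by
    exact_mod_cast (by rw [hC]; exact le_add_self : c₁ ≤ C)
  calc a₁ + c₀ * a₃ + c₁ * a₄ + a₂ ≤ C * a₁ + C * a₃ + C * a₄ + C * a₂ := by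
        gcongr
        · exact le_mul_of_one_le_left' b1
        · exact le_mul_of_one_le_left' b1
    _ = C * (a₁ + a₂ + a₃ + a₄) := by ring

end PolyExt

end

noncomputable section

namespace PolyExt

variable {d : ℕ} {Ω : Set (Space d)} {b Y : ℝ}

/-! ### The tensor product projection -/

/-- The coefficients of the finite expansion of `Π_y u` lie in the span of its values, hence in
`H²₀(Ω)`. There the extension of `Π_x` agrees with `Π_x` itself and maps into `W`. -/
theorem IsProjYOf.exists_mem_tensorSpace (hΩ : IsOpen Ω) (hY : 0 < Y) {M : ℕ}
    {τ : Fin (M + 1) → ℝ} (hτ : IsPartition Y τ) {W : Set (L2 Ω)} {c₀ c₁ : ℝ≥0}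
    {prX : H20 Ω →ₗ[ℝ] L2 Ω} (hX : IsStableProjX Ω W c₀ c₁ prX) {prY : H2N b Y →ₗ[ℝ] (ℝ → ℝ)}
    (hpr : IsProjY b Y (femS Y τ) prY) {u Pu : ℝ → L2 Ω} (hPu : IsProjYOf prY u Pu)
    (hmem : ∀ y ∈ Icc 0 Y, MemH20 Ω (Pu y)) :
    ∃ v ∈ tensorSpace W (femS Y τ), EqOn v (fun y => extX prX (Pu y)) (Icc 0 Y) := by
  obtain ⟨n, f, p, hf, hp, hv⟩ := hPu.exists_sum hτ hY hpr
  have hspan : Submodule.span ℝ (Pu '' Icc 0 Y) ≤ H20 Ω := by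
    rw [Submodule.span_le]
    rintro _ ⟨y, hy, rfl⟩
    exact hmem y hy
  refine ⟨∑ k, fun y => p k y • extX prX (f k), ?_, fun y hy => ?_⟩
  · refine Submodule.sum_mem _ fun k _ => Submodule.subset_span ⟨_, ?_, p k, hp k, rfl⟩
    rw [hX.extX_eq hΩ (hspan (hf k))]
    exact hX.range_mem _
  · simp only [Finset.sum_apply, hv y hy, map_sum, map_smul]

/-- The error is split by inserting `Π_x u`. A bounded operator in `x` commutes with `𝒟_b`, and
`Π_y` commutes with `Δ`, so each of the four pieces contains only one of the two projection errors.
The `L²` bound handles `Π_x 𝒟(1-Π_y)u`, the bound on Laplacians handles `Δ Π_x (1-Π_y)u`.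
Measurability of `Δ Π_x u` in `y` is not at hand, hence the special triangle inequality. -/
theorem energyNorm_sub_le_of_projections (hΩ : IsOpen Ω) (hb : b ∈ Ioo (-1 : ℝ) 1) (hY : 0 < Y)
    {M : ℕ} {τ : Fin (M + 1) → ℝ} (hτ : IsPartition Y τ) {W : Set (L2 Ω)}
    (hW : ∀ a ∈ W, MemH20 Ω a) {c₀ c₁ : ℝ≥0} {prX : H20 Ω →ₗ[ℝ] L2 Ω}
    (hX : IsStableProjX Ω W c₀ c₁ prX) {prY : H2N b Y →ₗ[ℝ] (ℝ → ℝ)}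
    (hpr : IsProjY b Y (femS Y τ) prY) {u z Pu Pz v : ℝ → L2 Ω} (hu : MemHtwoLY Ω b Y u)
    (hz : MemH2N b Y z) (huz : ∀ᵐ y ∂(wMeasure b Y), z y = lap Ω (u y))
    (hPu : IsProjYOf prY u Pu) (hPz : IsProjYOf prY z Pz) (hv : MemHtwoLY Ω b Y v)
    (hvP : EqOn v (fun y => extX prX (Pu y)) (Icc 0 Y)) :
    energyNorm Ω b Y (u - v) ≤ (1 + c₀ + c₁ : ℝ≥0) *
      (wNorm b Y (fun y => opD b u y - extX prX (opD b u y)) +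
        wNorm b Y (fun y => lap Ω (u y - extX prX (u y))) +
        wNorm b Y (opD b (u - Pu)) + wNorm b Y (fun y => z y - Pz y)) := by
  have hPuN := hPu.memH2N hb hτ hY hpr
  have hPzN := hPz.memH2N hb hτ hY hpr
  have hDu := hu.memH2N.memLp_opD hb
  refine eLpNorm_le_of_norm_le ((hu.sub hΩ hv).memLp_opL hb).1
    (hDu.sub ((extX prX).comp_memLp' hDu)).1 ((hu.memH2N.sub hPuN).memLp_opD hb).1
    (hz.sub hPzN).memLp.1 c₀ c₁ ?_
  filter_upwards [hu.opL_sub hΩ hb hv, hu.lateral, huz, hu.memH2N.opD_sub hb hPuN,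
    hPuN.opD_clm (extX prX) hb, ae_mem_Ioo b Y] with y e1 h1 h2 e2 e3 hy
  have hyI := Ioo_subset_Icc_self hy
  obtain ⟨h3, h4⟩ := hPu.memH20_and_lap_eq hΩ hY hpr hu huz hPz hyI
  have hXm : ∀ {a : L2 Ω}, MemH20 Ω a → MemH20 Ω (extX prX a) := fun {a} ha => by
    rw [hX.extX_eq hΩ ha]
    exact hW _ (hX.range_mem _)
  have e4 : opD b v y = extX prX (opD b Pu y) := by
    rw [← e3]
    exact opD_congr (hvP.mono Ioo_subset_Icc_self) hy
  have e5 : lap Ω (extX prX (u y - Pu y)) = lap Ω (extX prX (u y)) - lap Ω (v y) := by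
    rw [hvP hyI, map_sub]
    exact (hXm h1).lap_sub hΩ (hXm h3)
  have e6 : lap Ω (u y - extX prX (u y)) = lap Ω (u y) - lap Ω (extX prX (u y)) :=
    h1.lap_sub hΩ (hXm h1)
  have e7 : lap Ω (u y - Pu y) = z y - Pz y := by rw [h1.lap_sub hΩ h3, h2, h4]
  have e8 : opL Ω b (u - v) y = (opD b u y - extX prX (opD b u y))
      - lap Ω (u y - extX prX (u y)) + extX prX (opD b (u - Pu) y)
      - lap Ω (extX prX (u y - Pu y)) := by
    rw [e1, Pi.sub_apply, opL, opL, e4, e5, e6, e2, map_sub]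
    abel
  rw [e8]
  refine (norm_sub_le _ _).trans (add_le_add ((norm_add_le _ _).trans
    (add_le_add (norm_sub_le _ _) (hX.norm_extX_le hΩ _))) ?_)
  rw [Pi.sub_apply, ← e7]
  exact hX.norm_lap_extX_le hΩ (h1.sub h3)

end PolyExt

end

/-! ### The best approximation theorem -/

theorem mainTheorem3 (s : ℝ) (hs : s ∈ Set.Ioo (1 : ℝ) 2) :
    ∃ C₁ : ℝ≥0, ∀ c₀ c₁ : ℝ≥0, ∃ C₂ : ℝ≥0,
      ∀ (d : ℕ) (Ω : Set (Space d)) (_ : IsConvexPolytope Ω)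
        (eig : DirichletEigensystem Ω) (Y : ℝ) (_ : 0 < Y)
        (F : ℕ → ℝ) (_ : MemHNeg eig s F)
        (K : Geometry.SimplicialComplex ℝ (Space d)) (_ : IsTriangulation Ω K)
        (P : Finset (Space d) → Submodule ℝ (Space d → ℝ))
        (_ : IsH2Conforming Ω K P)
        (M : ℕ) (τ : Fin (M + 1) → ℝ) (_ : IsPartition Y τ)
        (u : ℝ → L2 Ω) (_ : IsTruncatedSolution eig s Y F u)
        (uh : ℝ → L2 Ω)
        (_ : IsDiscreteSolution eig s Y F
          (tensorSpace (femW Ω K P) (femS Y τ)) uh),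
        hsNorm eig s (trace (u - uh))
            ≤ C₁ * energyNorm Ω (bPar s) Y (u - uh) ∧
        IsLeast
          ((fun v => energyNorm Ω (bPar s) Y (u - v)) ''
            (tensorSpace (femW Ω K P) (femS Y τ) :
              Set (ℝ → L2 Ω)))
          (energyNorm Ω (bPar s) Y (u - uh)) ∧
        energyNorm Ω (bPar s) Y (u - uh) < ⊤ ∧
        ∀ (prX : H20 Ω →ₗ[ℝ] L2 Ω)
          (_ : IsStableProjX Ω (femW Ω K P) c₀ c₁ prX)
          (prY : H2N (bPar s) Y →ₗ[ℝ] (ℝ → ℝ))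
          (_ : IsProjY (bPar s) Y (femS Y τ) prY),
          (IsBoundedY (bPar s) Y prY →
            ∀ w : ℝ → L2 Ω, MemH2N (bPar s) Y w →
              ∃ v : ℝ → L2 Ω, IsProjYOf prY w v) ∧
          ∀ z : ℝ → L2 Ω, MemH2N (bPar s) Y z →
            (∀ᵐ y ∂(wMeasure (bPar s) Y), z y = lap Ω (u y)) →
            ∀ Pu Pz : ℝ → L2 Ω,
              IsProjYOf prY u Pu → IsProjYOf prY z Pz →
              energyNorm Ω (bPar s) Y (u - uh) ≤
                C₂ *
                  (wNorm (bPar s) Y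
                      (fun y => opD (bPar s) u y
                        - extX prX (opD (bPar s) u y)) +
                    wNorm (bPar s) Y
                      (fun y => lap Ω (u y - extX prX (u y))) +
                    wNorm (bPar s) Y
                      (opD (bPar s) (u - Pu)) +
                    wNorm (bPar s) Y (fun y => z y - Pz y)) := by
  refine ⟨(traceConst (bPar s)).toNNReal ^ (1 / 2 : ℝ), fun c₀ c₁ => ⟨1 + c₀ + c₁, ?_⟩⟩
  intro d Ω hpoly eig Y hY F _ K _ P hP M τ hτ u hu uh huh
  have hb := bPar_mem_Ioo hs
  have hΩ := hpoly.isOpen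
  have hV : ∀ v ∈ tensorSpace (femW Ω K P) (femS Y τ), MemHtwoLY Ω (bPar s) Y v :=
    fun v hv => memHtwoLY_of_mem_tensorSpace hpoly hb hY hP hτ hv
  have he := hu.1.sub hΩ (hV uh huh.1)
  have hbest : ∀ v ∈ tensorSpace (femW Ω K P) (femS Y τ),
      energyNorm Ω (bPar s) Y (u - uh) ≤ energyNorm Ω (bPar s) Y (u - v) := fun v hv =>
    energyNorm_sub_le_of_galerkin hΩ hb hV hu.1 huh.1
      (fun v hv => (hu.2 v (hV v hv)).trans (huh.2 v hv).symm) hv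
  refine ⟨he.hsNorm_trace_le hΩ eig hs hY, ⟨⟨uh, huh.1, rfl⟩, ?_⟩, he.energyNorm_lt_top hb, ?_⟩
  · rintro _ ⟨v, hv, rfl⟩
    exact hbest v hv
  · intro prX hX prY hpr
    refine ⟨fun hbd w hw => exists_isProjYOf hb hbd hw, fun z hz huz Pu Pz hPu hPz => ?_⟩
    -- The competitor `Π_x Π_y u` coincides with an element of `V` on `[0,Y]`, which is all that the
    -- energy sees.
    obtain ⟨v, hv, hvP⟩ := hPu.exists_mem_tensorSpace hΩ hY hτ hX hpr fun y hy =>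
      (hPu.memH20_and_lap_eq hΩ hY hpr hu.1 huz hPz hy).1
    exact (hbest v hv).trans (energyNorm_sub_le_of_projections hΩ hb hY hτ
      (fun a ha => memH20_of_mem_femW hpoly hP ha) hX hpr hu.1 hz huz hPu hPz (hV v hv) hvP)
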